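/- **Parameters.** Let $q\in\mathbb C^*$ be not a root of unity, $N\ge 1$, let $j_1,\dots,j_N$ be positive integers or half-integers, $d=2(j_1+\dots+j_N)$, and let $\alpha_0,\dots,\alpha_{N+2}\in\mathbb C^*$ satisfy $\alpha_{k+1}/\alpha_k=q^{-2j_k}$ for $k=1,\dots,N$. Assume that none of $\alpha_1^2/\alpha_0^2$, $\alpha_{N+1}\alpha_{N+2}$, $\alpha_{N+1}/\alpha_{N+2}$, $\alpha_{N+1}\alpha_{N+2}/\alpha_0^2$, $\alpha_{N+1}/(\alpha_{N+2}\alpha_0^2)$, $\alpha_{N+2}^2$ is an integral power of $q^2$. Write $(a;q)_n=\prod_{k<n}(1-aq^k)$, $(a_1,\dots,a_r;q)_n=\prod_i(a_i;q)_n$, $\mathcal N_k=n_1+\dots+n_k$, $\tilde{\mathcal N}_k=\tilde n_1+\dots+\tilde n_k$. **Polynomials.** Let $\bar p_n(x;a,b,c,d)=\frac{(ab,ac,ad;q^2)_n}{a^n}\,{}_4\phi_3\!\left({q^{-2n},\,abcdq^{2n-2},\,az,\,az^{-1}\atop ab,\,ac,\,ad};q^2,q^2\right)$, $x=\frac12(z+z^{-1})$,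 be the Askey–Wilson polynomials in base $q^2$. With $z_{N+1}=\alpha_{N+2}$, $x_j=\frac12(z_j+z_j^{-1})$, put $$\widehat Q(\{n\},\{x\})=\frac{(\alpha_{N+1}\alpha_{N+2})^{\mathcal N_N}}{(\alpha_{N+1}\alpha_{N+2},\frac{\alpha_{N+1}\alpha_{N+2}}{\alpha_0^2};q^2)_{\mathcal N_N}}\prod_{j=1}^N\frac{\bar p_{n_j}\big(x_j;\alpha_jq^{2\mathcal N_{j-1}},\frac{\alpha_j}{\alpha_0^2}q^{2\mathcal N_{j-1}},\frac{\alpha_{j+1}}{\alpha_j}z_{j+1},\frac{\alpha_{j+1}}{\alpha_j}z_{j+1}^{-1}\big)}{\alpha_j^{n_j}(\alpha_{j+1}^2/\alpha_j^2;q^2)_{n_j}}.$$ The discretized Gasper–Rahman polynomial $\widetilde Q(\{n\},\{\tilde n\})$ is $\widehat Q(\{n\},\{x\})$ at $z_k=\frac{\alpha_{N+1}\alpha_{N+2}}{\alpha_k}q^{2\tilde{\mathcal N}_{N+1-k}}$ $(1\le k\le N)$. Indices range over the grids $0\le n_k\le 2j_k$ and $0\le\tilde n_{N+1-k}\le 2j_k$.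 **Operators.** For $\nu\in\{0,\pm1\}^N\setminus\{0\}$ with nonzero entries in positions $i_1<\dots<i_s$, put $\zeta_j=z_j^{-1}$ if $\nu_j=-1$, $\zeta_j=z_j$ otherwise, and $$\Phi_\nu=(1-\alpha_{i_1}\zeta_{i_1})\Big(1-\tfrac{\alpha_{i_1}\zeta_{i_1}}{\alpha_0^2}\Big)\frac{\prod_{k=2}^s\big(1-\frac{\alpha_{i_k}\zeta_{i_k}\zeta_{i_{k-1}}}{\alpha_{i_{k-1}}}\big)\big(1-\frac{q^2\alpha_{i_k}\zeta_{i_k}\zeta_{i_{k-1}}}{\alpha_{i_{k-1}}}\big)}{\prod_{k=1}^s(1-\zeta_{i_k}^2)(1-q^2\zeta_{i_k}^2)}\Big(1-\tfrac{\alpha_{N+1}\alpha_{N+2}\zeta_{i_s}}{\alpha_{i_s}}\Big)\Big(1-\tfrac{\alpha_{N+1}\zeta_{i_s}}{\alpha_{i_s}\alpha_{N+2}}\Big).$$ Let $E_{z_j}$ be the shift $z_j\mapsto q^2z_j$, $\Delta_{z_j}=E_{z_j}-1$, $\nabla_{z_j}=1-E_{z_j}^{-1}$, and, with $\nu_j^{+}=\max(\nu_j,0)$,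 $\nu_j^{-}=\max(-\nu_j,0)$, $|\nu^-|=\sum_j\nu^-_j$, $$\mathbb D^{*}_{\{z\}}=\frac{\alpha_0q}{\alpha_{N+1}}\Big(\sum_{\nu\ne0}(-1)^{|\nu^-|}\Phi_\nu\,\Delta_z^{\nu^+}\nabla_z^{\nu^-}+1+\frac{\alpha_{N+1}^2}{q^2\alpha_0^2}\Big).$$ $\mathbb D_{\{n\}}$ is obtained from $\mathbb D^*_{\{z\}}$ by the simultaneous substitution $\alpha_0\mapsto\alpha_0$, $\alpha_j\mapsto\frac{\alpha_0\alpha_{N+1}\alpha_{N+2}q}{\alpha_{N+2-j}}$ $(1\le j\le N+1)$, $\alpha_{N+2}\mapsto\frac{\alpha_1}{\alpha_0q}$, $z_j\mapsto\frac{\alpha_{N+2-j}}{\alpha_0q}q^{2\mathcal N_{N+1-j}}$, $E_{z_j}\mapsto E_{n_{N+1-j}}E_{n_{N+2-j}}^{-1}$, where $E_{n_k}$ is $n_k\mapsto n_k+1$ and $E_{n_{N+1}}=1$. $\mathbb D^*_{\{\tilde n\}}$ is obtained from $\mathbb D^*_{\{z\}}$ by $z_k\mapsto\frac{\alpha_{N+1}\alpha_{N+2}}{\alpha_k}q^{2\tilde{\mathcal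 N}_{N+1-k}}$, $E_{z_j}\mapsto E_{\tilde n_{N+1-j}}E_{\tilde n_{N+2-j}}^{-1}$, $E_{\tilde n_{N+1}}=1$. Put $$\theta_p=\tfrac12\Big(\tfrac{\alpha_1}{\alpha_{N+1}\alpha_{N+2}}q^{-2p}+\tfrac{\alpha_{N+1}\alpha_{N+2}}{\alpha_1}q^{2p}\Big),\qquad \theta^*_p=\tfrac12\Big(\tfrac{\alpha_0q}{\alpha_{N+1}}q^{-2p}+\tfrac{\alpha_{N+1}}{\alpha_0q}q^{2p}\Big).$$ **Modules.** The $q$-Onsager algebra is the unital associative $\mathbb C$-algebra with generators $\mathsf W_0,\mathsf W_1$ and relations $[\mathsf W_0,[\mathsf W_0,[\mathsf W_0,\mathsf W_1]_q]_{q^{-1}}]=\rho[\mathsf W_0,\mathsf W_1]$, $[\mathsf W_1,[\mathsf W_1,[\mathsf W_1,\mathsf W_0]_q]_{q^{-1}}]=\rho[\mathsf W_1,\mathsf W_0]$, where $[X,Y]_q=qXY-q^{-1}YX$ and $\rho=-(q^2-q^{-2})^2/4$. A module $U$ over it *admits two dual bases* if it has a basis $\psi(\{n\})$ and a basis $\varphi(\{\tilde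 n\})$, indexed by the two grids, with $$\mathsf W_0\psi=\tfrac12\mathbb D_{\{n\}}\psi,\quad \mathsf W_1\psi=\theta^*_{\mathcal N_N}\psi,\qquad \mathsf W_0\varphi=\theta_{\tilde{\mathcal N}_N}\varphi,\quad \mathsf W_1\varphi=\tfrac12\mathbb D^*_{\{\tilde n\}}\varphi,$$ where $\psi,\varphi$ are read as $0$ outside the grids. Numbers $P(\{n\},\{\tilde n\})$ are the *overlap coefficients* of the bases if $\langle\psi(\{n\}),\varphi(\{\tilde n\})\rangle=P(\{n\},\{\tilde n\})$ for a nondegenerate symmetric bilinear form on $U$ for which each of the two bases is orthogonal. A *tridiagonal pair* on a nonzero finite-dimensional $\mathbb C$-space $U$ is a pair $A,A^*$ of diagonalizable linear maps such that (ii) the eigenspaces of $A$ can be ordered $U_0,\dots,U_d$ with $A^*U_p\subseteq U_{p-1}+U_p+U_{p+1}$ ($U_{-1}=U_{d+1}=0$), (iii) the same holds with $A$ and $A^*$ interchanged (such orderings are called standard), and (iv) no subspace other than $0$ and $U$ is invariant under both. It is *of $q$-Racah type* if, for some standard orderings, the eigenvalues have the form $a+bq^{2p-d}+cq^{d-2p}$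 and $a^*+b^*q^{2p-d}+c^*q^{d-2p}$ ($0\le p\le d$) with $b,c,b^*,c^*\neq0$. **Theorem.** 1. On the grids, $\tfrac12\mathbb D_{\{n\}}\widetilde Q(\{n\},\{\tilde n\})=\theta_{\tilde{\mathcal N}_N}\widetilde Q(\{n\},\{\tilde n\})$ and $\tfrac12\mathbb D^*_{\{\tilde n\}}\widetilde Q(\{n\},\{\tilde n\})=\theta^*_{\mathcal N_N}\widetilde Q(\{n\},\{\tilde n\})$, whatever values are assigned to $\widetilde Q$ outside the grids (both recurrences terminate). 2. There is a module of the $q$-Onsager algebra admitting two dual bases, with overlap coefficients $\widetilde Q(\{n\},\{\tilde n\})$. 3. Let $U$ be any module of the $q$-Onsager algebra admitting two dual bases $\psi,\varphi$. Then $\mathsf W_0,\mathsf W_1$ are diagonalizable on $U$, their distinct eigenvalues are $\theta_0,\dots,\theta_d$ and $\theta^*_0,\dots,\theta^*_d$, and these orders of the eigenspaces are standard. If $U$ is irreducible, then $\mathsf W_0,\mathsf W_1$ act on $U$ as a tridiagonal pair of $q$-Racah type, and the $\widetilde Q(\{n\},\{\tilde n\})$ are, for one suitable form, the overlap coefficients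 between $\psi$ and $\varphi$. -/

import Mathlib

noncomputable section

namespace GasperRahman

/-! ### `q`-shifted factorials and Askey-Wilson polynomials -/

/-- The `q`-shifted factorial `(a;q)_n = ∏_{k<n} (1 - a q^k)`. -/
def qPoch (a q : ℂ) (n : ℕ) : ℂ := ∏ k ∈ Finset.range n, (1 - a * q ^ k)

/-- The Askey-Wilson polynomial `p_n(x;a,b,c,d)` in base `q`, with `x = (z + z⁻¹)/2`, as a function
of `z`: `(ab,ac,ad;q)_n / a^n` times the terminating series
`₄φ₃(q⁻ⁿ, abcd qⁿ⁻¹, az, az⁻¹; ab, ac, ad; q, q)`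
(the terms of index `k > n` vanish because of the factor `(q⁻ⁿ;q)_k`). -/
def askeyWilson (q : ℂ) (n : ℕ) (a b c d z : ℂ) : ℂ :=
  qPoch (a * b) q n * qPoch (a * c) q n * qPoch (a * d) q n / a ^ n *
    ∑ k ∈ Finset.range (n + 1),
      qPoch (q ^ (-(n : ℤ))) q k * qPoch (a * b * c * d * q ^ ((n : ℤ) - 1)) q k *
          qPoch (a * z) q k * qPoch (a * z⁻¹) q k /
        (qPoch (a * b) q k * qPoch (a * c) q k * qPoch (a * d) q k * qPoch q q k) * q ^ k

/-! ### Gasper-Rahman polynomials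

The parameters `α₀, …, α_{N+2}` are the first `N + 3` values of a sequence `α : ℕ → ℂ`.
A vector `(v₁, …, v_N)` is a function on `Fin N`; the index `i : Fin N` stands for `i + 1`. -/

/-- The partial sum `v₁ + ⋯ + v_k`. -/
def psum {A : Type*} [AddCommMonoid A] {N : ℕ} (v : Fin N → A) (k : ℕ) : A :=
  ∑ i : Fin N with i.val < k, v i

/-- `z_{j+1}` for `j = i + 1`, where `z_{N+1} = α_{N+2}`. -/
def zNext {N : ℕ} (α : ℕ → ℂ) (z : Fin N → ℂ) (i : Fin N) : ℂ :=
  if h : i.val + 1 < N then z ⟨i.val + 1, h⟩ else α (N + 2)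

/-- The Gasper-Rahman polynomial `Q^{(N)}({n},{x},{α})`, with `x_j = (z_j + z_j⁻¹)/2`: the product
over `j = 1, …, N` of the Askey-Wilson polynomials in base `q²`
`p_{n_j}(x_j; α_j q^{2N_{j-1}}, (α_j/α₀²) q^{2N_{j-1}}, (α_{j+1}/α_j) z_{j+1},
(α_{j+1}/α_j) z_{j+1}⁻¹)`, where `N_j = n₁ + ⋯ + n_j`. -/
def grPoly {N : ℕ} (q : ℂ) (α : ℕ → ℂ) (n : Fin N → ℕ) (z : Fin N → ℂ) : ℂ :=
  ∏ i : Fin N,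
    askeyWilson (q ^ 2) (n i)
      (α (i + 1) * q ^ (2 * psum n i))
      (α (i + 1) / α 0 ^ 2 * q ^ (2 * psum n i))
      (α (i + 2) / α (i + 1) * zNext α z i)
      (α (i + 2) / α (i + 1) * (zNext α z i)⁻¹)
      (z i)

/-- The normalized Gasper-Rahman polynomial. -/
def grPolyNormalized {N : ℕ} (q : ℂ) (α : ℕ → ℂ) (n : Fin N → ℕ) (z : Fin N → ℂ) : ℂ :=
  (α (N + 1) * α (N + 2)) ^ psum n N /
      (qPoch (α (N + 1) * α (N + 2)) (q ^ 2) (psum n N) *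
        qPoch (α (N + 1) * α (N + 2) / α 0 ^ 2) (q ^ 2) (psum n N)) *
    (1 / ∏ i : Fin N,
      (α (i + 1) ^ n i * qPoch (α (i + 2) ^ 2 / α (i + 1) ^ 2) (q ^ 2) (n i))) *
    grPoly q α n z

/-- The discrete support
`z_k = (α_{N+1} α_{N+2} / α_k) q^{2(ñ₁ + ⋯ + ñ_{N+1-k})}`, `k = 1, …, N`. -/
def supportZ {N : ℕ} (q : ℂ) (α : ℕ → ℂ) (nt : Fin N → ℤ) (i : Fin N) : ℂ :=
  α (N + 1) * α (N + 2) / α (i + 1) * q ^ (2 * psum nt (N - i))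

/-! ### The `q`-difference operator and its difference versions -/

/-- Translation by `e` on functions of `e ∈ ℤ^N`: `(E^e F)(x) = F(x + e)`. -/
def shiftOp {N : ℕ} (V : Type*) [AddCommGroup V] [Module ℂ V] (e : Fin N → ℤ) :
    Module.End ℂ ((Fin N → ℤ) → V) :=
  LinearMap.funLeft ℂ V (fun x => x + e)

/-- `Δ_j = E_j - 1` if the sign is `1`, `∇_j = 1 - E_j⁻¹` if it is `-1`, and `1` if it is `0`. -/
def differenceFactor {N : ℕ} (V : Type*) [AddCommGroup V] [Module ℂ V] (j : Fin N) :
    SignType → Module.End ℂ ((Fin N → ℤ) → V)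
  | .pos => shiftOp V (Pi.single j 1) - 1
  | .neg => 1 - shiftOp V (-Pi.single j 1)
  | .zero => 1

/-- `Δ^{ν⁺} ∇^{ν⁻}`, the product over the coordinates (its factors commute). -/
def differenceProduct {N : ℕ} (V : Type*) [AddCommGroup V] [Module ℂ V] (ν : Fin N → SignType) :
    Module.End ℂ ((Fin N → ℤ) → V) :=
  (List.ofFn fun j => differenceFactor V j (ν j)).prod

/-- The coefficient `Φ_ν({z})` for nonzero `ν ∈ {-1,0,1}^N`, where `i₁ < ⋯ < i_s` are the positions
of the nonzero components of `ν`; each `z_j` with `ν_j = -1` is replaced by `z_j⁻¹`. -/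
def Phi {N : ℕ} (q : ℂ) (α : ℕ → ℂ) (ν : Fin N → SignType) (z : Fin N → ℂ) : ℂ :=
  let ζ : Fin N → ℂ := fun j => if ν j = -1 then (z j)⁻¹ else z j
  let l : List (Fin N) := (List.finRange N).filter fun j => ν j ≠ 0
  -- factors with `i₁`
  (l.head?.elim 1 fun i => (1 - α (i + 1) * ζ i) * (1 - α (i + 1) * ζ i / α 0 ^ 2)) *
  -- factors with the consecutive pairs `i_{k-1}, i_k`
  (((l.zip l.tail).map fun p =>
      (1 - α (p.2 + 1) * ζ p.2 * ζ p.1 / α (p.1 + 1)) *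
        (1 - q ^ 2 * α (p.2 + 1) * ζ p.2 * ζ p.1 / α (p.1 + 1))).prod /
    (l.map fun i => (1 - ζ i ^ 2) * (1 - q ^ 2 * ζ i ^ 2)).prod) *
  -- factors with `i_s`
  (l.getLast?.elim 1 fun i =>
    (1 - α (N + 1) * α (N + 2) * ζ i / α (i + 1)) *
      (1 - α (N + 1) * ζ i / (α (i + 1) * α (N + 2))))

/-- The value at the point `z` of `𝔻_{z}^{*(N)} f`, Iliev's `q`-difference operator, where `F e = f(q^{2e} z)` for `e ∈ ℤ^N`
(so that the `q`-shift in `z_j` is translation by the `j`-th unit vector):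
`(α₀ q/α_{N+1}) (∑_{ν ≠ 0} (-1)^{|ν⁻|} Φ_ν(z) Δ^{ν⁺} ∇^{ν⁻} + 1 + α_{N+1}²/(q² α₀²)) f`. -/
def operatorAt {N : ℕ} {V : Type*} [AddCommGroup V] [Module ℂ V] (q : ℂ) (α : ℕ → ℂ)
    (z : Fin N → ℂ) (F : (Fin N → ℤ) → V) : V :=
  (α 0 * q / α (N + 1)) •
    ((∑ ν : Fin N → SignType with ν ≠ 0,
        ((-1 : ℂ) ^ (Finset.univ.filter fun j => ν j = -1).card * Phi q α ν z) •
          differenceProduct V ν F 0) +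
      (1 + α (N + 1) ^ 2 / (q ^ 2 * α 0 ^ 2)) • F 0)

/-- The dual parameters: `α₀ ↦ α₀`, `α_j ↦ α₀ α_{N+1} α_{N+2} q / α_{N+2-j}` for `1 ≤ j ≤ N+1`, and
`α_{N+2} ↦ α₁/(α₀ q)`. -/
def dualParam (N : ℕ) (q : ℂ) (α : ℕ → ℂ) (j : ℕ) : ℂ :=
  if j = 0 then α 0
  else if j ≤ N + 1 then α 0 * α (N + 1) * α (N + 2) * q / α (N + 2 - j)
  else α 1 / (α 0 * q)

/-- The dual variables: `z_j ↦ (α_{N+2-j}/(α₀ q)) q^{2(n₁ + ⋯ + n_{N+1-j})}`. -/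
def dualZ {N : ℕ} (q : ℂ) (α : ℕ → ℂ) (n : Fin N → ℤ) (i : Fin N) : ℂ :=
  α (N + 1 - i) / (α 0 * q) * q ^ (2 * psum n (N - i))

/-- The translation of `(n₁, …, n_N)` that corresponds to `∏_j E_{z_j}^{e_j}` when
`E_{z_j} ↦ E_{n_{N+1-j}} E_{n_{N+2-j}}⁻¹` with `E_{n_{N+1}} = 1`:
the `k`-th component is `e_{N+1-k} - e_{N+2-k}`, with `e_{N+1} = 0`. -/
def indexShift {N : ℕ} (e : Fin N → ℤ) (i : Fin N) : ℤ :=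
  e i.rev - if h : 0 < i.val then e (Fin.rev ⟨i.val - 1, by omega⟩) else 0

/-- The difference operator `𝔻_{n}^{(N)}`, the image of `𝔻_{z}^{*(N)}` under
`α ↦ dualParam`, `z ↦ dualZ`, `E_{z_j} ↦ E_{n_{N+1-j}} E_{n_{N+2-j}}⁻¹`. -/
def Dn {N : ℕ} {V : Type*} [AddCommGroup V] [Module ℂ V] (q : ℂ) (α : ℕ → ℂ)
    (f : (Fin N → ℤ) → V) (n : Fin N → ℤ) : V :=
  operatorAt q (dualParam N q α) (dualZ q α n) fun e => f (n + indexShift e)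

/-- The dual difference operator `𝔻_{ñ}^{*(N)}`, the restriction of `𝔻_{z}^{*(N)}` to the discrete
support `supportZ`, on which `z_j ↦ q² z_j` amounts to
`ñ_{N+1-j} ↦ ñ_{N+1-j} + 1`, `ñ_{N+2-j} ↦ ñ_{N+2-j} - 1`. -/
def DStarNt {N : ℕ} {V : Type*} [AddCommGroup V] [Module ℂ V] (q : ℂ) (α : ℕ → ℂ)
    (f : (Fin N → ℤ) → V) (nt : Fin N → ℤ) : V :=
  operatorAt q α (supportZ q α nt) fun e => f (nt + indexShift e)

/-- The eigenvalue `θ_p` of `W₀`, for `p = ñ₁ + ⋯ + ñ_N`. -/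
def theta (N : ℕ) (q : ℂ) (α : ℕ → ℂ) (p : ℤ) : ℂ :=
  1 / 2 * (α 1 / (α (N + 1) * α (N + 2)) * q ^ (-2 * p) +
    α (N + 1) * α (N + 2) / α 1 * q ^ (2 * p))

/-- The eigenvalue `θ*_p` of `W₁`, for `p = n₁ + ⋯ + n_N`. -/
def thetaStar (N : ℕ) (q : ℂ) (α : ℕ → ℂ) (p : ℤ) : ℂ :=
  1 / 2 * (α 0 * q / α (N + 1) * q ^ (-2 * p) + α (N + 1) / (α 0 * q) * q ^ (2 * p))

/-! ### The finite grids -/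

/-- The multi-indices `(n₁, …, n_N)` with `0 ≤ n_k ≤ m_k`. -/
abbrev Grid {N : ℕ} (m : Fin N → ℕ) : Type := (i : Fin N) → Fin (m i + 1)

/-- The multi-indices `(ñ₁, …, ñ_N)` with `0 ≤ ñ_{N+1-k} ≤ m_k`. -/
abbrev DualGrid {N : ℕ} (m : Fin N → ℕ) : Type := Grid fun i => m i.rev

/-- A grid point as a vector of natural numbers. -/
def Grid.toNat {N : ℕ} {m : Fin N → ℕ} (n : Grid m) : Fin N → ℕ := fun i => (n i : ℕ)

/-- A grid point as a vector of integers. -/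
def Grid.toInt {N : ℕ} {m : Fin N → ℕ} (n : Grid m) : Fin N → ℤ := fun i => ((n i : ℕ) : ℤ)

/-- Extension by zero to `ℤ^N` of a function on a grid. -/
def extendByZero {N : ℕ} {m : Fin N → ℕ} {V : Type*} [Zero V] (f : Grid m → V) :
    (Fin N → ℤ) → V :=
  Function.extend Grid.toInt f 0

/-- The normalized Gasper-Rahman polynomials on the discrete support. -/
def discretizedPoly {N : ℕ} {m : Fin N → ℕ} (q : ℂ) (α : ℕ → ℂ) (n : Grid m) (nt : DualGrid m) :
    ℂ :=
  grPolyNormalized q α n.toNat (supportZ q α (Grid.toInt nt))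

/-! ### The `q`-Onsager algebra -/

/-- The `q`-commutator `[X,Y]_q = q XY - q⁻¹ YX`. -/
def qComm {R : Type*} [Ring R] [Algebra ℂ R] (q : ℂ) (X Y : R) : R :=
  q • (X * Y) - q⁻¹ • (Y * X)

/-- The defining relations of the `q`-Onsager algebra with parameters `q`, `ρ`:
`[W₀,[W₀,[W₀,W₁]_q]_{q⁻¹}] = ρ [W₀,W₁]` and `[W₁,[W₁,[W₁,W₀]_q]_{q⁻¹}] = ρ [W₁,W₀]`. -/
inductive OnsagerRel (q ρ : ℂ) : FreeAlgebra ℂ (Fin 2) → FreeAlgebra ℂ (Fin 2) → Prop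
  | rel (i j : Fin 2) (h : i ≠ j) :
    OnsagerRel q ρ
      ⁅FreeAlgebra.ι ℂ i, qComm q⁻¹ (FreeAlgebra.ι ℂ i)
        (qComm q (FreeAlgebra.ι ℂ i) (FreeAlgebra.ι ℂ j))⁆
      (ρ • ⁅FreeAlgebra.ι ℂ i, FreeAlgebra.ι ℂ j⁆)

/-- The `q`-Onsager algebra: the unital associative algebra with two generators and these
relations. -/
def QOnsager (q ρ : ℂ) : Type := RingQuot (OnsagerRel q ρ)

instance (q ρ : ℂ) : Ring (QOnsager q ρ) := inferInstanceAs (Ring (RingQuot (OnsagerRel q ρ)))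

instance (q ρ : ℂ) : Algebra ℂ (QOnsager q ρ) :=
  inferInstanceAs (Algebra ℂ (RingQuot (OnsagerRel q ρ)))

/-- The standard generators `W₀`, `W₁`. -/
def QOnsager.W (q ρ : ℂ) (i : Fin 2) : QOnsager q ρ :=
  RingQuot.mkAlgHom ℂ (OnsagerRel q ρ) (FreeAlgebra.ι ℂ i)

/-- The module given by the representation `π` is irreducible. -/
def IsIrreducibleRep {R U : Type*} [Ring R] [Algebra ℂ R] [AddCommGroup U] [Module ℂ U]
    (π : R →ₐ[ℂ] Module.End ℂ U) : Prop :=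
  Nontrivial U ∧
    ∀ W : Submodule ℂ U, (∀ a : R, ∀ u ∈ W, π a u ∈ W) → W = ⊥ ∨ W = ⊤

/-! ### Tridiagonal pairs -/

section Tridiagonal

variable {U : Type*} [AddCommGroup U] [Module ℂ U]

/-- `A` is diagonalizable: `U` is spanned by the eigenspaces of `A`. -/
def IsDiagonalizable (A : Module.End ℂ U) : Prop := ⨆ μ : ℂ, A.eigenspace μ = ⊤

/-- The eigenspaces `U_0, …, U_d` of `A` belonging to `θ_0, …, θ_d` form an ordering of all
the eigenspaces of `A` such that `B U_p ⊆ U_{p-1} + U_p + U_{p+1}`, with `U_{-1} = U_{d+1} = 0`. -/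
structure IsStandardOrdering (A B : Module.End ℂ U) (d : ℕ) (θ : Fin (d + 1) → ℂ) : Prop where
  injective : Function.Injective θ
  hasEigenvalue_iff : ∀ μ : ℂ, A.HasEigenvalue μ ↔ ∃ p, θ p = μ
  tridiagonal : ∀ p : Fin (d + 1),
    (A.eigenspace (θ p)).map B ≤
      ⨆ r : {r : Fin (d + 1) // r.val ≤ p.val + 1 ∧ p.val ≤ r.val + 1}, A.eigenspace (θ r)

/-- `A`, `A*` is a tridiagonal pair on `U`. -/
structure IsTDPair (A Astar : Module.End ℂ U) : Prop where
  finiteDimensional : FiniteDimensional ℂ U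
  nontrivial : Nontrivial U
  diagonalizable : IsDiagonalizable A
  diagonalizable_star : IsDiagonalizable Astar
  ordering : ∃ (d : ℕ) (θ : Fin (d + 1) → ℂ), IsStandardOrdering A Astar d θ
  ordering_star : ∃ (d : ℕ) (θ : Fin (d + 1) → ℂ), IsStandardOrdering Astar A d θ
  irreducible : ∀ W : Submodule ℂ U,
    (∀ u ∈ W, A u ∈ W) → (∀ u ∈ W, Astar u ∈ W) → W = ⊥ ∨ W = ⊤

/-- `A`, `A*` is a tridiagonal pair of `q`-Racah type: in standard orderings,
`θ_p = a + b q^{2p-d} + c q^{d-2p}` and `θ*_p = a* + b* q^{2p-d} + c* q^{d-2p}` with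
`b, c, b*, c*` nonzero, where `q ≠ 0`, `q² ≠ 1`, `q² ≠ -1`. -/
def IsTDPairOfQRacahType (q : ℂ) (A Astar : Module.End ℂ U) : Prop :=
  IsTDPair A Astar ∧ q ≠ 0 ∧ q ^ 2 ≠ 1 ∧ q ^ 2 ≠ -1 ∧
    ∃ (d : ℕ) (θ θs : Fin (d + 1) → ℂ) (a b c as bs cs : ℂ),
      IsStandardOrdering A Astar d θ ∧ IsStandardOrdering Astar A d θs ∧
      b ≠ 0 ∧ c ≠ 0 ∧ bs ≠ 0 ∧ cs ≠ 0 ∧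
      (∀ p : Fin (d + 1),
        θ p = a + b * q ^ (2 * (p.val : ℤ) - d) + c * q ^ ((d : ℤ) - 2 * p.val)) ∧
      ∀ p : Fin (d + 1),
        θs p = as + bs * q ^ (2 * (p.val : ℤ) - d) + cs * q ^ ((d : ℤ) - 2 * p.val)

end Tridiagonal

/-! ### The two dual bases -/

section Bases

variable {N : ℕ} {m : Fin N → ℕ} {U : Type*} [AddCommGroup U] [Module ℂ U]

/-- On `ψ(n)`, `W₀` acts as `½ 𝔻_{n}^{(N)}` and `W₁` acts as `θ*_{n}`. -/
def ActsOnBasis (q : ℂ) (α : ℕ → ℂ) (W₀ W₁ : Module.End ℂ U) (ψ : Module.Basis (Grid m) ℂ U) :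
    Prop :=
  ∀ n : Grid m,
    W₀ (ψ n) = (1 / 2 : ℂ) • Dn q α (extendByZero ψ) n.toInt ∧
    W₁ (ψ n) = thetaStar N q α (psum n.toInt N) • ψ n

/-- On `φ(ñ)`, `W₀` acts as `θ_{ñ}` and `W₁` acts as `½ 𝔻_{ñ}^{*(N)}`. -/
def ActsOnDualBasis (q : ℂ) (α : ℕ → ℂ) (W₀ W₁ : Module.End ℂ U)
    (φ : Module.Basis (DualGrid m) ℂ U) : Prop :=
  ∀ nt : DualGrid m,
    W₀ (φ nt) = theta N q α (psum (Grid.toInt nt) N) • φ nt ∧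
    W₁ (φ nt) = (1 / 2 : ℂ) • DStarNt q α (extendByZero φ) (Grid.toInt nt)

/-- `P` is the family of overlap coefficients between the bases `ψ` and `φ`: the scalar products
`⟨ψ_i, φ_j⟩` for a nondegenerate symmetric bilinear form for which each of the two bases is
orthogonal. Equivalently `ψ_i = ∑_j (P i j / ⟨φ_j, φ_j⟩) φ_j` and
`φ_j = ∑_i (P i j / ⟨ψ_i, ψ_i⟩) ψ_i`, with nonzero `⟨ψ_i, ψ_i⟩`, `⟨φ_j, φ_j⟩`. -/
def AreOverlapCoefficients {I J : Type*} (ψ : Module.Basis I ℂ U) (φ : Module.Basis J ℂ U)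
    (P : I → J → ℂ) : Prop :=
  ∃ B : LinearMap.BilinForm ℂ U, B.IsSymm ∧ B.Nondegenerate ∧
    (∀ i i', i ≠ i' → B (ψ i) (ψ i') = 0) ∧ (∀ j j', j ≠ j' → B (φ j) (φ j') = 0) ∧
    ∀ i j, B (ψ i) (φ j) = P i j

end Bases

/-- `x` is not an integral power of `q²`. -/
def NotPowSq (q x : ℂ) : Prop := ∀ k : ℤ, x ≠ (q ^ 2) ^ k

/-- The parameters of the construction, `m_k = 2 j_k`: `q` is nonzero and not a root of unity, the
`j_k` are positive integers or half-integers, `α_{k+1}/α_k = q^{-2 j_k}` for `1 ≤ k ≤ N`, and the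
degenerate situations are excluded in which, at a point of the discrete support, one of the products
`ab, ac, ad, bc, bd, abcd` of the parameters of the Askey-Wilson factors (in base `q²`) is an
integral power of `q²`, or in which this happens to `z_k²`. -/
structure Admissible {N : ℕ} (q : ℂ) (α : ℕ → ℂ) (m : Fin N → ℕ) : Prop where
  q_ne_zero : q ≠ 0
  not_root_of_unity : ∀ k : ℕ, 0 < k → q ^ k ≠ 1
  pos : 0 < N
  m_pos : ∀ i, 0 < m i
  ne_zero : ∀ i ≤ N + 2, α i ≠ 0
  ratio : ∀ i : Fin N, α (i + 2) / α (i + 1) = q ^ (-(m i : ℤ))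
  generic_ab : NotPowSq q (α 1 ^ 2 / α 0 ^ 2)
  generic_ac : NotPowSq q (α (N + 1) * α (N + 2))
  generic_ad : NotPowSq q (α (N + 1) / α (N + 2))
  generic_bc : NotPowSq q (α (N + 1) * α (N + 2) / α 0 ^ 2)
  generic_bd : NotPowSq q (α (N + 1) / (α (N + 2) * α 0 ^ 2))
  generic_z : NotPowSq q (α (N + 2) ^ 2)

end GasperRahman

end

noncomputable section

namespace GasperRahman

open Finset

/-! Put p = q². To a site with variable z belong three vectors v_e, e ∈ {0, +, -}, in a
three-dimensional space: the elementary symmetric functions of z, z⁻¹, of z, pz and of z⁻¹, pz⁻¹.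
They form an orthogonal basis for `pairing`, which gives a resolution of the identity
(`sum_pairing_sitePair`). When this identity is inserted at the sites skipped by ν, Iliev's
operator, given in terms of differences, becomes up to an additive constant a transfer matrix ∑ c_ε
E^ε whose coefficients are products of nearest-neighbour weights (`operatorAt_eq_chainOperator`).

The Askey-Wilson factor of a site passes through this matrix. Summation over the shift at the site
pulls the polynomial out and rescales the boundary vector (`sum_site_askeyWilson`); if the next site
is unshifted this is the Askey-Wilson difference equation, otherwise a contiguous relation.
Induction on the sites diagonalizes the operator and also its truncations to the first k sites
(`chainOperator_grProduct`).

On the discrete support the weights of all shifts that leave the grid vanish, because α_{k+1}/α_k =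
q^{-2j_k}. This gives the recurrence in ñ for arbitrary outside values. The recurrence in n is the
same statement for the dual parameters, by a duality of the polynomials. On a finite grid each
Askey-Wilson polynomial can be expanded from the parameter at which its grid starts
(`askeyWilson_swap_grid`); the ₄φ₃ is then symmetric in degree and grid position, and the prefactors
collect into symmetric factors at lattice points (`Admissible.grPolyNormalized_eq_closedForm`,
`closedForm_eq_of_dual`).

Orthogonality comes from the truncations. After adding a function of z_{k+1} (z_{N+1} = α_{N+2}),
the k-th one has an eigenvalue that determines n₁ + ⋯ + n_k, so together they separate the
polynomials. Their coefficients factor into pieces depending on a single integer each, so detailed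
balance holds with one weight for all k (`IsSupportData.exists_balancing_weight`), and all these
operators are symmetric. The polynomials thus form an invertible matrix with orthogonal rows, hence
with orthogonal columns, which yields a bilinear form with two orthogonal bases. Declare W₀ diagonal
on φ and W₁ diagonal on ψ. Both are self-adjoint, and the recurrences of the overlap coefficients
give the remaining actions. The q-Onsager relations hold since on an eigenvector they become a cubic
in the generator that vanishes at the same and at adjacent eigenvalues.

An irreducible module with two dual bases is mapped to this model along ψ and along φ. Both maps are
intertwiners, so by Schur's lemma they are proportional, and the form of the model, pulled back and
rescaled, has the required overlap coefficients. -/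

/-! ### Site data of the transfer matrix -/

/-- The symmetric bilinear pairing of site data in base `p`. -/
def pairing (p : ℂ) (l r : ℂ × ℂ × ℂ) : ℂ :=
  l.1 * r.1 - l.2.1 * r.2.1 / (1 + p) + l.2.2 * r.2.2 / p

/-- Weighted scaling of site data. -/
def scale (s : ℂ) (l : ℂ × ℂ × ℂ) : ℂ × ℂ × ℂ := (l.1, s * l.2.1, s ^ 2 * l.2.2)

/-- The elementary symmetric functions of the two numbers attached to a shift at a site:
`z, z⁻¹` for no shift, `z, p z` for a shift up, `z⁻¹, p z⁻¹` for a shift down. -/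
def sitePair (p z : ℂ) : SignType → ℂ × ℂ × ℂ
  | .zero => (1, z + z⁻¹, 1)
  | .pos => (1, (1 + p) * z, p * z ^ 2)
  | .neg => (1, (1 + p) * z⁻¹, p * z⁻¹ ^ 2)

/-- The weight of a shift at a site. -/
def siteWeight (p z : ℂ) : SignType → ℂ
  | .zero => p * (1 + p) / ((1 - p * z ^ 2) * (1 - p * z⁻¹ ^ 2))
  | .pos => 1 / ((1 - z ^ 2) * (1 - p * z ^ 2))
  | .neg => 1 / ((1 - z⁻¹ ^ 2) * (1 - p * z⁻¹ ^ 2))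

/-- `x` is not an integral power of `p`. -/
def NotPow (p x : ℂ) : Prop := ∀ k : ℤ, x ≠ p ^ k

/-- `p` is nonzero and not a root of unity. -/
structure IsGenericBase (p : ℂ) : Prop where
  ne_zero : p ≠ 0
  pow_ne_one : ∀ k : ℕ, 0 < k → p ^ k ≠ 1

namespace IsGenericBase

variable {p : ℂ} (hp : IsGenericBase p)
include hp

lemma zpow_ne_one {k : ℤ} (hk : k ≠ 0) : p ^ k ≠ 1 := by
  intro h
  rcases Int.natAbs_eq k with h' | h'
  · rw [h', zpow_natCast] at h
    exact hp.pow_ne_one _ (by omega) h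
  · rw [h', zpow_neg, zpow_natCast, inv_eq_one] at h
    exact hp.pow_ne_one _ (by omega) h

lemma one_sub_zpow_ne_zero {k : ℤ} (hk : k ≠ 0) : 1 - p ^ k ≠ 0 :=
  sub_ne_zero.mpr (hp.zpow_ne_one hk).symm

lemma one_add_ne_zero : 1 + p ≠ 0 := by
  intro h
  apply hp.pow_ne_one 2 (by norm_num)
  linear_combination (p - 1) * h

lemma zpow_injective {i j : ℤ} (h : p ^ i = p ^ j) : i = j := by
  by_contra hne
  apply hp.zpow_ne_one (sub_ne_zero.mpr hne)
  rw [zpow_sub₀ hp.ne_zero, h, div_self (zpow_ne_zero _ hp.ne_zero)]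

end IsGenericBase

lemma NotPow.mul_zpow {p x : ℂ} (hp : p ≠ 0) (h : NotPow p x) (i : ℤ) : NotPow p (x * p ^ i) := by
  intro k hk
  apply h (k - i)
  rw [zpow_sub₀ hp, ← hk, mul_div_cancel_right₀ _ (zpow_ne_zero _ hp)]

lemma NotPow.inv {p x : ℂ} (h : NotPow p x) : NotPow p x⁻¹ := by
  intro k hk
  apply h (-k)
  rw [zpow_neg, ← hk, inv_inv]

lemma NotPow.one_sub_ne_zero {p x : ℂ} (h : NotPow p x) : 1 - x ≠ 0 := by
  have := h 0
  rw [zpow_zero] at this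
  exact sub_ne_zero.mpr this.symm

lemma NotPow.one_sub_mul_zpow_ne_zero {p x : ℂ} (hp : p ≠ 0) (h : NotPow p x) (i : ℤ) :
    1 - x * p ^ i ≠ 0 := (h.mul_zpow hp i).one_sub_ne_zero

lemma NotPow.one_sub_mul_pow_ne_zero {p x : ℂ} (hp : p ≠ 0) (h : NotPow p x) (i : ℕ) :
    1 - x * p ^ i ≠ 0 := by simpa using h.one_sub_mul_zpow_ne_zero hp i

lemma NotPow.ne_zero_factors {p z : ℂ} (hp : p ≠ 0) (h : NotPow p (z ^ 2)) :
    1 - z ^ 2 ≠ 0 ∧ 1 - p * z ^ 2 ≠ 0 ∧ z ^ 2 - p ≠ 0 := by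
  refine ⟨h.one_sub_ne_zero, ?_, ?_⟩
  · have := h.one_sub_mul_pow_ne_zero hp 1
    rwa [pow_one, mul_comm] at this
  · have := h 1
    rw [zpow_one] at this
    exact sub_ne_zero.mpr this

lemma sum_signType {M : Type*} [AddCommMonoid M] (f : SignType → M) :
    ∑ e, f e = f .pos + f .neg + f .zero := by
  rw [SignType.univ_eq, Finset.sum_insert (by decide), Finset.sum_insert (by decide),
    Finset.sum_singleton]
  show f .zero + (f .neg + f .pos) = _
  abel

lemma one_sub_inv_sq_factors {p z : ℂ} (hz : z ≠ 0) :
    (1 - z⁻¹ ^ 2) * (1 - p * z⁻¹ ^ 2) = (1 - z ^ 2) * -(z ^ 2 - p) / z ^ 4 := by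
  field_simp; ring

lemma one_sub_mul_inv_sq {p z : ℂ} (hz : z ≠ 0) : 1 - p * z⁻¹ ^ 2 = (z ^ 2 - p) / z ^ 2 := by
  field_simp

/-- Over the three shifts of a site the denominators are always products of two of 1 - z², 1 - pz²
and z² - p. This reduces each rational identity at a site to one polynomial identity. -/
lemma combine_fractions {A B C R D₁ D₂ D₃ : ℂ} (h₁ : D₁ ≠ 0) (h₂ : D₂ ≠ 0) (h₃ : D₃ ≠ 0)
    (h : A * D₃ - B * D₂ + C * D₁ = R * (D₁ * D₂ * D₃)) :
    A / (D₁ * D₂) + B / (D₁ * -D₃) + C / (D₂ * D₃) = R := by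
  field_simp
  linear_combination h

/-- The site vectors form a resolution of the identity. -/
lemma sum_pairing_sitePair {p z : ℂ} (hp : IsGenericBase p) (hz : z ≠ 0) (h : NotPow p (z ^ 2))
    (l r : ℂ × ℂ × ℂ) :
    ∑ e, pairing p l (sitePair p z e) * siteWeight p z e * pairing p (sitePair p z e) r =
      pairing p l r := by
  obtain ⟨h1, h2, h3⟩ := h.ne_zero_factors hp.ne_zero
  have hp0 := hp.ne_zero
  have hp1 := hp.one_add_ne_zero
  obtain ⟨l0, l1, l2⟩ := l
  obtain ⟨r0, r1, r2⟩ := r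
  -- Conceptually the three site vectors are orthogonal for the pairing, with squares the inverse
  -- weights; for instance v_+ pairs with itself to (1 - z²)(1 - pz²) and with v_- to 0. The
  -- identity is checked here by clearing denominators.
  rw [sum_signType]
  simp only [sitePair, siteWeight, pairing]
  rw [one_sub_inv_sq_factors hz, one_sub_mul_inv_sq hz]
  have e1 : ∀ A B X Y : ℂ, X * (A / (B / z ^ 4)) * Y = X * A * z ^ 4 * Y / B :=
    fun A B X Y => by field_simp
  have e2 : ∀ A B D X Y : ℂ, X * (A / (D * (B / z ^ 2))) * Y = X * A * z ^ 2 * Y / (D * B) :=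
    fun A B D X Y => by field_simp
  have e3 : ∀ A B X Y : ℂ, X * (A / B) * Y = X * A * Y / B :=
    fun A B X Y => by field_simp
  rw [e1, e2, e3]
  apply combine_fractions h1 h2 h3
  field_simp
  ring

/-- The pairing with the pair `a, b` in place of a site pair. -/
lemma pairing_sitePair_pos {p a b z : ℂ} (hp : IsGenericBase p) :
    pairing p (1, a + b, a * b) (sitePair p z .pos) = (1 - a * z) * (1 - b * z) := by
  have hp0 := hp.ne_zero
  have hp1 := hp.one_add_ne_zero
  simp only [pairing, sitePair]
  field_simp
  ring

lemma pairing_sitePair_neg {p a b z : ℂ} (hp : IsGenericBase p) :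
    pairing p (1, a + b, a * b) (sitePair p z .neg) = (1 - a * z⁻¹) * (1 - b * z⁻¹) := by
  have hp0 := hp.ne_zero
  have hp1 := hp.one_add_ne_zero
  simp only [pairing, sitePair]
  field_simp
  ring

lemma pairing_comm (p : ℂ) (l r : ℂ × ℂ × ℂ) : pairing p l r = pairing p r l := by
  simp only [pairing]; ring

lemma pairing_scale (p s : ℂ) (l r : ℂ × ℂ × ℂ) :
    pairing p (scale s l) r = pairing p l (scale s r) := by
  simp only [pairing, scale]; ring

lemma scale_scale (s t : ℂ) (l : ℂ × ℂ × ℂ) : scale s (scale t l) = scale (s * t) l := by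
  simp only [scale, Prod.mk.injEq]; refine ⟨trivial, ?_, ?_⟩ <;> ring

lemma scale_one (l : ℂ × ℂ × ℂ) : scale 1 l = l := by
  simp [scale]

set_option maxRecDepth 8000 in
/-- The action of the second order Askey-Wilson operator on the basis `(az, a/z; p)_k`, after
division by common factors; `X = p^(k-1)`. -/
lemma askeyWilson_operator_core (a b c d X p z : ℂ) (hp : p ≠ 0) (hp1 : 1 + p ≠ 0) (hX : X ≠ 0)
    (hz : z ≠ 0) (h1 : 1 - z ^ 2 ≠ 0) (h2 : 1 - p * z ^ 2 ≠ 0) (h3 : z ^ 2 - p ≠ 0) :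
    (1 - b * z) * (1 - c * z) * (1 - d * z) * (1 - a * X * z) * (1 - a * X * p * z) *
          (1 - a / (p * z)) / ((1 - z ^ 2) * (1 - p * z ^ 2)) +
        (1 - b * z⁻¹) * (1 - c * z⁻¹) * (1 - d * z⁻¹) * (1 - a * X * z⁻¹) *
          (1 - a * X * p * z⁻¹) * (1 - a * z / p) / ((1 - z⁻¹ ^ 2) * (1 - p * z⁻¹ ^ 2)) +
        p * (1 + p) / ((1 - p * z ^ 2) * (1 - p * z⁻¹ ^ 2)) *
          (1 - (a + b) * (z + z⁻¹) / (1 + p) + a * b / p) *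
          (1 - (c + d) * (z + z⁻¹) / (1 + p) + c * d / p) *
          ((1 - a * X * z) * (1 - a * X * z⁻¹)) =
      (1 / (p * X) + a * b * c * d * X - (a + b) * (c + d) / (1 + p)) *
          ((1 - a * X * z) * (1 - a * X * z⁻¹)) +
        (1 - 1 / (p * X)) * (1 - a * b * X) * (1 - a * c * X) * (1 - a * d * X) := by
  have e3 : ∀ A B : ℂ, A / (B / z ^ 4) = A * z ^ 4 / B := fun A B => by field_simp
  have e4 : ∀ A B C D E: ℂ, A / (D * (B / z ^ 2)) * C * E = A * z ^ 2 * C * E / (D * B) :=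
    fun A B C D E => by field_simp
  rw [one_sub_inv_sq_factors hz, one_sub_mul_inv_sq hz, e3, e4, div_mul_eq_mul_div]
  apply combine_fractions h1 h2 h3
  rw [show ∀ x, x / (p * z) = x / p * z⁻¹ from fun x => by field_simp]
  field_simp
  ring

/-! ### Askey-Wilson polynomials and their contiguous relations -/

lemma qPoch_zero (a p : ℂ) : qPoch a p 0 = 1 := by simp [qPoch]

lemma qPoch_succ (a p : ℂ) (n : ℕ) : qPoch a p (n + 1) = qPoch a p n * (1 - a * p ^ n) := by
  simp [qPoch, Finset.prod_range_succ]

lemma qPoch_succ' (a p : ℂ) (n : ℕ) : qPoch a p (n + 1) = (1 - a) * qPoch (a * p) p n := by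
  simp only [qPoch, Finset.prod_range_succ']
  rw [mul_comm]
  congr 1
  · simp
  · exact Finset.prod_congr rfl fun k _ => by ring

lemma qPoch_ne_zero {a p : ℂ} {n : ℕ} (h : ∀ k < n, 1 - a * p ^ k ≠ 0) : qPoch a p n ≠ 0 :=
  Finset.prod_ne_zero_iff.mpr fun k hk => h k (Finset.mem_range.mp hk)

lemma qPoch_self_ne_zero {p : ℂ} (hp : IsGenericBase p) (n : ℕ) : qPoch p p n ≠ 0 :=
  qPoch_ne_zero fun k _ => by
    rw [← pow_succ']
    exact sub_ne_zero.mpr (hp.pow_ne_one _ (Nat.succ_pos k)).symm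

/-- The Askey-Wilson basis `(az, a/z; p)_k`. -/
def awBasis (p a z : ℂ) (k : ℕ) : ℂ := qPoch (a * z) p k * qPoch (a * z⁻¹) p k

/-- The coefficients of the terminating series in the Askey-Wilson polynomial. -/
def awCoeff (p : ℂ) (n : ℕ) (a b c d : ℂ) (k : ℕ) : ℂ :=
  qPoch (p ^ (-(n : ℤ))) p k * qPoch (a * b * c * d * p ^ ((n : ℤ) - 1)) p k /
    (qPoch (a * b) p k * qPoch (a * c) p k * qPoch (a * d) p k * qPoch p p k) * p ^ k

lemma askeyWilson_eq (p : ℂ) (n : ℕ) (a b c d z : ℂ) :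
    askeyWilson p n a b c d z =
      qPoch (a * b) p n * qPoch (a * c) p n * qPoch (a * d) p n / a ^ n *
        ∑ k ∈ range (n + 1), awCoeff p n a b c d k * awBasis p a z k := by
  unfold askeyWilson awCoeff awBasis
  congr 1
  exact Finset.sum_congr rfl fun k _ => by ring

lemma awCoeff_succ {p : ℂ} (hp : IsGenericBase p) (n : ℕ) (a b c d : ℂ) (k : ℕ) :
    awCoeff p n a b c d (k + 1) =
      awCoeff p n a b c d k * ((1 - (p ^ n)⁻¹ * p ^ k) * (1 - a * b * c * d * (p ^ n / p) * p ^ k) *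
        p / ((1 - a * b * p ^ k) * (1 - a * c * p ^ k) * (1 - a * d * p ^ k) *
          (1 - p * p ^ k))) := by
  have hp0 := hp.ne_zero
  simp only [awCoeff, qPoch_succ, zpow_neg, zpow_natCast, zpow_sub₀ hp0, zpow_one, pow_succ]
  simp only [div_eq_mul_inv, mul_inv]
  generalize (1 - (p ^ n)⁻¹ * p ^ k) = u
  generalize (1 - a * b * c * d * (p ^ n * p⁻¹) * p ^ k) = v
  ring

/-- The left factor is `awSub`, so this is the form in which the recursion of the coefficients meets
the action of the operator. -/
lemma awCoeff_succ_mul {p : ℂ} (hp : IsGenericBase p) (n : ℕ) {a b c d : ℂ} {k : ℕ}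
    (hab : 1 - a * b * p ^ k ≠ 0) (hac : 1 - a * c * p ^ k ≠ 0) (had : 1 - a * d * p ^ k ≠ 0) :
    awCoeff p n a b c d (k + 1) * ((1 - 1 / (p * p ^ k)) * (1 - a * b * p ^ k) *
        (1 - a * c * p ^ k) * (1 - a * d * p ^ k)) =
      -(awCoeff p n a b c d k * ((1 - (p ^ n)⁻¹ * p ^ k) *
        (1 - a * b * c * d * (p ^ n / p) * p ^ k)) * (p ^ k)⁻¹) := by
  have hp0 := hp.ne_zero
  have h1 : 1 - p * p ^ k ≠ 0 := by
    rw [← pow_succ']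
    exact sub_ne_zero.mpr (hp.pow_ne_one _ (Nat.succ_pos k)).symm
  have h2 : 1 - 1 / (p * p ^ k) = -((1 - p * p ^ k) / (p * p ^ k)) := by field_simp; ring
  rw [awCoeff_succ hp, h2]
  generalize (1 - (p ^ n)⁻¹ * p ^ k) * (1 - a * b * c * d * (p ^ n / p) * p ^ k) = u
  generalize 1 - a * b * p ^ k = A at *
  generalize 1 - a * c * p ^ k = B at *
  generalize 1 - a * d * p ^ k = C at *
  generalize 1 - p * p ^ k = D at *
  field_simp

/-- The second order Askey-Wilson operator applied to a function of the shift. -/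
def awOperator (p a b c d z : ℂ) (f : SignType → ℂ) : ℂ :=
  ∑ e, pairing p (1, a + b, a * b) (sitePair p z e) * siteWeight p z e *
    pairing p (sitePair p z e) (1, c + d, c * d) * f e

lemma awBasis_succ (p a z : ℂ) (k : ℕ) :
    awBasis p a z (k + 1) = awBasis p a z k * ((1 - a * z * p ^ k) * (1 - a * z⁻¹ * p ^ k)) := by
  simp only [awBasis, qPoch_succ]; ring

/-- The factor 1 - az is present in the coefficient of the upward shift; with it the shifted product
becomes a multiple of the unshifted one of lower index. -/
lemma awBasis_shift (p a z : ℂ) (k : ℕ) (hp : p ≠ 0) :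
    (1 - a * z) * awBasis p a (z * p) (k + 1) = awBasis p a z k *
      ((1 - a * z * p ^ k) * (1 - a * z * p ^ (k + 1)) * (1 - a * z⁻¹ * p⁻¹)) := by
  have e1 : (1 - a * z) * qPoch (a * z * p) p (k + 1) = qPoch (a * z) p (k + 1 + 1) :=
    (qPoch_succ' _ _ _).symm
  have e2 : qPoch (a * z⁻¹ * p⁻¹) p (k + 1) = (1 - a * z⁻¹ * p⁻¹) * qPoch (a * z⁻¹) p k := by
    rw [qPoch_succ', inv_mul_cancel_right₀ hp]
  simp only [awBasis, mul_inv, ← mul_assoc]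
  rw [e1, e2, qPoch_succ, qPoch_succ]
  ring

lemma awBasis_inv (p a z : ℂ) (k : ℕ) : awBasis p a z⁻¹ k = awBasis p a z k := by
  simp [awBasis, mul_comm]

/-- The diagonal coefficients of the Askey-Wilson operator in the Askey-Wilson basis. -/
def awDiag (p a b c d : ℂ) (k : ℕ) : ℂ :=
  (p ^ k)⁻¹ + a * b * c * d * p ^ k / p - (a + b) * (c + d) / (1 + p)

/-- The subdiagonal coefficients of the Askey-Wilson operator in the Askey-Wilson basis. -/
def awSub (p a b c d : ℂ) (k : ℕ) : ℂ :=
  (1 - 1 / (p * p ^ k)) * (1 - a * b * p ^ k) * (1 - a * c * p ^ k) * (1 - a * d * p ^ k)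

/-- On constants the operator reduces to the resolution of the identity. -/
lemma awOperator_awBasis_zero {p z : ℂ} (hp : IsGenericBase p) (hz : z ≠ 0)
    (h : NotPow p (z ^ 2)) (a b c d : ℂ) :
    awOperator p a b c d z (fun e => awBasis p a (z * p ^ (e : ℤ)) 0) = awDiag p a b c d 0 := by
  have := sum_pairing_sitePair hp hz h (1, a + b, a * b) (1, c + d, c * d)
  simp only [awOperator, awBasis, qPoch_zero, mul_one, this]
  simp [pairing, awDiag]
  ring

/-- The operator is bidiagonal in this basis. The downward shift is the upward one at z⁻¹, and
division by the common factor `awBasis p a z k` leaves `askeyWilson_operator_core`. -/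
lemma awOperator_awBasis_succ {p z : ℂ} (hp : IsGenericBase p) (hz : z ≠ 0)
    (h : NotPow p (z ^ 2)) (a b c d : ℂ) (k : ℕ) :
    awOperator p a b c d z (fun e => awBasis p a (z * p ^ (e : ℤ)) (k + 1)) =
      awDiag p a b c d (k + 1) * awBasis p a z (k + 1) +
      awSub p a b c d k * awBasis p a z k := by
  obtain ⟨h1, h2, h3⟩ := h.ne_zero_factors hp.ne_zero
  have hp0 := hp.ne_zero
  have hp1 := hp.one_add_ne_zero
  have core := askeyWilson_operator_core a b c d (p ^ k) p z hp0 hp1 (pow_ne_zero _ hp0) hz h1 h2 h3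
  have s1 := awBasis_shift p a z k hp0
  have s2 := awBasis_shift p a z⁻¹ k hp0
  rw [show z⁻¹ * p = (z * p⁻¹)⁻¹ by field_simp, awBasis_inv, awBasis_inv, inv_inv] at s2
  rw [awOperator, sum_signType, awBasis_succ p a z k]
  simp only [pairing_sitePair_pos hp, pairing_sitePair_neg hp,
    pairing_comm p (sitePair p z _)]
  have e1 : ((SignType.pos : SignType) : ℤ) = 1 := rfl
  have e2 : ((SignType.neg : SignType) : ℤ) = -1 := rfl
  have e3 : ((SignType.zero : SignType) : ℤ) = 0 := rfl
  rw [e1, e2, e3, zpow_one, zpow_neg_one, zpow_zero, mul_one, awBasis_succ p a z k]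
  simp only [siteWeight, sitePair, pairing, awDiag, awSub]
  rw [show a * b * c * d * p ^ (k + 1) / p = a * b * c * d * p ^ k by
    rw [pow_succ]; field_simp]
  linear_combination (1 - b * z) * (1 - c * z) * (1 - d * z) *
      (1 / ((1 - z ^ 2) * (1 - p * z ^ 2))) * s1 +
    (1 - b * z⁻¹) * (1 - c * z⁻¹) * (1 - d * z⁻¹) *
      (1 / ((1 - z⁻¹ ^ 2) * (1 - p * z⁻¹ ^ 2))) * s2 + awBasis p a z k * core

/-- Comparison of coefficients for a bidiagonal operator. At the top index only the diagonal
coefficient contributes, so the condition there does not involve u (n + 1). -/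
lemma awOperator_sum {p z : ℂ} (hp : IsGenericBase p) (hz : z ≠ 0) (h : NotPow p (z ^ 2))
    (a b c d : ℂ) (n : ℕ) (u v : ℕ → ℂ)
    (huv : ∀ k < n, u k * awDiag p a b c d k + u (k + 1) * awSub p a b c d k = v k)
    (hn : u n * awDiag p a b c d n = v n) :
    awOperator p a b c d z
        (fun e => ∑ k ∈ range (n + 1), u k * awBasis p a (z * p ^ (e : ℤ)) k) =
      ∑ k ∈ range (n + 1), v k * awBasis p a z k := by
  have lin : awOperator p a b c d z
        (fun e => ∑ k ∈ range (n + 1), u k * awBasis p a (z * p ^ (e : ℤ)) k) =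
      ∑ k ∈ range (n + 1), u k *
        awOperator p a b c d z (fun e => awBasis p a (z * p ^ (e : ℤ)) k) := by
    simp only [awOperator, Finset.mul_sum]
    rw [Finset.sum_comm]
    exact Finset.sum_congr rfl fun k _ => Finset.sum_congr rfl fun e _ => by ring
  rw [lin, Finset.sum_range_succ', awOperator_awBasis_zero hp hz h]
  simp only [awOperator_awBasis_succ hp hz h, mul_add, Finset.sum_add_distrib]
  have e0 : u 0 * awDiag p a b c d 0 =
    u 0 * (awDiag p a b c d 0 * awBasis p a z 0) := by simp [awBasis, qPoch_zero]
  rw [e0, add_right_comm,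
    ← Finset.sum_range_succ' (fun k => u k * (awDiag p a b c d k * awBasis p a z k)),
    Finset.sum_range_succ, Finset.sum_range_succ (fun k => v k * _), ← hn, add_right_comm,
    ← Finset.sum_add_distrib]
  congr 1
  · refine Finset.sum_congr rfl fun k hk => ?_
    rw [← huv k (Finset.mem_range.mp hk)]
    ring
  · ring

/-- The Askey-Wilson difference equation. -/
lemma awOperator_askeyWilson {p z : ℂ} (hp : IsGenericBase p) (hz : z ≠ 0)
    (h : NotPow p (z ^ 2)) {a b c d : ℂ} {n : ℕ} (hab : ∀ k < n, 1 - a * b * p ^ k ≠ 0)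
    (hac : ∀ k < n, 1 - a * c * p ^ k ≠ 0) (had : ∀ k < n, 1 - a * d * p ^ k ≠ 0) :
    awOperator p a b c d z (fun e => askeyWilson p n a b c d (z * p ^ (e : ℤ))) =
      awDiag p a b c d n * askeyWilson p n a b c d z := by
  have hp0 := hp.ne_zero
  -- The difference of the diagonal coefficients at k and n is p⁻ᵏ(1 - p^{k-n})(1 - abcd p^{n+k-1}),
  -- exactly the factor in the recursion of the coefficients.
  have key := awOperator_sum hp hz h a b c d n (awCoeff p n a b c d)
    (fun k => awDiag p a b c d n * awCoeff p n a b c d k) (fun k hk => ?_) (mul_comm _ _)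
  · simp only [askeyWilson_eq]
    rw [mul_left_comm, Finset.mul_sum _ _ (awDiag p a b c d n)]
    simp only [← mul_assoc] at key ⊢
    rw [← key, awOperator, awOperator, Finset.mul_sum]
    exact Finset.sum_congr rfl fun e _ => by ring
  · have h1 := hab k hk
    have h2 := hac k hk
    have h3 := had k hk
    have hX : p ^ k ≠ 0 := pow_ne_zero _ hp0
    have hP : p ^ n ≠ 0 := pow_ne_zero _ hp0
    have hs := awCoeff_succ_mul hp n h1 h2 h3
    simp only [awDiag, awSub]
    rw [← sub_eq_zero] at hs ⊢
    rw [← hs]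
    field_simp
    ring

lemma qPoch_shift (x p : ℂ) (n : ℕ) :
    (1 - x) * qPoch (x * p) p n = qPoch x p n * (1 - x * p ^ n) := by
  rw [← qPoch_succ', qPoch_succ]

/-- The contiguous relation for a shift of two parameters in opposite directions. -/
lemma awOperator_askeyWilson_shift {p z : ℂ} (hp : IsGenericBase p) (hz : z ≠ 0)
    (h : NotPow p (z ^ 2)) {a b c d : ℂ} (n : ℕ) (hab : NotPow p (a * b))
    (hac : NotPow p (a * c)) (had : NotPow p (a * d)) :
    awOperator p a b c (p * c) z
        (fun e => askeyWilson p n a b (p * c) (d / p) (z * p ^ (e : ℤ))) =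
      (p ^ n)⁻¹ * (1 - a * c * p ^ n) * (1 - b * c * p ^ n) * askeyWilson p n a b c d z := by
  have hp0 := hp.ne_zero
  have had' : NotPow p (a * d / p) := by simpa [div_eq_mul_inv] using had.mul_zpow hp0 (-1)
  have d1 := hac.one_sub_ne_zero
  have d2 := had'.one_sub_ne_zero
  have d3 := fun k => hac.one_sub_mul_pow_ne_zero hp0 k
  have d4 := fun k => had'.one_sub_mul_pow_ne_zero hp0 k
  have c1 : ∀ k, qPoch (a * (p * c)) p k = qPoch (a * c) p k * (1 - a * c * p ^ k) / (1 - a * c) :=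
    fun k => by rw [eq_div_iff d1, ← qPoch_shift]; ring_nf
  have c2 : ∀ k, qPoch (a * (d / p)) p k =
      qPoch (a * d) p k * (1 - a * d / p) / (1 - a * d / p * p ^ k) := fun k => by
    rw [eq_div_iff (d4 k), ← mul_div_assoc, ← qPoch_shift, div_mul_cancel₀ _ hp0]; ring
  -- Up to a constant, replacing c, d by pc, d/p multiplies the k-th coefficient by (1 - ad
  -- p^{k-1})/(1 - ac p^k), because cd and hence abcd do not change.
  have key := awOperator_sum hp hz h a b c (p * c) n
    (fun k => awCoeff p n a b c d k * ((1 - a * d / p * p ^ k) / (1 - a * c * p ^ k)))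
    (fun k => (p ^ n)⁻¹ * (1 - b * c * p ^ n) * (1 - a * d / p * p ^ n) * awCoeff p n a b c d k)
    (fun k hk => ?_) ?_
  · have hu : ∀ k, awCoeff p n a b (p * c) (d / p) k = (1 - a * c) / (1 - a * d / p) *
        (awCoeff p n a b c d k * ((1 - a * d / p * p ^ k) / (1 - a * c * p ^ k))) := by
      intro k
      simp only [awCoeff, c1, c2]
      rw [show a * b * (p * c) * (d / p) = a * b * c * d by field_simp]
      simp only [div_eq_mul_inv, mul_inv, inv_inv]
      ring
    have lhs : ∀ y, askeyWilson p n a b (p * c) (d / p) y =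
        qPoch (a * b) p n * qPoch (a * c) p n * qPoch (a * d) p n / a ^ n *
          ((1 - a * c * p ^ n) / (1 - a * d / p * p ^ n)) *
        ∑ k ∈ range (n + 1), awCoeff p n a b c d k *
          ((1 - a * d / p * p ^ k) / (1 - a * c * p ^ k)) * awBasis p a y k := by
      intro y
      rw [askeyWilson_eq, c1, c2]
      simp only [hu, mul_assoc ((1 - a * c) / _), ← Finset.mul_sum]
      rw [← mul_assoc]
      congr 1
      generalize 1 - a * d / p = A at *
      generalize 1 - a * c = B at *
      field_simp
    have pull : ∀ (C : ℂ) (f : SignType → ℂ), awOperator p a b c (p * c) z (fun e => C * f e) =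
        C * awOperator p a b c (p * c) z f := by
      intro C f
      simp only [awOperator, Finset.mul_sum]
      exact Finset.sum_congr rfl fun e _ => by ring
    simp only [lhs, pull, key, askeyWilson_eq, mul_assoc _ (awCoeff p n a b c d _) (awBasis _ _ _ _),
      ← Finset.mul_sum]
    have hN := d4 n
    generalize 1 - a * d / p * p ^ n = A at *
    field_simp
  · have h1 := hab.one_sub_mul_pow_ne_zero hp0 k
    have h2 := d3 k
    have h3 := had.one_sub_mul_pow_ne_zero hp0 k
    have hX : p ^ k ≠ 0 := pow_ne_zero _ hp0
    have hP : p ^ n ≠ 0 := pow_ne_zero _ hp0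
    have hs := awCoeff_succ_mul hp n h1 h2 h3
    have hp1 := hp.one_add_ne_zero
    have g1 : awDiag p a b c (p * c) k =
        (p ^ k)⁻¹ * (1 - a * c * p ^ k) * (1 - b * c * p ^ k) := by
      simp only [awDiag]; field_simp; ring
    have g2 : (1 - a * d / p * p ^ (k + 1)) / (1 - a * c * p ^ (k + 1)) *
        awSub p a b c (p * c) k = (1 - 1 / (p * p ^ k)) * (1 - a * b * p ^ k) *
        (1 - a * c * p ^ k) * (1 - a * d * p ^ k) := by
      have h4 := d3 (k + 1)
      rw [awSub, show a * (p * c) * p ^ k = a * c * p ^ (k + 1) by ring,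
        show a * d / p * p ^ (k + 1) = a * d * p ^ k by rw [pow_succ]; field_simp]
      generalize 1 - a * c * p ^ (k + 1) = A at *
      field_simp
    rw [mul_assoc (awCoeff p n a b c d (k + 1)), g2, hs, g1]
    generalize awCoeff p n a b c d k = u
    rw [show u * ((1 - a * d / p * p ^ k) / (1 - a * c * p ^ k)) *
      ((p ^ k)⁻¹ * (1 - a * c * p ^ k) * (1 - b * c * p ^ k)) =
      u * (1 - a * d / p * p ^ k) * ((p ^ k)⁻¹ * (1 - b * c * p ^ k)) by
        generalize 1 - a * c * p ^ k = A at *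
        field_simp]
    field_simp
    ring
  · have h2 := d3 n
    have hP : p ^ n ≠ 0 := pow_ne_zero _ hp0
    have hp1 := hp.one_add_ne_zero
    have g1 : awDiag p a b c (p * c) n =
        (p ^ n)⁻¹ * (1 - a * c * p ^ n) * (1 - b * c * p ^ n) := by
      simp only [awDiag]; field_simp; ring
    rw [g1]
    generalize 1 - a * c * p ^ n = A at *
    field_simp

lemma askeyWilson_swap (p : ℂ) (n : ℕ) (a b c d z : ℂ) :
    askeyWilson p n a b c d z = askeyWilson p n a b d c z := by
  unfold askeyWilson
  congr 1
  · ring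
  · refine Finset.sum_congr rfl fun k _ => ?_
    rw [show a * b * d * c = a * b * c * d by ring,
      mul_right_comm (qPoch (a * b) p k) (qPoch (a * c) p k)]

/-- The local exchange relation: summation over the shift at a site carries the Askey-Wilson
polynomial attached to this site through the transfer matrix. -/
lemma sum_site_askeyWilson {p a τ s z w : ℂ} (hp : IsGenericBase p) (hz : z ≠ 0) (hw : w ≠ 0)
    (hz2 : NotPow p (z ^ 2)) (hab : NotPow p (a * (τ * a))) (hac : NotPow p (a * (s * w)))
    (had : NotPow p (a * (s * w⁻¹))) (n : ℕ) (f : SignType) :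
    ∑ e : SignType, pairing p (1, a + τ * a, a * (τ * a)) (sitePair p z e) * siteWeight p z e *
        pairing p (scale s (sitePair p z e)) (sitePair p w f) *
        askeyWilson p n a (τ * a) (s * (w * p ^ (f : ℤ))) (s * (w * p ^ (f : ℤ))⁻¹)
          (z * p ^ (e : ℤ)) =
      (p ^ n)⁻¹ * pairing p (scale (p ^ n * s) (1, a + τ * a, a * (τ * a))) (sitePair p w f) *
        askeyWilson p n a (τ * a) (s * w) (s * w⁻¹) z := by
  have hp0 := hp.ne_zero
  have hp1 := hp.one_add_ne_zero
  have hP : p ^ n ≠ 0 := pow_ne_zero _ hp0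
  simp only [pairing_scale]
  match f with
  -- The next site is unshifted: its scaled pair is c = sw, d = s/w, and the claim is the difference
  -- equation.
  | .zero =>
    have key := awOperator_askeyWilson hp hz hz2 (n := n) (a := a) (b := τ * a) (c := s * w)
      (d := s * w⁻¹) (fun k _ => hab.one_sub_mul_pow_ne_zero hp0 k)
      (fun k _ => hac.one_sub_mul_pow_ne_zero hp0 k) (fun k _ => had.one_sub_mul_pow_ne_zero hp0 k)
    have e1 : scale s (sitePair p w .zero) = (1, s * w + s * w⁻¹, s * w * (s * w⁻¹)) := by
      simp only [scale, sitePair, Prod.mk.injEq, true_and]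
      constructor <;> field_simp
    have e2 : (((SignType.zero : SignType) : ℤ)) = 0 := rfl
    simp only [e2, zpow_zero, mul_one, e1] at *
    rw [awOperator] at key
    rw [key]
    congr 1
    simp only [awDiag, pairing, scale, sitePair]
    field_simp
    ring
  -- The shift of w turns c, d into pc, d/p in the polynomial, while the scaled pair is c, pc: the
  -- contiguous relation.
  | .pos =>
    have key := awOperator_askeyWilson_shift hp hz hz2 (b := τ * a) (d := s * w⁻¹) n hab hac had
    have e1 : scale s (sitePair p w .pos) = (1, s * w + p * (s * w), s * w * (p * (s * w))) := by
      simp only [scale, sitePair, Prod.mk.injEq, true_and]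
      constructor <;> ring
    have e2 : (((SignType.pos : SignType) : ℤ)) = 1 := rfl
    have e3 : s * (w * p) = p * (s * w) := by ring
    have e4 : s * (w * p)⁻¹ = s * w⁻¹ / p := by field_simp
    rw [awOperator] at key
    simp only [e2, zpow_one, e1, e3, e4]
    rw [key]
    congr 1
    simp only [pairing, scale, sitePair]
    field_simp
    ring
  -- The same relation with c and d interchanged.
  | .neg =>
    have key := awOperator_askeyWilson_shift hp hz hz2 (b := τ * a) (d := s * w) n hab had hac
    have e1 : scale s (sitePair p w .neg) =
        (1, s * w⁻¹ + p * (s * w⁻¹), s * w⁻¹ * (p * (s * w⁻¹))) := by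
      simp only [scale, sitePair, Prod.mk.injEq, true_and]
      constructor <;> ring
    have e2 : (((SignType.neg : SignType) : ℤ)) = -1 := rfl
    have e3 : s * (w * p⁻¹) = s * w / p := by field_simp
    have e4 : s * (w * p⁻¹)⁻¹ = p * (s * w⁻¹) := by field_simp
    rw [awOperator] at key
    simp only [e2, zpow_neg_one, e1, e3, e4]
    simp only [fun x => askeyWilson_swap p n a (τ * a) (s * w / p) (p * (s * w⁻¹)) x]
    rw [key, askeyWilson_swap p n a (τ * a) (s * w)]
    congr 1
    simp only [pairing, scale, sitePair]
    field_simp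
    ring

/-! ### The transfer matrix -/

/-- The sequence with initial term `x` and tail `v`. -/
def seqCons {X : Type*} (x : X) (v : ℕ → X) : ℕ → X
  | 0 => x
  | j + 1 => v j

/-- Extension by zero of a vector to a sequence. -/
def seqExt {X : Type*} [Zero X] {k : ℕ} (v : Fin k → X) (j : ℕ) : X :=
  if h : j < k then v ⟨j, h⟩ else 0

lemma seqExt_cons {X : Type*} [Zero X] {k : ℕ} (x : X) (v : Fin k → X) :
    seqExt (Fin.cons x v) = seqCons x (seqExt v) := by
  funext j
  cases j with
  | zero => simp [seqExt, seqCons]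
  | succ j =>
    by_cases h : j < k
    · simp only [seqExt, seqCons, h, Nat.succ_lt_succ_iff, dif_pos]
      exact Fin.cons_succ (α := fun _ => X) x v ⟨j, h⟩
    · simp [seqExt, seqCons, h]

/-- The coefficient of the shift `ε` in the operator of order `k`. -/
def chainCoeff (p : ℂ) (k : ℕ) (l : ℂ × ℂ × ℂ) (A z : ℕ → ℂ) (ε : ℕ → SignType) : ℂ :=
  pairing p l (sitePair p (z 0) (ε 0)) *
    ∏ j ∈ range k, (siteWeight p (z j) (ε j) *
      pairing p (scale (A (j + 1) / A j) (sitePair p (z j) (ε j)))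
        (sitePair p (z (j + 1)) (ε (j + 1))))

/-- The operator of order `k` in the first `k` variables, applied to a function of the shift. -/
def chainOperator {V : Type*} [AddCommGroup V] [Module ℂ V] (p : ℂ) (k : ℕ) (l : ℂ × ℂ × ℂ)
    (A z : ℕ → ℂ) (F : (ℕ → SignType) → V) : V :=
  ∑ ε : Fin k → SignType, chainCoeff p k l A z (seqExt ε) • F (seqExt ε)

lemma sum_fin_cons {X M : Type*} [Fintype X] [AddCommMonoid M] {k : ℕ}
    (f : (Fin (k + 1) → X) → M) : ∑ v, f v = ∑ x : X, ∑ v : Fin k → X, f (Fin.cons x v) := by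
  rw [← Fintype.sum_prod_type' fun x (v : Fin k → X) => f (Fin.cons x v)]
  exact (Equiv.sum_comp (Fin.consEquiv fun _ => X) f).symm

section

variable {V : Type*} [AddCommGroup V] [Module ℂ V] (p : ℂ)

lemma chainOperator_zero (l : ℂ × ℂ × ℂ) (A z : ℕ → ℂ) (F : (ℕ → SignType) → V) :
    chainOperator p 0 l A z F = pairing p l (sitePair p (z 0) 0) • F 0 := by
  have : ∀ ε : Fin 0 → SignType, seqExt ε = 0 := fun ε => by funext j; simp [seqExt]
  simp [chainOperator, chainCoeff, this]

lemma chainCoeff_cons (k : ℕ) (l : ℂ × ℂ × ℂ) (A z : ℕ → ℂ) (e : SignType) (ε : ℕ → SignType) :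
    chainCoeff p (k + 1) l A z (seqCons e ε) =
      pairing p l (sitePair p (z 0) e) * siteWeight p (z 0) e *
        chainCoeff p k (scale (A 1 / A 0) (sitePair p (z 0) e)) (fun j => A (j + 1))
          (fun j => z (j + 1)) ε := by
  simp only [chainCoeff, Finset.prod_range_succ', seqCons]
  ring

lemma chainOperator_succ (k : ℕ) (l : ℂ × ℂ × ℂ) (A z : ℕ → ℂ) (F : (ℕ → SignType) → V) :
    chainOperator p (k + 1) l A z F =
      ∑ e, (pairing p l (sitePair p (z 0) e) * siteWeight p (z 0) e) •
        chainOperator p k (scale (A 1 / A 0) (sitePair p (z 0) e)) (fun j => A (j + 1))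
          (fun j => z (j + 1)) fun ε => F (seqCons e ε) := by
  simp only [chainOperator, sum_fin_cons, seqExt_cons, chainCoeff_cons, Finset.smul_sum, mul_smul]

end

/-- The Gasper-Rahman polynomials in the variables `z 0, …, z (k - 1)`. -/
def grProduct (p τ : ℂ) : ℕ → (ℕ → ℂ) → (ℕ → ℂ) → (ℕ → ℕ) → ℂ
  | 0, _, _, _ => 1
  | k + 1, A, z, n =>
    askeyWilson p (n 0) (A 0) (τ * A 0) (A 1 / A 0 * z 1) (A 1 / A 0 * (z 1)⁻¹) (z 0) *
      grProduct p τ k (fun j => A (j + 1) * p ^ n 0) (fun j => z (j + 1)) fun j => n (j + 1)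

/-- The variables `z` after the shift `ε`. -/
def shiftVar (p : ℂ) (z : ℕ → ℂ) (ε : ℕ → SignType) (j : ℕ) : ℂ := z j * p ^ (ε j : ℤ)

/-- The nondegeneracy conditions on the parameters and variables of `grProduct`. -/
structure IsGenericPoint (p τ : ℂ) (A z : ℕ → ℂ) (k : ℕ) : Prop where
  A_ne_zero : ∀ j, A j ≠ 0
  z_ne_zero : ∀ j, z j ≠ 0
  sq : ∀ j < k, NotPow p (z j ^ 2)
  ab : ∀ j < k, NotPow p (τ * A j ^ 2)
  ac : ∀ j < k, NotPow p (A (j + 1) * z (j + 1))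
  ad : ∀ j < k, NotPow p (A (j + 1) * (z (j + 1))⁻¹)

lemma IsGenericPoint.tail {p τ : ℂ} {A z : ℕ → ℂ} {k : ℕ} (hp : p ≠ 0)
    (h : IsGenericPoint p τ A z (k + 1)) (n : ℕ) :
    IsGenericPoint p τ (fun j => A (j + 1) * p ^ n) (fun j => z (j + 1)) k where
  A_ne_zero j := mul_ne_zero (h.A_ne_zero _) (pow_ne_zero _ hp)
  z_ne_zero j := h.z_ne_zero _
  sq j hj := h.sq _ (by omega)
  ab j hj := by
    have := (h.ab (j + 1) (by omega)).mul_zpow hp (2 * n)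
    rw [mul_comm (2 : ℤ), zpow_mul, zpow_natCast] at this
    convert this using 1
    norm_cast
    ring
  ac j hj := by
    have := (h.ac (j + 1) (by omega)).mul_zpow hp n
    rw [zpow_natCast] at this
    convert this using 1
    ring
  ad j hj := by
    have := (h.ad (j + 1) (by omega)).mul_zpow hp n
    rw [zpow_natCast] at this
    convert this using 1
    ring

/-- The Gasper-Rahman polynomials are eigenfunctions of the operators of all orders, up to
multiplication by functions of the next variable. -/
theorem chainOperator_grProduct {p τ : ℂ} (hp : IsGenericBase p) (k r : ℕ) (A z : ℕ → ℂ)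
    (n : ℕ → ℕ) (h : IsGenericPoint p τ A z k) :
    chainOperator p k (1, A 0 + τ * A 0, A 0 * (τ * A 0)) A z
        (fun ε => grProduct p τ (k + r) A (shiftVar p z ε) n) =
      (p ^ ∑ i ∈ range k, n i)⁻¹ *
        pairing p (scale ((p ^ ∑ i ∈ range k, n i) * (A k / A 0))
          (1, A 0 + τ * A 0, A 0 * (τ * A 0))) (sitePair p (z k) 0) *
        grProduct p τ (k + r) A z n := by
  induction k generalizing A z n with
  | zero =>
    have : shiftVar p z 0 = z := by funext j; simp [shiftVar]
    rw [chainOperator_zero, this, smul_eq_mul]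
    simp [div_self (h.A_ne_zero 0), scale_one]
  | succ k ih =>
    have hp0 := hp.ne_zero
    have hA0 := h.A_ne_zero 0
    have hA1 := h.A_ne_zero 1
    set A' : ℕ → ℂ := fun j => A (j + 1) * p ^ n 0 with hA'
    set z' : ℕ → ℂ := fun j => z (j + 1) with hz'
    set n' : ℕ → ℕ := fun j => n (j + 1) with hn'
    have hih := ih A' z' n' (h.tail hp0 (n 0))
    have hP : p ^ n 0 ≠ 0 := pow_ne_zero _ hp0
    have local_rel : ∀ f : SignType, _ := fun f =>
      sum_site_askeyWilson hp (h.z_ne_zero 0) (h.z_ne_zero 1) (h.sq 0 (by omega))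
      (a := A 0) (τ := τ) (s := A 1 / A 0) (by
        have := h.ab 0 (by omega); convert this using 1; ring) (by
        have := h.ac 0 (by omega); convert this using 1; field_simp) (by
        have := h.ad 0 (by omega); convert this using 1; field_simp) (n 0) f
    -- With the other shifts fixed, the exchange relation absorbs the first site: its polynomial
    -- comes out, and the rescaled boundary vector is the initial one for the parameters A (j + 1)
    -- p^{n 0} of the shorter chain.
    have step : chainOperator p (k + 1) (1, A 0 + τ * A 0, A 0 * (τ * A 0)) A z
        (fun ε => grProduct p τ (k + 1 + r) A (shiftVar p z ε) n) =
        (p ^ n 0)⁻¹ * askeyWilson p (n 0) (A 0) (τ * A 0) (A 1 / A 0 * z 1)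
          (A 1 / A 0 * (z 1)⁻¹) (z 0) *
        chainOperator p k (1, A' 0 + τ * A' 0, A' 0 * (τ * A' 0)) A' z'
          (fun ε => grProduct p τ (k + r) A' (shiftVar p z' ε) n') := by
      rw [chainOperator_succ]
      simp only [chainOperator, smul_eq_mul, Finset.mul_sum]
      rw [Finset.sum_comm]
      refine Finset.sum_congr rfl fun ε _ => ?_
      have hl := local_rel (seqExt ε 0)
      rw [Nat.add_right_comm]
      simp only [grProduct]
      have hv : ∀ e : SignType, (fun j => shiftVar p z (seqCons e (seqExt ε)) (j + 1)) =
        shiftVar p z' (seqExt ε) := fun e => rfl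
      have hv0 : ∀ e : SignType, shiftVar p z (seqCons e (seqExt ε)) 0 = z 0 * p ^ (e : ℤ) :=
        fun e => rfl
      have hv1 : ∀ e : SignType, shiftVar p z (seqCons e (seqExt ε)) 1 =
        z 1 * p ^ ((seqExt ε 0 : SignType) : ℤ) := fun e => rfl
      have hl' : (1, A' 0 + τ * A' 0, A' 0 * (τ * A' 0)) =
          scale (p ^ n 0 * (A 1 / A 0)) (1, A 0 + τ * A 0, A 0 * (τ * A 0)) := by
        simp only [scale, hA', Prod.mk.injEq, true_and]
        constructor <;> field_simp
      have hr : ∀ j, A' (j + 1) / A' j = A (j + 1 + 1) / A (j + 1) := fun j => by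
        simp only [hA']
        rw [mul_div_mul_right _ _ hP]
      simp only [hv, hv0, hv1, chainCoeff, hl', hr]
      simp only [hz'] at hl ⊢
      generalize ∏ j ∈ range k, (siteWeight p (z (j + 1)) (seqExt ε j) *
        pairing p (scale (A (j + 1 + 1) / A (j + 1)) (sitePair p (z (j + 1)) (seqExt ε j)))
          (sitePair p (z (j + 1 + 1)) (seqExt ε (j + 1)))) = R
      have hl2 := congrArg (· * (R * grProduct p τ (k + r) A'
        (shiftVar p (fun j => z (j + 1)) (seqExt ε)) n')) hl
      simp only [Finset.sum_mul] at hl2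
      exact (Finset.sum_congr rfl fun e _ => by ring).trans (hl2.trans (by ring))
    rw [step, hih, Finset.sum_range_succ', pow_add]
    have e1 : scale ((p ^ ∑ i ∈ range k, n' i) * (A' k / A' 0))
          (1, A' 0 + τ * A' 0, A' 0 * (τ * A' 0)) =
        scale (((p ^ ∑ i ∈ range k, n (i + 1)) * p ^ n 0) * (A (k + 1) / A 0))
          (1, A 0 + τ * A 0, A 0 * (τ * A 0)) := by
      simp only [scale, hA', hn', Prod.mk.injEq, true_and]
      constructor <;> field_simp
    rw [e1, Nat.add_right_comm]
    simp only [grProduct]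
    rw [mul_inv]
    ring

/-! ### Expansion of the difference operator in shifts -/

section Expansion

variable {V : Type*} [AddCommGroup V] [Module ℂ V]

/-- The value at the origin of the product over `j` of the differences `E_j^{ν_j} - 1`
over the nonzero `ν_j`. -/
def differenceEval : (N : ℕ) → (Fin N → SignType) → ((Fin N → ℤ) → V) → V
  | 0, _, F => F 0
  | N + 1, ν, F =>
    differenceEval N (Fin.tail ν) (fun x => F (Fin.cons (ν 0 : ℤ) x)) -
      if ν 0 = 0 then 0 else differenceEval N (Fin.tail ν) (fun x => F (Fin.cons 0 x))

lemma differenceFactor_succ_apply {N : ℕ} (j : Fin N) (s : SignType) (c : ℤ)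
    (F : (Fin (N + 1) → ℤ) → V) :
    (fun y : Fin N → ℤ => differenceFactor V j.succ s F (Fin.cons c y)) =
      differenceFactor V j s (fun y => F (Fin.cons c y)) := by
  have key : ∀ (t : ℤ) (y : Fin N → ℤ), (Fin.cons c y : Fin (N + 1) → ℤ) + Pi.single j.succ t =
      Fin.cons c (y + Pi.single j t) := by
    intro t y
    funext i
    refine Fin.cases ?_ (fun i => ?_) i
    · simp [(Fin.succ_ne_zero j).symm]
    · simp [Pi.single_apply, Fin.succ_inj]
  funext y
  match s with
  | .pos => simp [differenceFactor, shiftOp, LinearMap.funLeft_apply, key]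
  | .neg =>
    have := key (-1) y
    simp only [Pi.single_neg] at this
    simp [differenceFactor, shiftOp, LinearMap.funLeft_apply, this]
  | .zero => simp [differenceFactor]

lemma differenceProduct_tail_apply {N : ℕ} (ν : Fin N → SignType) (F : (Fin (N + 1) → ℤ) → V)
    (c : ℤ) (y : Fin N → ℤ) :
    (List.ofFn fun j => differenceFactor V j.succ (ν j)).prod F (Fin.cons c y) =
      differenceProduct V ν (fun y => F (Fin.cons c y)) y := by
  rw [differenceProduct, List.ofFn_eq_map, List.ofFn_eq_map]
  generalize List.finRange N = L
  induction L generalizing y with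
  | nil => simp
  | cons j L ih =>
    simp only [List.map_cons, List.prod_cons, Module.End.mul_apply]
    have := congrFun (differenceFactor_succ_apply (V := V) j (ν j) c
      ((List.map (fun j => differenceFactor V j.succ (ν j)) L).prod F)) y
    rw [this]
    exact congrFun (congrArg _ (funext ih)) y

lemma neg_one_pow_card_eq {N : ℕ} (ν : Fin N → SignType) :
    (-1 : ℂ) ^ (univ.filter fun j => ν j = -1).card = ∏ j, if ν j = -1 then -1 else 1 := by
  rw [Finset.prod_ite, Finset.prod_const, Finset.prod_const_one, mul_one]

/-- The sign turns each factor 1 - E_j⁻¹ into E_j⁻¹ - 1, so that both signs of ν_j contribute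
E_j^{ν_j} - 1. -/
lemma sign_smul_differenceProduct {N : ℕ} (ν : Fin N → SignType) (F : (Fin N → ℤ) → V)
    (x : Fin N → ℤ) :
    ((-1 : ℂ) ^ (univ.filter fun j => ν j = -1).card) • differenceProduct V ν F x =
      differenceEval N ν fun y => F (x + y) := by
  rw [neg_one_pow_card_eq]
  induction N with
  | zero => simpa [differenceProduct, differenceEval] using congrArg F (Subsingleton.elim _ _)
  | succ N ih =>
    have hx : ∀ t : ℤ, x + Pi.single 0 t = Fin.cons (x 0 + t) (Fin.tail x) := by
      intro t
      funext i
      refine Fin.cases ?_ (fun i => ?_) i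
      · simp
      · simp [Fin.tail]
    have hx0 : x = Fin.cons (x 0) (Fin.tail x) := (Fin.cons_self_tail x).symm
    have hc : ∀ (t : ℤ) (y : Fin N → ℤ), x + Fin.cons t y = Fin.cons (x 0 + t) (Fin.tail x + y) := by
      intro t y
      funext i
      refine Fin.cases ?_ (fun i => ?_) i
      · simp
      · simp [Fin.tail]
    have hprod : differenceProduct V ν F = differenceFactor V 0 (ν 0)
        ((List.ofFn fun j => differenceFactor V j.succ (Fin.tail ν j)).prod F) := by
      rw [differenceProduct, List.ofFn_succ, List.prod_cons]
      rfl
    have ht := differenceProduct_tail_apply (V := V) (Fin.tail ν) F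
    rw [hprod, Fin.prod_univ_succ]
    simp only [differenceEval, hc]
    have ih' := fun c => ih (Fin.tail ν) (fun y => F (Fin.cons c y)) (Fin.tail x)
    simp only [← ih']
    set G := (List.ofFn fun j => differenceFactor V j.succ (Fin.tail ν j)).prod F
    have hGx : G x = differenceProduct V (Fin.tail ν) (fun y => F (Fin.cons (x 0) y))
        (Fin.tail x) := (congrArg G hx0).trans (ht _ _)
    have hs : ∀ j : Fin N, ν j.succ = Fin.tail ν j := fun j => rfl
    simp only [hs]
    generalize ∏ j, (if Fin.tail ν j = -1 then (-1 : ℂ) else 1) = π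
    match ν 0 with
    | .zero =>
      rw [show (SignType.zero : SignType) = 0 from rfl]
      have : differenceFactor V (0 : Fin (N + 1)) 0 = 1 := rfl
      rw [this]
      simp [hGx]
    | .pos =>
      rw [show (SignType.pos : SignType) = 1 from rfl]
      have : differenceFactor V (0 : Fin (N + 1)) 1 G x = G (x + Pi.single 0 1) - G x := rfl
      rw [this, hx, ht, hGx]
      simp [smul_sub]
    | .neg =>
      rw [show (SignType.neg : SignType) = -1 from rfl]
      have : differenceFactor V (0 : Fin (N + 1)) (-1) G x = G x - G (x + -Pi.single 0 1) := rfl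
      rw [this, ← Pi.single_neg, hx, ht, hGx]
      simp [smul_sub]
      abel

end Expansion

/-- The site data of a shift by which `ζ` is multiplied by `p`. -/
def shiftedPair (p ζ : ℂ) : ℂ × ℂ × ℂ := (1, (1 + p) * ζ, p * ζ ^ 2)

/-- The product along a chain of sites with nonzero shifts. -/
def listChain {ι : Type*} (p : ℂ) (a ζ : ι → ℂ) (b : ℂ) (r : ℂ × ℂ × ℂ) :
    ℂ → ℂ × ℂ × ℂ → List ι → ℂ
  | β, l, [] => pairing p (scale (b / β) l) r
  | β, l, i :: L => pairing p (scale (a i / β) l) (shiftedPair p (ζ i)) *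
      (1 / ((1 - ζ i ^ 2) * (1 - p * ζ i ^ 2))) * listChain p a ζ b r (a i) (shiftedPair p (ζ i)) L

lemma listChain_map {ι κ : Type*} (p : ℂ) (f : κ → ι) (a ζ : ι → ℂ) (b β : ℂ)
    (r l : ℂ × ℂ × ℂ) (L : List κ) :
    listChain p a ζ b r β l (L.map f) =
      listChain p (fun i => a (f i)) (fun i => ζ (f i)) b r β l L := by
  induction L generalizing β l with
  | nil => rfl
  | cons i L ih => simp only [List.map_cons, listChain, ih]

/-- Each link between shifted sites splits into two linear factors, as does the last link to an
unshifted site with variable y; these are the factors in `Phi`. -/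
lemma listChain_cons_eq {ι : Type*} {p : ℂ} (hp : IsGenericBase p) (a ζ : ι → ℂ) {b y : ℂ}
    (hy : y ≠ 0) (ha : ∀ i, a i ≠ 0) (β : ℂ) (l : ℂ × ℂ × ℂ) (i : ι) (L : List ι) :
    listChain p a ζ b (1, y + y⁻¹, 1) β l (i :: L) =
      pairing p (scale (a i / β) l) (shiftedPair p (ζ i)) *
        ((((i :: L).zip L).map fun x => (1 - a x.2 * ζ x.2 * ζ x.1 / a x.1) *
            (1 - p * a x.2 * ζ x.2 * ζ x.1 / a x.1)).prod /
          ((i :: L).map fun i => (1 - ζ i ^ 2) * (1 - p * ζ i ^ 2)).prod) *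
        (i :: L).getLast?.elim 1 fun i =>
          (1 - b * y * ζ i / a i) * (1 - b * ζ i / (a i * y)) := by
  have hp0 := hp.ne_zero
  have hp1 := hp.one_add_ne_zero
  induction L generalizing β l i with
  | nil =>
    have hi := ha i
    have : pairing p (scale (b / a i) (shiftedPair p (ζ i))) (1, y + y⁻¹, 1) =
        (1 - b * y * ζ i / a i) * (1 - b * ζ i / (a i * y)) := by
      simp only [pairing, scale, shiftedPair]
      field_simp
      ring
    simp only [listChain, this]
    simp
  | cons j L ih =>
    have hi := ha i
    have : pairing p (scale (a j / a i) (shiftedPair p (ζ i))) (shiftedPair p (ζ j)) =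
        (1 - a j * ζ j * ζ i / a i) * (1 - p * a j * ζ j * ζ i / a i) := by
      simp only [pairing, scale, shiftedPair]
      field_simp
      ring
    rw [listChain, ih, this, List.getLast?_cons_cons]
    simp only [List.zip_cons_cons, List.map_cons, List.prod_cons]
    rw [mul_comm ((1 - ζ i ^ 2) * (1 - p * ζ i ^ 2)), mul_div_mul_comm]
    simp only [div_eq_mul_inv, mul_inv]
    ring

/-- The variable `z` or `z⁻¹`, depending on the sign of the shift. -/
def signedVar (z : ℂ) (e : SignType) : ℂ := if e = -1 then z⁻¹ else z

lemma sitePair_eq_shiftedPair (p z : ℂ) {e : SignType} (he : e ≠ 0) :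
    sitePair p z e = shiftedPair p (signedVar z e) := by
  match e with
  | .zero => exact absurd rfl he
  | .pos => rfl
  | .neg => rfl

lemma siteWeight_eq (p z : ℂ) {e : SignType} (he : e ≠ 0) :
    siteWeight p z e = 1 / ((1 - signedVar z e ^ 2) * (1 - p * signedVar z e ^ 2)) := by
  match e with
  | .zero => exact absurd rfl he
  | .pos => rfl
  | .neg => rfl

/-- The coefficient of the difference `∏ (E_j^{ν_j} - 1)`, with left boundary data `β`, `l`. -/
def differenceCoeff (p : ℂ) (N : ℕ) (β : ℂ) (l : ℂ × ℂ × ℂ) (A z : ℕ → ℂ)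
    (ν : Fin N → SignType) : ℂ :=
  listChain p (fun i : Fin N => A i) (fun i => signedVar (z i) (ν i)) (A N) (sitePair p (z N) 0)
    β l ((List.finRange N).filter fun j => ν j ≠ 0)

/-- A site with ν_j = 0 drops out of the chain: the last visited site, recorded in β and l, is
linked directly to the next one that is shifted. -/
lemma differenceCoeff_cons (p : ℂ) (N : ℕ) (β : ℂ) (l : ℂ × ℂ × ℂ) (A z : ℕ → ℂ)
    (e : SignType) (ν : Fin N → SignType) :
    differenceCoeff p (N + 1) β l A z (Fin.cons e ν) =
      if e = 0 then differenceCoeff p N β l (fun j => A (j + 1)) (fun j => z (j + 1)) ν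
      else pairing p (scale (A 0 / β) l) (sitePair p (z 0) e) * siteWeight p (z 0) e *
        differenceCoeff p N (A 0) (sitePair p (z 0) e) (fun j => A (j + 1))
          (fun j => z (j + 1)) ν := by
  have tail : ((List.finRange N).map Fin.succ).filter
      (fun j => (Fin.cons e ν : Fin (N + 1) → SignType) j ≠ 0) =
      ((List.finRange N).filter fun j => ν j ≠ 0).map Fin.succ := by
    rw [List.filter_map]
    congr 1
  unfold differenceCoeff
  rw [List.finRange_succ, List.filter_cons, tail]
  split_ifs with h1 h2 h2
  · simp [h2] at h1
  · rw [listChain, listChain_map, sitePair_eq_shiftedPair p _ h2, siteWeight_eq p _ h2]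
    simp
  · rw [listChain_map]
    simp
  · simp [h2] at h1

/-- Expanding the boundary vector in the orthogonal basis of a further site reinstates a site that
was skipped. -/
lemma chainOperator_resolution {V : Type*} [AddCommGroup V] [Module ℂ V] {p y : ℂ}
    (hp : IsGenericBase p) (hy : y ≠ 0) (hy2 : NotPow p (y ^ 2)) (k : ℕ) (t : ℂ)
    (l : ℂ × ℂ × ℂ) (A z : ℕ → ℂ) (F : (ℕ → SignType) → V) :
    chainOperator p k (scale t l) A z F =
      ∑ e, (pairing p l (sitePair p y e) * siteWeight p y e) •
        chainOperator p k (scale t (sitePair p y e)) A z F := by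
  simp only [chainOperator, Finset.smul_sum, smul_smul]
  rw [Finset.sum_comm]
  refine Finset.sum_congr rfl fun ε _ => ?_
  rw [← Finset.sum_smul]
  congr 1
  simp only [chainCoeff, pairing_scale p t]
  rw [← sum_pairing_sitePair hp hy hy2, Finset.sum_mul]
  exact Finset.sum_congr rfl fun e _ => by ring

/-- Induction on the first site. The terms with ν_0 = 0 skip it, and the resolution of the identity
rewrites them as a sum over all shifts e of that site, with F unshifted there. The terms with ν_0 ≠
0 contribute E^e F - F; the subtracted parts cancel the summands e ≠ 0 of that sum, and the full
transfer matrix remains. -/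
lemma sum_differenceCoeff_smul {V : Type*} [AddCommGroup V] [Module ℂ V] {p : ℂ}
    (hp : IsGenericBase p) (N : ℕ) (β : ℂ) (l : ℂ × ℂ × ℂ) (A z : ℕ → ℂ) (hA : ∀ j, A j ≠ 0)
    (hz : ∀ j, z j ≠ 0) (hz2 : ∀ j < N, NotPow p (z j ^ 2)) (F : (Fin N → ℤ) → V) :
    ∑ ν, differenceCoeff p N β l A z ν • differenceEval N ν F =
      chainOperator p N (scale (A 0 / β) l) A z fun ε => F fun i => (ε i : ℤ) := by
  induction N generalizing β l A z with
  | zero =>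
    have hF : ∀ x, F x = F 0 := fun x => congrArg F (Subsingleton.elim _ _)
    rw [chainOperator_zero, hF fun i => _]
    simp [differenceCoeff, listChain, differenceEval]
  | succ N ih =>
    have ih' := fun β l F => ih β l (fun j => A (j + 1)) (fun j => z (j + 1))
      (fun j => hA _) (fun j => hz _) (fun j hj => hz2 _ (by omega)) F
    have hcons : ∀ (e : SignType) (ε : ℕ → SignType),
        (fun i : Fin (N + 1) => ((seqCons e ε i : SignType) : ℤ)) = Fin.cons (e : ℤ) fun i => (ε i : ℤ) := by
      intro e ε
      funext i
      exact Fin.cases rfl (fun i => rfl) i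
    have hs : scale (A 1 / β) l = scale (A 1 / A 0) (scale (A 0 / β) l) := by
      rw [scale_scale, div_mul_div_cancel₀ (hA 0)]
    have h0 := chainOperator_resolution hp (hz 0) (hz2 0 (by omega)) N (A 1 / A 0)
      (scale (A 0 / β) l) (fun j => A (j + 1)) (fun j => z (j + 1))
      fun ε => F (Fin.cons 0 fun i => (ε i : ℤ))
    rw [chainOperator_succ]
    simp only [sum_fin_cons, differenceCoeff_cons, differenceEval, Fin.tail_cons, Fin.cons_zero,
      hcons]
    rw [sum_signType] at h0
    rw [sum_signType, sum_signType]
    have n1 : (SignType.pos : SignType) ≠ 0 := by decide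
    have n2 : (SignType.neg : SignType) ≠ 0 := by decide
    have n3 : (SignType.zero : SignType) = 0 := rfl
    simp only [if_neg n1, if_neg n2, n3, if_true, sub_zero, SignType.coe_zero, smul_sub,
      Finset.sum_sub_distrib, mul_smul (_ * _) (differenceCoeff _ _ _ _ _ _ _),
      ← Finset.smul_sum, ih', zero_add, hs, h0]
    abel

/-- The boundary factors of `Phi` are links as well: those with i₁ come from an unshifted site to
the left with parameter and variable α₀, those with i_s from the unshifted site z_{N+1} = α_{N+2}.
-/
lemma phi_eq_differenceCoeff {N : ℕ} {q : ℂ} (hp : IsGenericBase (q ^ 2)) (α : ℕ → ℂ)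
    (hα : ∀ i ≤ N + 2, α i ≠ 0) (z : Fin N → ℂ) {ν : Fin N → SignType} (hν : ν ≠ 0) (Z : ℕ → ℂ)
    (hZ : ∀ i : Fin N, Z i = z i) (hN : Z N = α (N + 2)) :
    Phi q α ν z = differenceCoeff (q ^ 2) N (α 0) (1, α 0 + (α 0)⁻¹, 1) (fun j => α (j + 1)) Z ν := by
  have hα' : ∀ i : Fin N, α (i + 1) ≠ 0 := fun i => hα _ (by omega)
  unfold differenceCoeff
  have hζ : (fun i : Fin N => signedVar (Z i) (ν i)) =
      fun j => if ν j = -1 then (z j)⁻¹ else z j := by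
    funext i
    rw [hZ, signedVar]
  unfold Phi
  rw [hζ, hN]
  cases hL : (List.finRange N).filter fun j => ν j ≠ 0 with
  | nil =>
    exfalso
    apply hν
    funext i
    by_contra h
    have : i ∈ (List.finRange N).filter fun j => ν j ≠ 0 := by
      simpa using h
    rw [hL] at this
    simp at this
  | cons i L =>
    have := listChain_cons_eq hp (fun i : Fin N => α (i + 1))
      (fun j => if ν j = -1 then (z j)⁻¹ else z j) (b := α (N + 1))
      (hα (N + 2) le_rfl) hα' (α 0) (1, α 0 + (α 0)⁻¹, 1) i L
    have h0 := hα 0 (by omega)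
    have hp1 := hp.one_add_ne_zero
    have hp0 := hp.ne_zero
    have h1 : ∀ ζ, pairing (q ^ 2) (scale (α (i + 1) / α 0) (1, α 0 + (α 0)⁻¹, 1))
        (shiftedPair (q ^ 2) ζ) = (1 - α (i + 1) * ζ) * (1 - α (i + 1) * ζ / α 0 ^ 2) := by
      intro ζ
      simp only [pairing, scale, shiftedPair]
      generalize q ^ 2 = p at *
      field_simp
      ring
    rw [h1] at this
    simp only [sitePair]
    exact this.symm

/-- The transfer matrix is the sum over all ν, including ν = 0. The additional multiple of F 0 is
the difference between the constant in Iliev's operator and the coefficient at ν = 0. -/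
theorem operatorAt_eq_chainOperator {N : ℕ} {V : Type*} [AddCommGroup V] [Module ℂ V] {q : ℂ}
    (hp : IsGenericBase (q ^ 2)) (α : ℕ → ℂ) (hα : ∀ i ≤ N + 2, α i ≠ 0) (z : Fin N → ℂ)
    (F : (Fin N → ℤ) → V) (A Z : ℕ → ℂ) (hA : ∀ j, A j ≠ 0) (hAα : ∀ j ≤ N, A j = α (j + 1))
    (hZ : ∀ i : Fin N, Z i = z i) (hN : Z N = α (N + 2)) (hZ0 : ∀ j, Z j ≠ 0)
    (hz2 : ∀ j < N, NotPow (q ^ 2) (Z j ^ 2)) :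
    operatorAt q α z F = (α 0 * q / α (N + 1)) •
      (chainOperator (q ^ 2) N (1, A 0 + (α 0 ^ 2)⁻¹ * A 0, A 0 * ((α 0 ^ 2)⁻¹ * A 0)) A Z
        (fun ε => F fun i => (ε i : ℤ)) +
      (α (N + 1) / α 0 * (α 0 + (α 0)⁻¹) * (α (N + 2) + (α (N + 2))⁻¹) / (1 + q ^ 2)) • F 0) := by
  have h0 : α 0 ≠ 0 := hα 0 (by omega)
  have hp1 := hp.one_add_ne_zero
  have hp0 := hp.ne_zero
  have main := sum_differenceCoeff_smul hp N (α 0) (1, α 0 + (α 0)⁻¹, 1) A Z hA hZ0 hz2 F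
  have hl : scale (A 0 / α 0) (1, α 0 + (α 0)⁻¹, 1) =
      (1, A 0 + (α 0 ^ 2)⁻¹ * A 0, A 0 * ((α 0 ^ 2)⁻¹ * A 0)) := by
    simp only [scale, Prod.mk.injEq, true_and]
    constructor <;> field_simp
  have hcoef : ∀ ν : Fin N → SignType, differenceCoeff (q ^ 2) N (α 0) (1, α 0 + (α 0)⁻¹, 1) A Z ν =
      differenceCoeff (q ^ 2) N (α 0) (1, α 0 + (α 0)⁻¹, 1) (fun j => α (j + 1)) Z ν := by
    intro ν
    unfold differenceCoeff
    rw [hAα N le_rfl]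
    congr 1
    funext i
    exact hAα i (by omega)
  have hsum : ∑ ν : Fin N → SignType with ν ≠ 0,
        ((-1 : ℂ) ^ (univ.filter fun j => ν j = -1).card * Phi q α ν z) •
          differenceProduct V ν F 0 =
      ∑ ν : Fin N → SignType with ν ≠ 0,
        differenceCoeff (q ^ 2) N (α 0) (1, α 0 + (α 0)⁻¹, 1) A Z ν • differenceEval N ν F := by
    refine Finset.sum_congr rfl fun ν hν => ?_
    rw [phi_eq_differenceCoeff hp α hα z (Finset.mem_filter.mp hν).2 Z hZ hN, hcoef, mul_comm,
      mul_smul, sign_smul_differenceProduct]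
    simp
  have hzero : differenceCoeff (q ^ 2) N (α 0) (1, α 0 + (α 0)⁻¹, 1) A Z 0 =
      1 + α (N + 1) ^ 2 / (q ^ 2 * α 0 ^ 2) -
      α (N + 1) / α 0 * (α 0 + (α 0)⁻¹) * (α (N + 2) + (α (N + 2))⁻¹) / (1 + q ^ 2) := by
    have h2 := hα (N + 2) le_rfl
    simp only [differenceCoeff, Pi.zero_apply, ne_eq, not_true_eq_false, decide_false,
      List.filter_false, listChain, hN, hAα N le_rfl]
    simp only [pairing, scale]
    rw [show (0 : SignType) = SignType.zero from rfl]
    simp only [sitePair]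
    generalize q ^ 2 = p at *
    field_simp
    ring
  have heval : ∀ (M : ℕ) (F : (Fin M → ℤ) → V), differenceEval M 0 F = F 0 := by
    intro M
    induction M with
    | zero => intro F; rfl
    | succ M ih =>
      intro F
      have : Fin.tail (0 : Fin (M + 1) → SignType) = 0 := rfl
      rw [differenceEval, this, ih, Pi.zero_apply, if_pos rfl, sub_zero]
      congr 1
      funext i
      exact Fin.cases rfl (fun i => rfl) i
  rw [operatorAt, hsum, Finset.filter_ne', Finset.sum_erase_eq_sub (Finset.mem_univ _), main, hl,
    hzero, heval, sub_smul]
  congr 1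
  abel

/-! ### The discrete support -/

/-- The product of the factors `1 - s pⁱ x` (`i < t`) or `1 - s pⁱ x⁻¹` (`i < -t`). -/
def shiftFactor (p s : ℂ) (t : ℤ) (x : ℂ) : ℂ :=
  (∏ i ∈ range t.toNat, (1 - s * p ^ i * x)) * ∏ i ∈ range (-t).toNat, (1 - s * p ^ i * x⁻¹)

lemma shiftFactor_zero (p s x : ℂ) : shiftFactor p s 0 x = 1 := by simp [shiftFactor]

lemma shiftFactor_one (p s x : ℂ) : shiftFactor p s 1 x = 1 - s * x := by simp [shiftFactor]

lemma shiftFactor_two (p s x : ℂ) : shiftFactor p s 2 x = (1 - s * x) * (1 - s * p * x) := by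
  simp [shiftFactor, Finset.prod_range_succ, show (2 : ℤ).toNat = 2 from rfl]

lemma shiftFactor_neg (p s x : ℂ) (t : ℤ) : shiftFactor p s (-t) x = shiftFactor p s t x⁻¹ := by
  simp [shiftFactor, mul_comm]

/-- Factorization of the transfer weights other than that of two zero shifts. -/
lemma pairing_sitePair_sitePair {p z w : ℂ} (hp : IsGenericBase p) (hz : z ≠ 0) (hw : w ≠ 0)
    (s : ℂ) {e f : SignType} (h : ¬(e = 0 ∧ f = 0)) :
    pairing p (scale s (sitePair p z e)) (sitePair p w f) =
      shiftFactor p s (e + f) (z * w) * shiftFactor p s (e - f) (z / w) := by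
  have hp0 := hp.ne_zero
  have hp1 := hp.one_add_ne_zero
  have i0 : ((SignType.zero : SignType) : ℤ) = 0 := rfl
  have i1 : ((SignType.pos : SignType) : ℤ) = 1 := rfl
  have i2 : ((SignType.neg : SignType) : ℤ) = -1 := rfl
  match e, f with
  | .zero, .zero => exact absurd ⟨rfl, rfl⟩ h
  | .zero, .pos =>
    rw [i0, i1, zero_add, zero_sub, shiftFactor_neg, shiftFactor_one, shiftFactor_one]
    simp only [pairing, scale, sitePair]; field_simp; ring
  | .zero, .neg =>
    rw [i0, i2, zero_add, zero_sub, neg_neg, shiftFactor_neg, shiftFactor_one, shiftFactor_one]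
    simp only [pairing, scale, sitePair]; field_simp; ring
  | .pos, .zero =>
    rw [i0, i1, add_zero, sub_zero, shiftFactor_one, shiftFactor_one]
    simp only [pairing, scale, sitePair]; field_simp; ring
  | .neg, .zero =>
    rw [i0, i2, add_zero, sub_zero, shiftFactor_neg, shiftFactor_neg, shiftFactor_one,
      shiftFactor_one]
    simp only [pairing, scale, sitePair]; field_simp; ring
  | .pos, .pos =>
    rw [i1, sub_self, one_add_one_eq_two, shiftFactor_zero, shiftFactor_two]
    simp only [pairing, scale, sitePair]; field_simp; ring
  | .neg, .neg =>
    rw [i2, sub_self, ← neg_add, one_add_one_eq_two, shiftFactor_neg, shiftFactor_zero,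
      shiftFactor_two]
    simp only [pairing, scale, sitePair]; field_simp; ring
  | .pos, .neg =>
    rw [i1, i2, add_neg_cancel, sub_neg_eq_add, one_add_one_eq_two, shiftFactor_zero,
      shiftFactor_two]
    simp only [pairing, scale, sitePair]; field_simp; ring
  | .neg, .pos =>
    rw [i1, i2, neg_add_cancel, show (-1 : ℤ) - 1 = -2 by norm_num, shiftFactor_neg,
      shiftFactor_zero, shiftFactor_two]
    simp only [pairing, scale, sitePair]; field_simp; ring

/-- At x = s p^d with s² = p⁻ᵐ the factors are 1 - p^{i+d-m} and 1 - p^{i-d}. A step t past either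
end of 0, …, m includes one that is zero. -/
lemma shiftFactor_support_ne_zero {p s : ℂ} (hp : p ≠ 0) {m : ℕ} (hs : s ^ 2 = p ^ (-(m : ℤ)))
    {d t : ℤ} (h0 : 0 ≤ d) (hm : d ≤ m) (h : shiftFactor p s t (s * p ^ d) ≠ 0) :
    0 ≤ d + t ∧ d + t ≤ m := by
  have hs0 : s ≠ 0 := by
    rintro rfl
    exact zpow_ne_zero _ hp (hs.symm.trans (by simp))
  rw [shiftFactor, mul_ne_zero_iff, Finset.prod_ne_zero_iff, Finset.prod_ne_zero_iff] at h
  obtain ⟨h1, h2⟩ := h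
  constructor
  · by_contra hlt
    apply h2 d.toNat (Finset.mem_range.mpr (by omega))
    rw [← zpow_natCast, Int.toNat_of_nonneg h0, mul_inv_cancel₀ (mul_ne_zero hs0 (zpow_ne_zero _ hp)),
      sub_self]
  · by_contra hlt
    apply h1 (m - d).toNat (Finset.mem_range.mpr (by omega))
    rw [← zpow_natCast, Int.toNat_of_nonneg (by omega), sub_eq_zero]
    have : s * p ^ ((m : ℤ) - d) * (s * p ^ d) = s ^ 2 * (p ^ ((m : ℤ) - d) * p ^ d) := by ring
    rw [this, hs, ← zpow_add₀ hp, ← zpow_add₀ hp]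
    simp

/-- Parameters of the discrete support: `A j = α_{j+1}`, `w = α_{N+2}`, `τ = α₀⁻²`. -/
structure IsSupportData (p τ w : ℂ) (A : ℕ → ℂ) (m : ℕ → ℕ) (N : ℕ) : Prop where
  base : IsGenericBase p
  A_ne_zero : ∀ j, A j ≠ 0
  w_ne_zero : w ≠ 0
  ratio : ∀ j < N, (A (j + 1) / A j) ^ 2 = p ^ (-(m j : ℤ))
  ab : NotPow p (τ * A 0 ^ 2)
  ac : NotPow p (A N * w)
  ad : NotPow p (A N / w)
  bc : NotPow p (τ * (A N * w))
  bd : NotPow p (τ * (A N / w))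
  sq : NotPow p (w ^ 2)

/-- The points of the discrete support. -/
def supportVar (p w : ℂ) (A : ℕ → ℂ) (N : ℕ) (Y : ℕ → ℤ) (j : ℕ) : ℂ := A N * w / A j * p ^ Y j

/-- The sequences of exponents of the points of the discrete support. -/
structure IsGridSeq (m : ℕ → ℕ) (N : ℕ) (Y : ℕ → ℤ) : Prop where
  zero : ∀ j, N ≤ j → Y j = 0
  nonneg : ∀ j < N, 0 ≤ Y j - Y (j + 1)
  le : ∀ j < N, Y j - Y (j + 1) ≤ m j

namespace IsSupportData

variable {p τ w : ℂ} {A : ℕ → ℂ} {m : ℕ → ℕ} {N : ℕ} (h : IsSupportData p τ w A m N)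
include h

/-- The ratios of the parameters are powers of p only after squaring. This suffices to carry the
genericity conditions from the ends of the chain to every site. -/
lemma exists_sq_eq {j : ℕ} (hj : j ≤ N) : ∃ k : ℤ, A j ^ 2 = A 0 ^ 2 * p ^ k := by
  induction j with
  | zero => exact ⟨0, by simp⟩
  | succ j ih =>
    obtain ⟨k, hk⟩ := ih (by omega)
    refine ⟨k + -(m j : ℤ), ?_⟩
    rw [zpow_add₀ h.base.ne_zero, ← mul_assoc, ← hk, ← h.ratio j (by omega), div_pow,
      mul_div_cancel₀ _ (pow_ne_zero _ (h.A_ne_zero j))]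

lemma exists_sq_eq' {i j : ℕ} (hi : i ≤ N) (hj : j ≤ N) : ∃ k : ℤ, A i ^ 2 = A j ^ 2 * p ^ k := by
  obtain ⟨k, hk⟩ := h.exists_sq_eq hi
  obtain ⟨l, hl⟩ := h.exists_sq_eq hj
  refine ⟨k - l, ?_⟩
  rw [zpow_sub₀ h.base.ne_zero, hk, hl]
  have := zpow_ne_zero l h.base.ne_zero
  field_simp

lemma supportVar_ne_zero (Y : ℕ → ℤ) (j : ℕ) : supportVar p w A N Y j ≠ 0 :=
  mul_ne_zero (div_ne_zero (mul_ne_zero (h.A_ne_zero _) h.w_ne_zero) (h.A_ne_zero _))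
    (zpow_ne_zero _ h.base.ne_zero)

lemma notPow_supportVar_sq (Y : ℕ → ℤ) {j : ℕ} (hj : j ≤ N) :
    NotPow p (supportVar p w A N Y j ^ 2) := by
  obtain ⟨k, hk⟩ := h.exists_sq_eq' le_rfl hj
  have := h.sq.mul_zpow h.base.ne_zero (k + (Y j + Y j))
  convert this using 1
  have hA := h.A_ne_zero j
  rw [supportVar, mul_pow, div_pow, mul_pow, hk, zpow_add₀ h.base.ne_zero,
    zpow_add₀ h.base.ne_zero]
  field_simp

lemma notPow_ab {j : ℕ} (hj : j ≤ N) : NotPow p (τ * A j ^ 2) := by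
  obtain ⟨k, hk⟩ := h.exists_sq_eq hj
  rw [hk, ← mul_assoc]
  exact h.ab.mul_zpow h.base.ne_zero k

lemma mul_supportVar (Y : ℕ → ℤ) (j : ℕ) : A j * supportVar p w A N Y j = A N * w * p ^ Y j := by
  have hA := h.A_ne_zero j
  rw [supportVar]
  field_simp

lemma exists_mul_inv_supportVar (Y : ℕ → ℤ) {j : ℕ} (hj : j ≤ N) :
    ∃ k : ℤ, A j * (supportVar p w A N Y j)⁻¹ = A N / w * p ^ k := by
  obtain ⟨k, hk⟩ := h.exists_sq_eq' hj le_rfl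
  refine ⟨k - Y j, ?_⟩
  have hA := h.A_ne_zero j
  have hA' := h.A_ne_zero N
  have hw := h.w_ne_zero
  have hp := zpow_ne_zero (Y j) h.base.ne_zero
  rw [supportVar, zpow_sub₀ h.base.ne_zero]
  field_simp
  linear_combination hk

lemma isGenericPoint (Y : ℕ → ℤ) : IsGenericPoint p τ A (supportVar p w A N Y) N where
  A_ne_zero := h.A_ne_zero
  z_ne_zero := h.supportVar_ne_zero Y
  sq j hj := h.notPow_supportVar_sq Y hj.le
  ab j hj := h.notPow_ab hj.le
  ac j _ := by
    rw [h.mul_supportVar]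
    exact h.ac.mul_zpow h.base.ne_zero _
  ad j hj := by
    obtain ⟨k, hk⟩ := h.exists_mul_inv_supportVar Y (j := j + 1) hj
    rw [hk]
    exact h.ad.mul_zpow h.base.ne_zero _

lemma supportVar_div (Y : ℕ → ℤ) (j : ℕ) :
    supportVar p w A N Y j / supportVar p w A N Y (j + 1) =
      A (j + 1) / A j * p ^ (Y j - Y (j + 1)) := by
  have hA := h.A_ne_zero j
  have hA1 := h.A_ne_zero (j + 1)
  have hA' := h.A_ne_zero N
  have hw := h.w_ne_zero
  have hp := zpow_ne_zero (Y (j + 1)) h.base.ne_zero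
  rw [supportVar, supportVar, zpow_sub₀ h.base.ne_zero]
  field_simp

/-- The coefficients of the shifts that leave the support vanish. -/
lemma isGridSeq_of_chainCoeff_ne_zero {Y : ℕ → ℤ} (hY : IsGridSeq m N Y) {k : ℕ} (hk : k ≤ N)
    {l : ℂ × ℂ × ℂ} {ε : ℕ → SignType} (hε : ∀ j, k ≤ j → ε j = 0)
    (hc : chainCoeff p k l A (supportVar p w A N Y) ε ≠ 0) :
    IsGridSeq m N fun j => Y j + ε j := by
  have key : ∀ j < N, 0 ≤ (Y j - Y (j + 1)) + (ε j - ε (j + 1) : ℤ) ∧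
      (Y j - Y (j + 1)) + (ε j - ε (j + 1) : ℤ) ≤ m j := by
    intro j hj
    have h1 := hY.nonneg j hj
    have h2 := hY.le j hj
    by_cases h00 : ε j = 0 ∧ ε (j + 1) = 0
    · simp only [h00.1, h00.2, SignType.coe_zero, sub_zero, add_zero]
      exact ⟨h1, h2⟩
    have hjk : j < k := by
      by_contra hjk
      exact h00 ⟨hε _ (by omega), hε _ (by omega)⟩
    rw [chainCoeff, mul_ne_zero_iff, Finset.prod_ne_zero_iff] at hc
    have := (mul_ne_zero_iff.mp (hc.2 j (Finset.mem_range.mpr hjk))).2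
    -- The ratio z_j/z_{j+1} is s p^d with s² = p^{-m j}, where d = Y j - Y (j + 1) is the grid
    -- coordinate; the second shift factor therefore confines d.
    rw [pairing_sitePair_sitePair h.base (h.supportVar_ne_zero _ _) (h.supportVar_ne_zero _ _) _ h00,
      h.supportVar_div] at this
    exact shiftFactor_support_ne_zero h.base.ne_zero (h.ratio j hj) h1 h2
      (mul_ne_zero_iff.mp this).2
  refine ⟨fun j hj => ?_, fun j hj => ?_, fun j hj => ?_⟩
  · simp [hY.zero j hj, hε j (hk.trans hj)]
  · have := (key j hj).1
    omega
  · have := (key j hj).2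
    omega

lemma shiftVar_supportVar (Y : ℕ → ℤ) (ε : ℕ → SignType) :
    shiftVar p (supportVar p w A N Y) ε = supportVar p w A N fun j => Y j + ε j := by
  funext j
  rw [shiftVar, supportVar, supportVar, zpow_add₀ h.base.ne_zero, mul_assoc]

/-- The difference equations on the discrete support, for arbitrary values elsewhere. -/
theorem chainOperator_support {Y : ℕ → ℤ} (hY : IsGridSeq m N Y) {k : ℕ} (hk : k ≤ N)
    (n : ℕ → ℕ) (F : (ℕ → SignType) → ℂ) (C : ℂ)
    (hF : ∀ ε : ℕ → SignType, IsGridSeq m N (fun j => Y j + ε j) →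
      F ε = C * grProduct p τ N A (supportVar p w A N fun j => Y j + ε j) n) :
    chainOperator p k (1, A 0 + τ * A 0, A 0 * (τ * A 0)) A (supportVar p w A N Y) F =
      (p ^ ∑ i ∈ range k, n i)⁻¹ *
        pairing p (scale ((p ^ ∑ i ∈ range k, n i) * (A k / A 0))
          (1, A 0 + τ * A 0, A 0 * (τ * A 0))) (sitePair p (supportVar p w A N Y k) 0) *
        (C * grProduct p τ N A (supportVar p w A N Y) n) := by
  have hg := h.isGenericPoint Y
  have main := chainOperator_grProduct h.base k (N - k) A (supportVar p w A N Y) n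
    ⟨hg.A_ne_zero, hg.z_ne_zero, fun j hj => hg.sq j (by omega), fun j hj => hg.ab j (by omega),
      fun j hj => hg.ac j (by omega), fun j hj => hg.ad j (by omega)⟩
  rw [Nat.add_sub_cancel' hk] at main
  rw [mul_left_comm _ C, ← main, chainOperator, chainOperator, Finset.mul_sum]
  refine Finset.sum_congr rfl fun ε _ => ?_
  -- A shift that leaves the grid has coefficient zero, so the value of F there is irrelevant.
  by_cases hc : chainCoeff p k (1, A 0 + τ * A 0, A 0 * (τ * A 0)) A (supportVar p w A N Y)
      (seqExt ε) = 0
  · simp [hc]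
  · have hε : ∀ j, k ≤ j → seqExt ε j = 0 := fun j hj => by simp [seqExt, not_lt.mpr hj]
    rw [hF _ (h.isGridSeq_of_chainCoeff_ne_zero hY hk hε hc), h.shiftVar_supportVar]
    simp only [smul_eq_mul]
    ring

end IsSupportData

/-! ### The recurrence in the dual indices -/

lemma psum_eq_sum_range {M : Type*} [AddCommMonoid M] {N : ℕ} (v : Fin N → M) (k : ℕ) :
    psum v k = ∑ j ∈ range k, seqExt v j := by
  rw [psum, Finset.sum_filter]
  have h1 : ∑ i : Fin N, (if i.val < k then v i else 0) =
      ∑ j ∈ range N, if j < k then seqExt v j else 0 := by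
    rw [Finset.sum_range]
    refine Finset.sum_congr rfl fun i _ => ?_
    simp [seqExt]
  rw [h1, ← Finset.sum_filter]
  refine Finset.sum_subset_zero_on_sdiff ?_ ?_ fun _ _ => rfl
  · intro j hj
    simp only [Finset.mem_filter, Finset.mem_range] at hj ⊢
    exact hj.2
  · intro j hj
    simp only [Finset.mem_sdiff, Finset.mem_filter, Finset.mem_range, not_and] at hj
    have : ¬ j < N := fun h => hj.2 h hj.1
    simp [seqExt, this]

lemma grProduct_eq_prod (p τ : ℂ) (k : ℕ) (A z : ℕ → ℂ) (n : ℕ → ℕ) (hp : p ≠ 0) :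
    grProduct p τ k A z n = ∏ i ∈ range k,
      askeyWilson p (n i) (A i * p ^ ∑ j ∈ range i, n j) (τ * A i * p ^ ∑ j ∈ range i, n j)
        (A (i + 1) / A i * z (i + 1)) (A (i + 1) / A i * (z (i + 1))⁻¹) (z i) := by
  induction k generalizing A z n with
  | zero => rfl
  | succ k ih =>
    rw [grProduct, ih, Finset.prod_range_succ', mul_comm]
    congr 1
    · refine Finset.prod_congr rfl fun i _ => ?_
      have hP := pow_ne_zero (n 0) hp
      rw [Finset.sum_range_succ', mul_div_mul_right _ _ hP, add_comm, pow_add]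
      congr 1 <;> ring
    · simp

/-- The parameters `α₁, …, α_{N+1}`. -/
def paramSeq (N : ℕ) (α : ℕ → ℂ) (j : ℕ) : ℂ := if j ≤ N then α (j + 1) else 1

lemma paramSeq_of_le {N j : ℕ} (α : ℕ → ℂ) (h : j ≤ N) : paramSeq N α j = α (j + 1) := if_pos h

/-- The exponents of a point of the discrete support. -/
def gridExp {N : ℕ} (nt : Fin N → ℤ) (j : ℕ) : ℤ := psum nt (N - j)

lemma gridExp_of_le {N : ℕ} (nt : Fin N → ℤ) {j : ℕ} (hj : N ≤ j) : gridExp nt j = 0 := by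
  simp [gridExp, psum_eq_sum_range, Nat.sub_eq_zero_of_le hj]

lemma gridExp_sub {N : ℕ} (nt : Fin N → ℤ) (i : Fin N) :
    gridExp nt i - gridExp nt (i + 1) = nt i.rev := by
  have : N - i = (N - (i + 1)) + 1 := by omega
  rw [gridExp, gridExp, psum_eq_sum_range, psum_eq_sum_range, this, Finset.sum_range_succ]
  have h : N - (i + 1) < N := by omega
  simp only [add_sub_cancel_left, seqExt, h, dif_pos]
  rfl

lemma isGridSeq_gridExp_iff {N : ℕ} (m : Fin N → ℕ) (nt : Fin N → ℤ) :
    IsGridSeq (seqExt m) N (gridExp nt) ↔ ∀ i, 0 ≤ nt i ∧ nt i ≤ m i.rev := by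
  have hm : ∀ i : Fin N, seqExt m i = m i := fun i => by simp [seqExt]
  constructor
  · intro h i
    have := gridExp_sub nt i.rev
    rw [Fin.rev_rev] at this
    rw [← this, ← hm]
    exact ⟨h.nonneg _ i.rev.isLt, h.le _ i.rev.isLt⟩
  · intro h
    refine ⟨fun j hj => gridExp_of_le nt hj, fun j hj => ?_, fun j hj => ?_⟩
    · have := gridExp_sub nt ⟨j, hj⟩
      simp only at this
      rw [this]
      exact (h _).1
    · have := gridExp_sub nt ⟨j, hj⟩
      simp only at this
      rw [this]
      have := (h (Fin.rev ⟨j, hj⟩)).2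
      rw [Fin.rev_rev, ← hm] at this
      exact this

/-- The differences in `indexShift` telescope. For k = 0 the right side is the zero extension of e
at N, in accordance with e_{N+1} = 0. -/
lemma psum_indexShift {N : ℕ} (e : Fin N → ℤ) {k : ℕ} (hk : k ≤ N) :
    psum (indexShift e) k = seqExt e (N - k) := by
  rw [psum_eq_sum_range]
  induction k with
  | zero => simp [seqExt]
  | succ k ih =>
    rw [Finset.sum_range_succ, ih (by omega)]
    have hk' : k < N := by omega
    have h1 : N - (k + 1) < N := by omega
    have h2 : seqExt (indexShift e) k = seqExt e (N - (k + 1)) - seqExt e (N - k) := by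
      simp only [seqExt, hk', h1, dif_pos, indexShift]
      congr 1
      rcases Nat.eq_zero_or_pos k with rfl | hpos
      · simp
      · have h3 : N - k < N := by omega
        rw [dif_pos hpos, dif_pos h3]
        congr 1
        apply Fin.ext
        simp only [Fin.val_rev]
        omega
    rw [h2]
    abel

lemma gridExp_add_indexShift {N : ℕ} (nt : Fin N → ℤ) (e : Fin N → ℤ) :
    gridExp (nt + indexShift e) = fun j => gridExp nt j + seqExt e j := by
  funext j
  have hadd : gridExp (nt + indexShift e) j = gridExp nt j + gridExp (indexShift e) j := by
    simp only [gridExp, psum, Pi.add_apply, Finset.sum_add_distrib]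
  rw [hadd]
  congr 1
  rcases le_total N j with hj | hj
  · rw [gridExp_of_le _ hj]
    simp [seqExt, not_lt.mpr hj]
  · rw [gridExp, psum_indexShift e (by omega), Nat.sub_sub_self hj]

lemma seqExt_coe {N : ℕ} {ε : ℕ → SignType} (hε : ∀ j, N ≤ j → ε j = 0) :
    seqExt (fun i : Fin N => (ε i : ℤ)) = fun j => (ε j : ℤ) := by
  funext j
  by_cases h : j < N
  · simp [seqExt, h]
  · simp [seqExt, h, hε j (not_lt.mp h)]

lemma supportZ_eq {N : ℕ} (q : ℂ) (α : ℕ → ℂ) (nt : Fin N → ℤ) (i : Fin N) :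
    supportZ q α nt i = supportVar (q ^ 2) (α (N + 2)) (paramSeq N α) N (gridExp nt) i := by
  rw [supportZ, supportVar, paramSeq_of_le α le_rfl, paramSeq_of_le α i.isLt.le, gridExp, zpow_mul]
  norm_cast

namespace Admissible

variable {N : ℕ} {q : ℂ} {α : ℕ → ℂ} {m : Fin N → ℕ} (h : Admissible q α m)
include h

lemma isGenericBase : IsGenericBase (q ^ 2) where
  ne_zero := pow_ne_zero _ h.q_ne_zero
  pow_ne_one k hk := by
    rw [← pow_mul]
    exact h.not_root_of_unity _ (by omega)

/-- The value 1 of `paramSeq` beyond N is chosen so that this holds for all indices. -/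
lemma paramSeq_ne_zero (j : ℕ) : paramSeq N α j ≠ 0 := by
  unfold paramSeq
  split_ifs
  · exact h.ne_zero _ (by omega)
  · exact one_ne_zero

lemma isSupportData :
    IsSupportData (q ^ 2) (α 0 ^ 2)⁻¹ (α (N + 2)) (paramSeq N α) (seqExt m) N where
  base := h.isGenericBase
  A_ne_zero := h.paramSeq_ne_zero
  w_ne_zero := h.ne_zero _ le_rfl
  ratio j hj := by
    rw [paramSeq_of_le α hj.le, paramSeq_of_le α (show j + 1 ≤ N from hj)]
    have := h.ratio ⟨j, hj⟩
    simp only at this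
    rw [this, seqExt, dif_pos hj, ← zpow_natCast, ← zpow_mul, ← zpow_natCast, ← zpow_mul]
    congr 1
    push_cast
    ring
  ab := by
    rw [paramSeq_of_le α (Nat.zero_le N)]
    have := h.generic_ab
    rwa [div_eq_inv_mul] at this
  ac := by rw [paramSeq_of_le α le_rfl]; exact h.generic_ac
  ad := by rw [paramSeq_of_le α le_rfl]; exact h.generic_ad
  bc := by
    rw [paramSeq_of_le α le_rfl]
    have := h.generic_bc
    rwa [div_eq_inv_mul] at this
  bd := by
    rw [paramSeq_of_le α le_rfl]
    have := h.generic_bd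
    rwa [← div_div, div_eq_inv_mul (_ / _)] at this
  sq := h.generic_z

lemma supportVar_last (nt : Fin N → ℤ) :
    supportVar (q ^ 2) (α (N + 2)) (paramSeq N α) N (gridExp nt) N = α (N + 2) := by
  have := h.paramSeq_ne_zero N
  rw [supportVar, gridExp_of_le _ le_rfl, zpow_zero, mul_one]
  field_simp

lemma grPoly_supportZ (n : Fin N → ℕ) (nt : Fin N → ℤ) :
    grPoly q α n (supportZ q α nt) =
      grProduct (q ^ 2) (α 0 ^ 2)⁻¹ N (paramSeq N α)
        (supportVar (q ^ 2) (α (N + 2)) (paramSeq N α) N (gridExp nt)) (seqExt n) := by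
  rw [grProduct_eq_prod _ _ _ _ _ _ (pow_ne_zero _ h.q_ne_zero), grPoly, Finset.prod_range]
  refine Finset.prod_congr rfl fun i _ => ?_
  have hnext : zNext α (supportZ q α nt) i =
      supportVar (q ^ 2) (α (N + 2)) (paramSeq N α) N (gridExp nt) (i + 1) := by
    unfold zNext
    split_ifs with hi
    · exact supportZ_eq q α nt ⟨i + 1, hi⟩
    · have : i.val + 1 = N := by omega
      rw [this, h.supportVar_last]
  rw [hnext, supportZ_eq, psum_eq_sum_range, paramSeq_of_le α i.isLt.le,
    paramSeq_of_le α (show i.val + 1 ≤ N from i.isLt), pow_mul, div_eq_inv_mul _ (α 0 ^ 2)]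
  simp [seqExt]

lemma grPolyNormalized_supportZ (n : Fin N → ℕ) : ∃ C : ℂ, ∀ nt : Fin N → ℤ,
    grPolyNormalized q α n (supportZ q α nt) = C *
      grProduct (q ^ 2) (α 0 ^ 2)⁻¹ N (paramSeq N α)
        (supportVar (q ^ 2) (α (N + 2)) (paramSeq N α) N (gridExp nt)) (seqExt n) :=
  ⟨_, fun nt => by rw [← h.grPoly_supportZ]; rfl⟩

/-- The recurrence in the dual indices. -/
theorem DStarNt_grPolyNormalized (n : Fin N → ℕ) (nt : Fin N → ℤ)
    (hnt : ∀ i, 0 ≤ nt i ∧ nt i ≤ m i.rev) (f : (Fin N → ℤ) → ℂ)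
    (hf : ∀ y : Fin N → ℤ, (∀ i, 0 ≤ y i ∧ y i ≤ m i.rev) →
      f y = grPolyNormalized q α n (supportZ q α y)) :
    1 / 2 * DStarNt q α f nt =
      thetaStar N q α (psum n N : ℕ) * grPolyNormalized q α n (supportZ q α nt) := by
  have hd := h.isSupportData
  obtain ⟨C, hC⟩ := h.grPolyNormalized_supportZ n
  have hgrid := (isGridSeq_gridExp_iff m nt).mpr hnt
  have key := hd.chainOperator_support hgrid le_rfl (seqExt n)
    (fun ε => f (nt + indexShift fun i => (ε i : ℤ))) C ?_
  · rw [DStarNt, operatorAt_eq_chainOperator hd.base α h.ne_zero _ _ (paramSeq N α)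
      (supportVar (q ^ 2) (α (N + 2)) (paramSeq N α) N (gridExp nt)) h.paramSeq_ne_zero
      (fun j hj => paramSeq_of_le α hj) (fun i => (supportZ_eq q α nt i).symm) (h.supportVar_last nt)
      (hd.supportVar_ne_zero _) (fun j hj => hd.notPow_supportVar_sq _ hj.le), key, hC]
    have hf0 : f (nt + indexShift 0) = C * grProduct (q ^ 2) (α 0 ^ 2)⁻¹ N (paramSeq N α)
        (supportVar (q ^ 2) (α (N + 2)) (paramSeq N α) N (gridExp nt)) (seqExt n) := by
      have : indexShift (0 : Fin N → ℤ) = 0 := by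
        funext i
        simp [indexShift]
      rw [this, add_zero, hf nt hnt, hC]
    have h0 := h.ne_zero 0 (by omega)
    have h1 := h.ne_zero (N + 1) (by omega)
    have h2 := h.ne_zero (N + 2) le_rfl
    have hA := h.ne_zero 1 (by omega)
    have hq := h.q_ne_zero
    have hp1 := hd.base.one_add_ne_zero
    have hq2 : (q ^ 2) ^ psum n N = q ^ (2 * ((psum n N : ℕ) : ℤ)) := by
      rw [zpow_mul, zpow_natCast]; norm_cast
    have hP : (q ^ 2) ^ psum n N ≠ 0 := pow_ne_zero _ (pow_ne_zero _ hq)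
    rw [hf0, ← psum_eq_sum_range, thetaStar, neg_mul, zpow_neg, ← hq2, h.supportVar_last,
      paramSeq_of_le α le_rfl, paramSeq_of_le α (Nat.zero_le N)]
    -- The middle term of the pairing is free of P once multiplied by P⁻¹, and it cancels the
    -- additive constant of `operatorAt_eq_chainOperator`.
    generalize (q ^ 2) ^ psum n N = P at *
    generalize C * grProduct _ _ _ _ _ _ = G
    rw [show (0 : SignType) = SignType.zero from rfl]
    simp only [pairing, scale, sitePair, smul_eq_mul, zero_add]
    field_simp
    ring
  · intro ε hε
    have hε0 : ∀ j, N ≤ j → ε j = 0 := by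
      intro j hj
      have := hε.zero j hj
      rw [gridExp_of_le nt hj, zero_add] at this
      revert this
      cases ε j <;> decide
    have hexp : gridExp (nt + indexShift fun i => (ε i : ℤ)) = fun j => gridExp nt j + ε j := by
      rw [gridExp_add_indexShift, seqExt_coe hε0]
    rw [← hexp] at hε ⊢
    rw [hf _ ((isGridSeq_gridExp_iff m _).mp hε), hC]

end Admissible

/-! ### Change of base in the Askey-Wilson polynomials on a finite grid -/

lemma qPoch_inv_pow_eq_zero {p : ℂ} (hp : p ≠ 0) {n k : ℕ} (h : n < k) :
    qPoch (p ^ n)⁻¹ p k = 0 :=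
  Finset.prod_eq_zero (Finset.mem_range.mpr h)
    (by rw [inv_mul_cancel₀ (pow_ne_zero _ hp), sub_self])

/-- The summand of the balanced terminating series `₃φ₂`. -/
def saalschutzTerm (p B D x Y : ℂ) (n k : ℕ) : ℂ :=
  qPoch (p ^ n)⁻¹ p k * qPoch (Y * (p ^ n / p)) p k * qPoch x p k /
    (qPoch B p k * qPoch D p k * qPoch p p k) * p ^ k

/-- A recursion in n by creative telescoping: this combination of the summands for n + 1 and n is a
difference in k, and the right side is its partial sum. It vanishes at K = n + 1 through the factor
(p⁻ⁿ; p)_K. -/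
lemma saalschutzTerm_telescope {p : ℂ} (hp : IsGenericBase p) {B D x Y : ℂ} (hx : x ≠ 0)
    (hY : x * Y = B * D)
    (hB : ∀ k : ℕ, 1 - B * p ^ k ≠ 0) (hD : ∀ k : ℕ, 1 - D * p ^ k ≠ 0) (n K : ℕ) :
    ∑ k ∈ range (K + 1), ((1 - B * p ^ n) * (1 - D * p ^ n) * saalschutzTerm p B D x Y (n + 1) k -
        (x - B * p ^ n - D * p ^ n + Y * p ^ n * p ^ n) * saalschutzTerm p B D x Y n k) =
      (1 - Y * p ^ n * p ^ n) * (qPoch (p ^ n)⁻¹ p K * qPoch (Y * p ^ n) p K * qPoch x p (K + 1) /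
        (qPoch B p K * qPoch D p K * qPoch p p K)) := by
  have hp0 := hp.ne_zero
  induction K with
  | zero =>
    simp only [zero_add, Finset.sum_range_one, saalschutzTerm, qPoch_zero, qPoch_succ, pow_zero]
    linear_combination (-(p ^ n * p ^ n)) * hY
  | succ K ih =>
    have e1 : qPoch (p ^ (n + 1))⁻¹ p (K + 1) = (1 - (p ^ n * p)⁻¹) * qPoch (p ^ n)⁻¹ p K := by
      rw [qPoch_succ', pow_succ, mul_inv, inv_mul_cancel_right₀ hp0]
    have e2 : qPoch (Y * (p ^ n / p)) p (K + 1) =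
        (1 - Y * p ^ n / p) * qPoch (Y * p ^ n) p K := by
      rw [qPoch_succ', mul_assoc, div_mul_cancel₀ _ hp0, mul_div_assoc]
    have e3 : Y * (p ^ (n + 1) / p) = Y * p ^ n := by rw [pow_succ, mul_div_cancel_right₀ _ hp0]
    have b := hB K
    have d := hD K
    have b' : qPoch B p K ≠ 0 := qPoch_ne_zero fun k _ => hB k
    have d' : qPoch D p K ≠ 0 := qPoch_ne_zero fun k _ => hD k
    have g : 1 - p * p ^ K ≠ 0 := by
      rw [← pow_succ']
      exact sub_ne_zero.mpr (hp.pow_ne_one _ (Nat.succ_pos K)).symm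
    have g' := qPoch_self_ne_zero hp K
    have hP : p ^ n ≠ 0 := pow_ne_zero _ hp0
    rw [Finset.sum_range_succ, ih]
    simp only [saalschutzTerm, e1, e2, e3]
    rw [qPoch_succ x p (K + 1), qPoch_succ (p ^ n)⁻¹, qPoch_succ (Y * p ^ n), qPoch_succ B,
      qPoch_succ D, qPoch_succ p, pow_succ p K]
    generalize qPoch (p ^ n)⁻¹ p K = u1
    generalize qPoch (Y * p ^ n) p K = u2
    generalize qPoch x p (K + 1) = u3
    generalize qPoch B p K = u4 at *
    generalize qPoch D p K = u5 at *
    generalize qPoch p p K = u6 at *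
    generalize p ^ n = P at *
    generalize p ^ K = X at *
    have key : ((1 - B * P) * (1 - D * P) * ((1 - (P * p)⁻¹) * (1 - Y * P * X)) -
        (x - B * P - D * P + Y * P * P) * ((1 - P⁻¹ * X) * (1 - Y * P / p))) * (X * p) =
        (1 - Y * P * P) * ((1 - P⁻¹ * X) * (1 - Y * P * X) * (1 - x * (X * p)) -
          (1 - B * X) * (1 - D * X) * (1 - p * X)) := by
      have hY' : Y = B * D / x := by rw [← hY]; field_simp
      rw [hY']
      field_simp
      ring
    generalize 1 - B * X = x1 at *
    generalize 1 - D * X = x2 at *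
    generalize 1 - p * X = x3 at *
    have hh : u1 * u2 * u3 / (u4 * u5 * u6) =
        u1 * u2 * u3 * (x1 * x2 * x3) / (u4 * x1 * (u5 * x2) * (u6 * x3)) := by field_simp
    rw [hh]
    linear_combination (u1 * u2 * u3 / (u4 * x1 * (u5 * x2) * (u6 * x3))) * key

/-- The `q`-Pfaff-Saalschütz sum. -/
lemma sum_saalschutzTerm {p : ℂ} (hp : IsGenericBase p) {B D x Y : ℂ} (hx : x ≠ 0)
    (hY : x * Y = B * D) (hB : ∀ k : ℕ, 1 - B * p ^ k ≠ 0) (hD : ∀ k : ℕ, 1 - D * p ^ k ≠ 0)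
    (n : ℕ) :
    qPoch B p n * qPoch D p n * ∑ k ∈ range (n + 1), saalschutzTerm p B D x Y n k =
      x ^ n * qPoch (B / x) p n * qPoch (D / x) p n := by
  have hp0 := hp.ne_zero
  induction n with
  | zero => simp [saalschutzTerm, qPoch_zero]
  | succ n ih =>
    have ht := saalschutzTerm_telescope hp hx hY hB hD n (n + 1)
    rw [qPoch_inv_pow_eq_zero hp0 (Nat.lt_succ_self n), Finset.sum_sub_distrib, ← Finset.mul_sum,
      ← Finset.mul_sum, Finset.sum_range_succ (saalschutzTerm p B D x Y n)] at ht
    have h0 : saalschutzTerm p B D x Y n (n + 1) = 0 := by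
      simp [saalschutzTerm, qPoch_inv_pow_eq_zero hp0 (Nat.lt_succ_self n)]
    have hY' : Y = B * D / x := by rw [← hY]; field_simp
    have hfac : x - B * p ^ n - D * p ^ n + Y * p ^ n * p ^ n =
        x * (1 - B / x * p ^ n) * (1 - D / x * p ^ n) := by
      rw [hY']; field_simp; ring
    rw [h0, add_zero, hfac] at ht
    simp only [qPoch_succ]
    linear_combination (qPoch B p n * qPoch D p n) * ht +
      x * (1 - B / x * p ^ n) * (1 - D / x * p ^ n) * ih

/-- At z = c the factors (ac; p)_k cancel, and the ₄φ₃ becomes the balanced ₃φ₂ summed by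
Saalschütz. -/
lemma askeyWilson_eval {p : ℂ} (hp : IsGenericBase p) {a b c d : ℂ} (ha : a ≠ 0) (hc : c ≠ 0)
    (hab : ∀ k : ℕ, 1 - a * b * p ^ k ≠ 0) (hac : ∀ k : ℕ, 1 - a * c * p ^ k ≠ 0)
    (had : ∀ k : ℕ, 1 - a * d * p ^ k ≠ 0) (n : ℕ) :
    askeyWilson p n a b c d c =
      qPoch (c * b) p n * qPoch (c * a) p n * qPoch (c * d) p n / c ^ n := by
  have hp0 := hp.ne_zero
  have key := sum_saalschutzTerm hp (B := a * b) (D := a * d) (x := a / c) (Y := a * b * c * d)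
    (div_ne_zero ha hc) (by field_simp) hab had n
  have hterm : ∀ k, awCoeff p n a b c d k * awBasis p a c k =
      saalschutzTerm p (a * b) (a * d) (a / c) (a * b * c * d) n k := by
    intro k
    have h1 : qPoch (a * c) p k ≠ 0 := qPoch_ne_zero fun k _ => hac k
    simp only [awCoeff, awBasis, saalschutzTerm, zpow_neg, zpow_natCast, zpow_sub₀ hp0, zpow_one,
      ← div_eq_mul_inv a c]
    generalize qPoch (a * c) p k = u at *
    have : ∀ s t v w y r P : ℂ, s * t / (v * u * w * y) * P * (u * r) =
        s * t * r / (v * w * y) * P := by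
      intro s t v w y r P
      rw [show v * u * w * y = u * (v * w * y) by ring, div_mul_eq_mul_div, div_mul_eq_mul_div,
        div_mul_eq_mul_div, show s * t * P * (u * r) = u * (s * t * r * P) by ring,
        mul_div_mul_left _ _ h1]
    rw [this]
  rw [askeyWilson_eq, Finset.sum_congr rfl fun k _ => hterm k]
  have e1 : a * b / (a / c) = c * b := by field_simp
  have e2 : a * d / (a / c) = c * d := by field_simp
  rw [e1, e2, div_pow] at key
  have hA := pow_ne_zero n ha
  have hC := pow_ne_zero n hc
  rw [mul_comm c a]
  field_simp at key ⊢
  linear_combination qPoch (a * c) p n * key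

/-- The Askey-Wilson difference equation, symmetric in the four parameters. -/
lemma askeyWilson_difference {p z : ℂ} (hp : IsGenericBase p) (hz : z ≠ 0)
    (h : NotPow p (z ^ 2)) {a b c d : ℂ} {n : ℕ} (hab : ∀ k < n, 1 - a * b * p ^ k ≠ 0)
    (hac : ∀ k < n, 1 - a * c * p ^ k ≠ 0) (had : ∀ k < n, 1 - a * d * p ^ k ≠ 0) :
    (1 - a * z) * (1 - b * z) * (1 - c * z) * (1 - d * z) * siteWeight p z .pos *
        (askeyWilson p n a b c d (z * p) - askeyWilson p n a b c d z) +
      (1 - a * z⁻¹) * (1 - b * z⁻¹) * (1 - c * z⁻¹) * (1 - d * z⁻¹) * siteWeight p z .neg *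
        (askeyWilson p n a b c d (z * p⁻¹) - askeyWilson p n a b c d z) =
      ((p ^ n)⁻¹ - 1 + a * b * c * d * (p ^ n - 1) / p) * askeyWilson p n a b c d z := by
  have h1 := awOperator_askeyWilson hp hz h hab hac had
  have h0 := awOperator_awBasis_zero hp hz h a b c d
  have e1 : ((SignType.pos : SignType) : ℤ) = 1 := rfl
  have e2 : ((SignType.neg : SignType) : ℤ) = -1 := rfl
  have e3 : ((SignType.zero : SignType) : ℤ) = 0 := rfl
  rw [awOperator, sum_signType] at h0 h1
  simp only [e1, e2, e3, zpow_one, zpow_neg_one, zpow_zero, mul_one, pairing_sitePair_pos hp,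
    pairing_sitePair_neg hp, pairing_comm p (sitePair p z .pos), awBasis, qPoch_zero,
    pairing_comm p (sitePair p z .neg), awDiag, pow_zero] at h0 h1
  linear_combination h1 - askeyWilson p n a b c d z * h0

/-- On a finite grid, the first and the third parameters can be interchanged. -/
theorem askeyWilson_swap_grid {p a b c d : ℂ} (hp : IsGenericBase p) {m n : ℕ} (hn : n ≤ m)
    (ha : a ≠ 0) (hc : c ≠ 0) (hab : NotPow p (a * b)) (hac : NotPow p (a * c))
    (had : NotPow p (a * d)) (hbc : NotPow p (c * b)) (hcc : NotPow p (c ^ 2))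
    (hcd : c * d = p ^ (-(m : ℤ))) {i : ℕ} (hi : i ≤ m) :
    askeyWilson p n a b c d (c * p ^ i) = askeyWilson p n c b a d (c * p ^ i) := by
  have hp0 := hp.ne_zero
  have hcd' : ∀ k < m, 1 - c * d * p ^ k ≠ 0 := by
    intro k hk
    rw [hcd, ← zpow_natCast, ← zpow_add₀ hp0]
    exact hp.one_sub_zpow_ne_zero (by omega)
  have hca : NotPow p (c * a) := by rwa [mul_comm]
  -- At the first grid point the series with base c reduces to 1, because it contains (1; p)_k; the
  -- other one is the Saalschütz sum.
  have h0 : askeyWilson p n a b c d c = askeyWilson p n c b a d c := by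
    rw [askeyWilson_eval hp ha hc (hab.one_sub_mul_pow_ne_zero hp0)
      (hac.one_sub_mul_pow_ne_zero hp0) (had.one_sub_mul_pow_ne_zero hp0), askeyWilson_eq,
      Finset.sum_range_succ', Finset.sum_eq_zero]
    · simp [awCoeff, awBasis, qPoch_zero]
    · intro k _
      have : qPoch 1 p (k + 1) = 0 := by rw [qPoch_succ']; simp
      simp [awBasis, mul_inv_cancel₀ hc, this]
  have hz : ∀ j : ℕ, c * p ^ j ≠ 0 := fun j => mul_ne_zero hc (pow_ne_zero _ hp0)
  have hz2 : ∀ j : ℕ, NotPow p ((c * p ^ j) ^ 2) := by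
    intro j
    have := hcc.mul_zpow hp0 (j + j)
    rwa [zpow_add₀ hp0, zpow_natCast, ← sq, ← mul_pow] at this
  have eq1 := fun j : ℕ => askeyWilson_difference hp (hz j) (hz2 j) (n := n)
    (fun k _ => hab.one_sub_mul_pow_ne_zero hp0 k) (fun k _ => hac.one_sub_mul_pow_ne_zero hp0 k)
    (fun k _ => had.one_sub_mul_pow_ne_zero hp0 k)
  have eq2 := fun j : ℕ => askeyWilson_difference hp (hz j) (hz2 j) (n := n)
    (fun k _ => hbc.one_sub_mul_pow_ne_zero hp0 k) (fun k _ => hca.one_sub_mul_pow_ne_zero hp0 k)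
    (fun k hk => hcd' k (by omega))
  -- Both sides satisfy the same difference equation, symmetric in a, b, c, d, whose forward
  -- coefficient is nonzero for j < m. The backward coefficient contains 1 - c z⁻¹, which is 0 at j
  -- = 0; the second hypothesis keeps this factor so that it holds at the start as well.
  have step : ∀ j < m, askeyWilson p n a b c d (c * p ^ j) = askeyWilson p n c b a d (c * p ^ j) →
      (1 - c * (c * p ^ j)⁻¹) * askeyWilson p n a b c d (c * p ^ j * p⁻¹) =
        (1 - c * (c * p ^ j)⁻¹) * askeyWilson p n c b a d (c * p ^ j * p⁻¹) →
      askeyWilson p n a b c d (c * p ^ (j + 1)) = askeyWilson p n c b a d (c * p ^ (j + 1)) := by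
    intro j hj hj0 hj1
    have c1 : (1 - a * (c * p ^ j)) * (1 - b * (c * p ^ j)) * (1 - c * (c * p ^ j)) *
        (1 - d * (c * p ^ j)) * siteWeight p (c * p ^ j) .pos ≠ 0 := by
      obtain ⟨g1, g2, -⟩ := (hz2 j).ne_zero_factors hp0
      have f1 := hac.one_sub_mul_pow_ne_zero hp0 j
      have f2 := hbc.one_sub_mul_pow_ne_zero hp0 j
      have f3 := hcc.one_sub_mul_pow_ne_zero hp0 j
      have f4 := hcd' j hj
      rw [mul_assoc] at f1
      rw [mul_comm c b, mul_assoc] at f2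
      rw [sq, mul_assoc] at f3
      rw [mul_comm c d, mul_assoc] at f4
      exact mul_ne_zero (mul_ne_zero (mul_ne_zero (mul_ne_zero f1 f2) f3) f4)
        (one_div_ne_zero (mul_ne_zero g1 g2))
    rw [pow_succ, ← mul_assoc]
    apply mul_left_cancel₀ c1
    linear_combination eq1 j - eq2 j -
      (1 - a * (c * p ^ j)⁻¹) * (1 - b * (c * p ^ j)⁻¹) * (1 - d * (c * p ^ j)⁻¹) *
        siteWeight p (c * p ^ j) .neg * hj1 +
      ((1 - a * (c * p ^ j)) * (1 - b * (c * p ^ j)) * (1 - c * (c * p ^ j)) *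
        (1 - d * (c * p ^ j)) * siteWeight p (c * p ^ j) .pos +
      (1 - a * (c * p ^ j)⁻¹) * (1 - b * (c * p ^ j)⁻¹) * (1 - c * (c * p ^ j)⁻¹) *
        (1 - d * (c * p ^ j)⁻¹) * siteWeight p (c * p ^ j) .neg +
      ((p ^ n)⁻¹ - 1 + a * b * c * d * (p ^ n - 1) / p)) * hj0
  have main : ∀ j ≤ m, askeyWilson p n a b c d (c * p ^ j) = askeyWilson p n c b a d (c * p ^ j) ∧
      (1 - c * (c * p ^ j)⁻¹) * askeyWilson p n a b c d (c * p ^ j * p⁻¹) =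
        (1 - c * (c * p ^ j)⁻¹) * askeyWilson p n c b a d (c * p ^ j * p⁻¹) := by
    intro j
    induction j with
    | zero =>
      intro _
      simp [h0, mul_inv_cancel₀ hc]
    | succ j ih =>
      intro hj
      obtain ⟨i1, i2⟩ := ih (by omega)
      refine ⟨step j (by omega) i1 i2, ?_⟩
      rw [show c * p ^ (j + 1) * p⁻¹ = c * p ^ j by rw [pow_succ]; field_simp, i1]
  exact (main i hi).1

/-! ### The duality of the discretized polynomials -/

lemma qPoch_add (a p : ℂ) (i j : ℕ) :
    qPoch a p (i + j) = qPoch a p i * qPoch (a * p ^ i) p j := by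
  simp only [qPoch, Finset.prod_range_add, pow_add, mul_assoc]

/-- The terminating balanced series in the value of an Askey-Wilson polynomial on the grid. -/
def gridSeries (p : ℂ) (n d : ℕ) (u v C C' G : ℂ) : ℂ :=
  ∑ k ∈ range (n + 1), qPoch (p ^ n)⁻¹ p k * qPoch u p k * (qPoch (p ^ d)⁻¹ p k * qPoch v p k) /
    (qPoch C p k * qPoch C' p k * qPoch G p k * qPoch p p k) * p ^ k

/-- Either of (p⁻ⁿ; p)_k and (p⁻ᵈ; p)_k terminates the series, so both sums may be extended to k ≤ n
+ d, where their summands agree. -/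
lemma gridSeries_comm {p : ℂ} (hp : p ≠ 0) (n d : ℕ) (u v C C' G : ℂ) :
    gridSeries p n d u v C C' G = gridSeries p d n v u C C' G := by
  have ext : ∀ (n d : ℕ) (u v : ℂ), gridSeries p n d u v C C' G =
      ∑ k ∈ range (n + d + 1), qPoch (p ^ n)⁻¹ p k * qPoch u p k *
        (qPoch (p ^ d)⁻¹ p k * qPoch v p k) /
        (qPoch C p k * qPoch C' p k * qPoch G p k * qPoch p p k) * p ^ k := by
    intro n d u v
    refine Finset.sum_subset (by intro k; simp only [Finset.mem_range]; omega) fun k _ hk => ?_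
    rw [qPoch_inv_pow_eq_zero hp (by simpa using hk)]
    simp
  rw [ext, ext, add_comm d n]
  exact Finset.sum_congr rfl fun k _ => by ring

lemma gridSeries_zero_right (p : ℂ) (n : ℕ) (u v C C' G : ℂ) :
    gridSeries p n 0 u v C C' G = 1 := by
  rw [gridSeries, Finset.sum_range_succ', Finset.sum_eq_zero]
  · simp [qPoch_zero]
  · intro k _
    have : qPoch 1 p (k + 1) = 0 := by rw [qPoch_succ']; simp
    simp [this]

/-- With c as base parameter, cz and c/z at z = c pⁱ are c² pⁱ and p⁻ⁱ. The position i then enters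
through p⁻ⁱ just as the degree does through p⁻ⁿ. -/
lemma askeyWilson_grid {p a b c d : ℂ} (hp : IsGenericBase p) {m n : ℕ} (hn : n ≤ m)
    (ha : a ≠ 0) (hc : c ≠ 0) (hab : NotPow p (a * b)) (hac : NotPow p (c * a))
    (had : NotPow p (a * d)) (hbc : NotPow p (c * b)) (hcc : NotPow p (c ^ 2))
    (hcd : c * d = p ^ (-(m : ℤ))) {i : ℕ} (hi : i ≤ m) :
    askeyWilson p n a b c d (c * p ^ i) =
      qPoch (c * a) p n * qPoch (c * b) p n * qPoch (c * d) p n / c ^ n *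
        gridSeries p n i (a * b * (c * d) * p ^ n / p) (c ^ 2 * p ^ i) (c * a) (c * b) (c * d) := by
  have hp0 := hp.ne_zero
  rw [askeyWilson_swap_grid hp hn ha hc hab (by rwa [mul_comm]) had hbc hcc hcd hi, askeyWilson_eq]
  congr 1
  · ring
  · refine Finset.sum_congr rfl fun k _ => ?_
    have e1 : c * (c * p ^ i) = c ^ 2 * p ^ i := by ring
    have e2 : c * (c * p ^ i)⁻¹ = (p ^ i)⁻¹ := by
      have := pow_ne_zero i hp0
      field_simp
    have e3 : c * b * a * d * p ^ ((n : ℤ) - 1) = a * b * (c * d) * p ^ n / p := by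
      rw [zpow_sub₀ hp0, zpow_natCast, zpow_one]; ring
    rw [awCoeff, awBasis, e1, e2, e3, zpow_neg, zpow_natCast]
    ring

/-- The values of the Gasper-Rahman polynomials on the discrete support. -/
lemma IsSupportData.grProduct_support {p τ w : ℂ} {A : ℕ → ℂ} {m : ℕ → ℕ} {N : ℕ}
    (h : IsSupportData p τ w A m N) {M Y n d : ℕ → ℕ} (hM : ∀ i, M i = ∑ j ∈ range i, n j)
    (hY : ∀ i < N, Y i = Y (i + 1) + d i) (hn : ∀ i < N, n i ≤ m i) (hd : ∀ i < N, d i ≤ m i) :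
    grProduct p τ N A (supportVar p w A N fun j => Y j) n =
      ∏ i ∈ range N, (A i ^ n i * qPoch (p ^ (-(m i : ℤ))) p (n i) *
        (qPoch (A N * w * p ^ (M i + Y (i + 1))) p (n i) *
          qPoch (τ * (A N * w) * p ^ (M i + Y (i + 1))) p (n i)) /
        ((A N * w) ^ n i * p ^ (n i * Y (i + 1))) *
        gridSeries p (n i) (d i) (τ * A (i + 1) ^ 2 / p * p ^ (M i + M (i + 1)))
          ((A N * w) ^ 2 / A i ^ 2 * p ^ (Y i + Y (i + 1))) (A N * w * p ^ (M i + Y (i + 1)))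
          (τ * (A N * w) * p ^ (M i + Y (i + 1))) (p ^ (-(m i : ℤ)))) := by
  have hp0 := h.base.ne_zero
  rw [grProduct_eq_prod _ _ _ _ _ _ hp0]
  refine Finset.prod_congr rfl fun i hi => ?_
  have hi := Finset.mem_range.mp hi
  rw [← hM]
  have hA := h.A_ne_zero i
  have hA1 := h.A_ne_zero (i + 1)
  have hAN := h.A_ne_zero N
  have hw := h.w_ne_zero
  have hPM := pow_ne_zero (M i) hp0
  have hPY := pow_ne_zero (Y (i + 1)) hp0
  have hz := h.supportVar_ne_zero (fun j => Y j)
  have hg := h.isGenericPoint (fun j => Y j)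
  set Z := supportVar p w A N (fun j => (Y j : ℤ)) with hZ
  have z1 : A (i + 1) * Z (i + 1) = A N * w * p ^ Y (i + 1) := by
    rw [hZ, h.mul_supportVar, zpow_natCast]
  -- The support places z_i on the grid c p^d that starts at the third parameter c of its own
  -- polynomial.
  have z0 : Z i = A (i + 1) / A i * Z (i + 1) * p ^ d i := by
    have := h.supportVar_div (fun j => (Y j : ℤ)) i
    rw [← hZ, hY i hi] at this
    push_cast at this
    rw [add_sub_cancel_left, zpow_natCast, div_eq_iff (hz _)] at this
    rw [this]; ring
  have sq : ∀ x : ℂ, NotPow p x → ∀ k : ℕ, NotPow p (x * p ^ k) := fun x hx k => by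
    have := hx.mul_zpow hp0 k
    rwa [zpow_natCast] at this
  have ecd : A (i + 1) / A i * Z (i + 1) * (A (i + 1) / A i * (Z (i + 1))⁻¹) =
      p ^ (-(m i : ℤ)) := by
    rw [← h.ratio i hi]
    have := hz (i + 1)
    field_simp
  have eca : A (i + 1) / A i * Z (i + 1) * (A i * p ^ M i) = A N * w * p ^ (M i + Y (i + 1)) := by
    rw [pow_add]
    field_simp
    linear_combination z1
  have ecb : A (i + 1) / A i * Z (i + 1) * (τ * A i * p ^ M i) =
      τ * (A N * w) * p ^ (M i + Y (i + 1)) := by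
    rw [pow_add]
    field_simp
    linear_combination τ * z1
  have key := askeyWilson_grid h.base (hn i hi) (a := A i * p ^ M i) (b := τ * A i * p ^ M i)
    (c := A (i + 1) / A i * Z (i + 1)) (d := A (i + 1) / A i * (Z (i + 1))⁻¹)
    (mul_ne_zero hA hPM) (mul_ne_zero (div_ne_zero hA1 hA) (hz _)) ?_ ?_ ?_ ?_ ?_ ecd (hd i hi)
  · have ec : A (i + 1) / A i * Z (i + 1) = A N * w * p ^ Y (i + 1) / A i := by
      field_simp
      linear_combination z1
    have eu : A i * p ^ M i * (τ * A i * p ^ M i) * p ^ (-(m i : ℤ)) * p ^ n i / p =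
        τ * A (i + 1) ^ 2 / p * p ^ (M i + M (i + 1)) := by
      have hM1 : M (i + 1) = M i + n i := by rw [hM, hM, Finset.sum_range_succ]
      rw [← h.ratio i hi, hM1]
      field_simp
      ring
    have ev : (A (i + 1) / A i * Z (i + 1)) ^ 2 * p ^ d i =
        (A N * w) ^ 2 / A i ^ 2 * p ^ (Y i + Y (i + 1)) := by
      rw [ec, hY i hi]
      field_simp
      ring
    rw [z0, key, ecd, eca, ecb, eu, ev, ec, div_pow, mul_pow (A N * w), ← pow_mul,
      mul_comm (Y (i + 1))]
    congr 1
    have hB := pow_ne_zero (n i) (mul_ne_zero hAN hw)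
    have hP := pow_ne_zero (n i * Y (i + 1)) hp0
    have hAi := pow_ne_zero (n i) hA
    field_simp
  · convert sq _ (hg.ab i hi) (M i + M i) using 1
    ring
  · rw [eca]
    exact sq _ h.ac _
  · convert sq _ (hg.ad i hi) (M i) using 1
    field_simp
  · rw [ecb]
    exact sq _ h.bc _
  · have := (hg.sq i hi).mul_zpow hp0 (-(d i + d i))
    convert this using 1
    rw [z0, zpow_neg, ← Nat.cast_add, zpow_natCast]
    have := pow_ne_zero (d i) hp0
    field_simp
    ring

/-- The factors at a lattice point of the closed form of the discretized polynomials. -/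
def latticeFactor (p τ B : ℂ) (i j : ℕ) : ℂ :=
  qPoch B p (i + j) * qPoch (τ * B) p (i + j) / p ^ (i * j)

lemma latticeFactor_comm (p τ B : ℂ) (i j : ℕ) :
    latticeFactor p τ B i j = latticeFactor p τ B j i := by
  rw [latticeFactor, latticeFactor, add_comm, mul_comm i]

lemma latticeFactor_ne_zero {p τ B : ℂ} (hp : p ≠ 0) (hB : NotPow p B) (hB' : NotPow p (τ * B))
    (i j : ℕ) : latticeFactor p τ B i j ≠ 0 :=
  div_ne_zero (mul_ne_zero (qPoch_ne_zero fun k _ => hB.one_sub_mul_pow_ne_zero hp k)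
    (qPoch_ne_zero fun k _ => hB'.one_sub_mul_pow_ne_zero hp k)) (pow_ne_zero _ hp)

lemma latticeFactor_div {p τ B : ℂ} (hp : p ≠ 0) (hB : NotPow p B) (hB' : NotPow p (τ * B))
    (i n j : ℕ) : latticeFactor p τ B (i + n) j / latticeFactor p τ B i j =
      qPoch (B * p ^ (i + j)) p n * qPoch (τ * B * p ^ (i + j)) p n / p ^ (n * j) := by
  have h1 : qPoch B p (i + j) ≠ 0 := qPoch_ne_zero fun k _ => hB.one_sub_mul_pow_ne_zero hp k
  have h2 : qPoch (τ * B) p (i + j) ≠ 0 :=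
    qPoch_ne_zero fun k _ => hB'.one_sub_mul_pow_ne_zero hp k
  have h3 := pow_ne_zero (i * j) hp
  have h4 := pow_ne_zero (n * j) hp
  rw [latticeFactor, latticeFactor, add_right_comm, qPoch_add B p (i + j),
    qPoch_add (τ * B) p (i + j), add_mul, pow_add]
  generalize qPoch B p (i + j) = x at *
  generalize qPoch (τ * B) p (i + j) = y at *
  generalize qPoch (B * p ^ (i + j)) p n = x'
  generalize qPoch (τ * B * p ^ (i + j)) p n = y'
  field_simp
  ring

lemma pow_sum_eq_prod (x : ℂ) (n : ℕ → ℕ) (N : ℕ) :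
    x ^ ∑ i ∈ range N, n i = ∏ i ∈ range N, x ^ n i := (Finset.prod_pow_eq_pow_sum _ _ _).symm

lemma gridExp_natCast {N : ℕ} (nt : Fin N → ℕ) (j : ℕ) :
    gridExp (fun i => (nt i : ℤ)) j = ((∑ i ∈ range (N - j), seqExt nt i : ℕ) : ℤ) := by
  rw [← psum_eq_sum_range, gridExp, psum, psum]
  push_cast
  rfl

lemma sum_range_seqExt_sub {N : ℕ} (nt : Fin N → ℕ) {i : ℕ} (hi : i < N) :
    ∑ j ∈ range (N - i), seqExt nt j =
      ∑ j ∈ range (N - (i + 1)), seqExt nt j + seqExt nt (N - (i + 1)) := by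
  rw [← Finset.sum_range_succ]
  congr 2
  omega

/-- The closed form of the discretized polynomials. -/
def closedForm (p τ B : ℂ) (A : ℕ → ℂ) (m : ℕ → ℕ) (N : ℕ) (M Y n d : ℕ → ℕ) : ℂ :=
  (∏ i ∈ range N, latticeFactor p τ B (M (i + 1)) (Y (i + 1))) / latticeFactor p τ B (M N) (Y N) *
    ∏ i ∈ range N, ((latticeFactor p τ B (M i) (Y (i + 1)))⁻¹ *
      gridSeries p (n i) (d i) (τ * A (i + 1) ^ 2 / p * p ^ (M i + M (i + 1)))
        (B ^ 2 / A i ^ 2 * p ^ (Y i + Y (i + 1))) (B * p ^ (M i + Y (i + 1)))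
        (τ * B * p ^ (M i + Y (i + 1))) (p ^ (-(m i : ℤ))))

/-- The normalization cancels A_i^{n_i} and (p^{-m_i}; p)_{n_i}. The remaining Pochhammer symbols
and powers of p at site i are the quotient of the lattice factors at (M_{i+1}, Y_{i+1}) and (M_i,
Y_{i+1}), and the denominator of the normalization is the lattice factor at the end point (M_N, 0).
-/
theorem Admissible.grPolyNormalized_eq_closedForm {N : ℕ} {q : ℂ} {α : ℕ → ℂ} {m : Fin N → ℕ}
    (h : Admissible q α m) (n nt : Fin N → ℕ) (hn : ∀ i, n i ≤ m i) (hnt : ∀ i, nt i ≤ m i.rev) :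
    grPolyNormalized q α n (supportZ q α fun i => (nt i : ℤ)) =
      closedForm (q ^ 2) (α 0 ^ 2)⁻¹ (α (N + 1) * α (N + 2)) (paramSeq N α) (seqExt m) N
        (fun i => ∑ j ∈ range i, seqExt n j) (fun i => ∑ j ∈ range (N - i), seqExt nt j)
        (seqExt n) (fun i => seqExt nt (N - (i + 1))) := by
  have hd := h.isSupportData
  have hp0 := hd.base.ne_zero
  have hB : NotPow (q ^ 2) (α (N + 1) * α (N + 2)) := h.generic_ac
  have hB' : NotPow (q ^ 2) ((α 0 ^ 2)⁻¹ * (α (N + 1) * α (N + 2))) := by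
    have := hd.bc
    rwa [paramSeq_of_le α le_rfl] at this
  have key := hd.grProduct_support (M := fun i => ∑ j ∈ range i, seqExt n j)
    (Y := fun i => ∑ j ∈ range (N - i), seqExt nt j) (n := seqExt n)
    (d := fun i => seqExt nt (N - (i + 1))) (fun i => rfl)
    (fun i hi => sum_range_seqExt_sub nt hi) (fun i hi => by simp [seqExt, hi, hn]) (fun i hi => by
      have h1 : N - (i + 1) < N := by omega
      have := hnt ⟨N - (i + 1), h1⟩
      simp only [seqExt, hi, h1, dif_pos]
      convert this
      simp only [Fin.val_rev]
      omega)
  rw [grPolyNormalized, h.grPoly_supportZ]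
  have hexp : gridExp (fun i => (nt i : ℤ)) = fun j => ((∑ i ∈ range (N - j), seqExt nt i : ℕ) : ℤ) :=
    funext fun j => gridExp_natCast nt j
  have hden : ∏ i : Fin N, (α (i + 1) ^ n i * qPoch (α (i + 2) ^ 2 / α (i + 1) ^ 2) (q ^ 2) (n i)) =
      ∏ i ∈ range N, (paramSeq N α i ^ seqExt n i *
        qPoch ((q ^ 2) ^ (-((seqExt m i : ℕ) : ℤ))) (q ^ 2) (seqExt n i)) := by
    rw [Finset.prod_range]
    refine Finset.prod_congr rfl fun i _ => ?_
    rw [← hd.ratio i i.isLt, paramSeq_of_le α i.isLt.le,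
      paramSeq_of_le α (show i.val + 1 ≤ N from i.isLt), div_pow]
    simp [seqExt]
  have hfin : latticeFactor (q ^ 2) (α 0 ^ 2)⁻¹ (α (N + 1) * α (N + 2))
      (∑ j ∈ range N, seqExt n j) (∑ j ∈ range (N - N), seqExt nt j) =
      qPoch (α (N + 1) * α (N + 2)) (q ^ 2) (psum n N) *
        qPoch (α (N + 1) * α (N + 2) / α 0 ^ 2) (q ^ 2) (psum n N) := by
    rw [latticeFactor, psum_eq_sum_range, div_eq_inv_mul (α (N + 1) * α (N + 2)) (α 0 ^ 2)]
    simp only [Nat.sub_self, Finset.range_zero, Finset.sum_empty, add_zero, mul_zero, pow_zero,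
      div_one]
  rw [hexp, key, hden, closedForm, hfin, psum_eq_sum_range, pow_sum_eq_prod,
    paramSeq_of_le α le_rfl, one_div, ← Finset.prod_inv_distrib, div_mul_eq_mul_div,
    div_mul_eq_mul_div, div_mul_eq_mul_div, ← Finset.prod_mul_distrib, ← Finset.prod_mul_distrib,
    ← Finset.prod_mul_distrib]
  congr 1
  refine Finset.prod_congr rfl fun i hi => ?_
  have hi := Finset.mem_range.mp hi
  have hni : seqExt n i ≤ seqExt m i := by simp [seqExt, hi, hn]
  have hA := pow_ne_zero (seqExt n i) (hd.A_ne_zero i)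
  have hB0 : α (N + 1) * α (N + 2) ≠ 0 :=
    mul_ne_zero (h.ne_zero _ (by omega)) (h.ne_zero _ (by omega))
  have hBn := pow_ne_zero (seqExt n i) hB0
  have hP : qPoch ((q ^ 2) ^ (-((seqExt m i : ℕ) : ℤ))) (q ^ 2) (seqExt n i) ≠ 0 := by
    refine qPoch_ne_zero fun k hk => ?_
    rw [← zpow_natCast (q ^ 2) k, ← zpow_add₀ hp0]
    exact hd.base.one_sub_zpow_ne_zero (by omega)
  rw [← mul_assoc (latticeFactor _ _ _ _ _), Finset.sum_range_succ,
    ← div_eq_mul_inv (latticeFactor _ _ _ _ _),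
    latticeFactor_div hp0 hB hB']
  generalize gridSeries _ _ _ _ _ _ _ _ = S
  generalize qPoch ((q ^ 2) ^ (-((seqExt m i : ℕ) : ℤ))) (q ^ 2) (seqExt n i) = P at *
  generalize qPoch _ _ _ = x
  generalize qPoch _ _ _ = y
  generalize (α (N + 1) * α (N + 2)) ^ seqExt n i = b at *
  generalize paramSeq N α i ^ seqExt n i = c at *
  generalize (q ^ 2) ^ _ = u
  rw [mul_inv]
  field_simp

namespace Grid

variable {N : ℕ} {m : Fin N → ℕ}

lemma exists_toInt {y : Fin N → ℤ} (hy : ∀ i, 0 ≤ y i ∧ y i ≤ m i) :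
    ∃ g : Grid m, g.toInt = y :=
  ⟨fun i => ⟨(y i).toNat, by have := hy i; omega⟩, funext fun i => Int.toNat_of_nonneg (hy i).1⟩

lemma toInt_injective : Function.Injective (Grid.toInt : Grid m → Fin N → ℤ) := fun _ _ hg =>
  funext fun i => Fin.ext (Int.natCast_inj.mp (congrFun hg i))

lemma toNat_le (g : Grid m) (i : Fin N) : g.toNat i ≤ m i := Nat.lt_succ_iff.mp (g i).isLt

lemma toInt_eq (g : Grid m) : g.toInt = fun i => (g.toNat i : ℤ) := rfl

lemma toInt_mem (g : Grid m) (i : Fin N) : 0 ≤ g.toInt i ∧ g.toInt i ≤ m i :=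
  ⟨Int.natCast_nonneg _, Int.ofNat_le.mpr (g.toNat_le i)⟩

lemma psum_toInt (g : Grid m) (k : ℕ) : psum g.toInt k = (psum g.toNat k : ℕ) := by
  simp [psum, Grid.toInt, Grid.toNat]

end Grid

/-- The points (M i, Y i) run along a lattice path, which the hypotheses reverse and reflect in the
diagonal. The product over its interior points and the product over the corners (M i, Y (i + 1)) are
both preserved, since lattice factors and series are symmetric. -/
lemma closedForm_eq_of_dual {p τ B : ℂ} (hp : p ≠ 0) (hB : NotPow p B) (hB' : NotPow p (τ * B))
    {N : ℕ} {A A' : ℕ → ℂ} {m m' M M' Y Y' n n' d d' : ℕ → ℕ}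
    (hM : ∀ i ≤ N, M' i = Y (N - i)) (hY : ∀ i ≤ N, Y' i = M (N - i))
    (hn : ∀ i < N, n' (N - 1 - i) = d i) (hd : ∀ i < N, d' (N - 1 - i) = n i)
    (hm : ∀ i < N, m' (N - 1 - i) = m i)
    (hA : ∀ i < N, τ * A' (N - i) ^ 2 / p = B ^ 2 / A i ^ 2)
    (hA' : ∀ i < N, B ^ 2 / A' (N - (i + 1)) ^ 2 = τ * A (i + 1) ^ 2 / p) :
    closedForm p τ B A' m' N M' Y' n' d' = closedForm p τ B A m N M Y n d := by
  unfold closedForm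
  congr 1
  · have h0 := latticeFactor_ne_zero hp hB hB' (M 0) (Y 0)
    have hN := latticeFactor_ne_zero hp hB hB' (M N) (Y N)
    rw [hM N le_rfl, hY N le_rfl, Nat.sub_self, latticeFactor_comm p τ B (Y 0), div_eq_div_iff h0 hN,
      ← Finset.prod_range_reflect]
    have e1 : ∏ j ∈ range N, latticeFactor p τ B (M' (N - 1 - j + 1)) (Y' (N - 1 - j + 1)) =
        ∏ j ∈ range N, latticeFactor p τ B (M j) (Y j) := by
      refine Finset.prod_congr rfl fun j hj => ?_
      have hj := Finset.mem_range.mp hj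
      rw [hM _ (by omega), hY _ (by omega), latticeFactor_comm,
        show N - (N - 1 - j + 1) = j by omega]
    rw [e1, ← Finset.prod_range_succ (fun j => latticeFactor p τ B (M j) (Y j)),
      ← Finset.prod_range_succ' (fun j => latticeFactor p τ B (M j) (Y j))]
  · rw [← Finset.prod_range_reflect]
    refine Finset.prod_congr rfl fun i hi => ?_
    have hi := Finset.mem_range.mp hi
    rw [hM _ (by omega), hY _ (by omega), hM _ (by omega), hY _ (by omega), hn i hi, hd i hi, hm i hi,
      show N - 1 - i + 1 = N - i by omega, show N - 1 - i = N - (i + 1) by omega, hA i hi, hA' i hi,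
      show N - (N - i) = i by omega, show N - (N - (i + 1)) = i + 1 by omega,
      latticeFactor_comm, gridSeries_comm hp, add_comm (Y (i + 1)) (Y i), add_comm (M (i + 1)) (M i),
      add_comm (Y (i + 1)) (M i)]

/-! ### The dual parameters -/

lemma dualParam_zero (N : ℕ) (q : ℂ) (α : ℕ → ℂ) : dualParam N q α 0 = α 0 := if_pos rfl

lemma dualParam_of_le {N j : ℕ} (q : ℂ) (α : ℕ → ℂ) (h0 : 0 < j) (hj : j ≤ N + 1) :
    dualParam N q α j = α 0 * α (N + 1) * α (N + 2) * q / α (N + 2 - j) := by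
  rw [dualParam, if_neg h0.ne', if_pos hj]

lemma dualParam_last (N : ℕ) (q : ℂ) (α : ℕ → ℂ) : dualParam N q α (N + 2) = α 1 / (α 0 * q) := by
  rw [dualParam, if_neg (by omega), if_neg (by omega)]

lemma paramSeq_dualParam {N j : ℕ} (q : ℂ) (α : ℕ → ℂ) (hj : j ≤ N) : paramSeq N (dualParam N q α) j =
    α 0 * α (N + 1) * α (N + 2) * q / paramSeq N α (N - j) := by
  rw [paramSeq_of_le _ hj, dualParam_of_le q α (by omega) (by omega),
    paramSeq_of_le α (show N - j ≤ N by omega), show N + 2 - (j + 1) = N - j + 1 by omega]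

namespace Admissible

variable {N : ℕ} {q : ℂ} {α : ℕ → ℂ} {m : Fin N → ℕ} (h : Admissible q α m)
include h

lemma dualParam_mul_last : dualParam N q α (N + 1) * dualParam N q α (N + 2) =
    α (N + 1) * α (N + 2) := by
  have h0 := h.ne_zero 0 (by omega)
  have h1 := h.ne_zero 1 (by omega)
  have hq := h.q_ne_zero
  rw [dualParam_of_le q α (by omega) le_rfl, dualParam_last, show N + 2 - (N + 1) = 1 by omega]
  field_simp

lemma dualParam_ne_zero {j : ℕ} (hj : j ≤ N + 2) : dualParam N q α j ≠ 0 := by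
  have h0 := h.ne_zero 0 (by omega)
  have hq := h.q_ne_zero
  unfold dualParam
  split_ifs with h1 h2
  · exact h0
  · exact div_ne_zero (mul_ne_zero (mul_ne_zero (mul_ne_zero h0 (h.ne_zero _ (by omega)))
      (h.ne_zero _ le_rfl)) hq) (h.ne_zero _ (by omega))
  · exact div_ne_zero (h.ne_zero _ (by omega)) (mul_ne_zero h0 hq)

lemma exists_last_sq_eq : ∃ k : ℤ, α (N + 1) ^ 2 = α 1 ^ 2 * (q ^ 2) ^ k := by
  obtain ⟨k, hk⟩ := h.isSupportData.exists_sq_eq le_rfl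
  rw [paramSeq_of_le α le_rfl, paramSeq_of_le α (Nat.zero_le N)] at hk
  exact ⟨k, hk⟩

/-- Admissible parameters are dual to admissible parameters. -/
theorem dual : Admissible q (dualParam N q α) fun i => m i.rev := by
  have h0 := h.ne_zero 0 (by omega)
  have h1 := h.ne_zero 1 (by omega)
  have hN := h.ne_zero (N + 1) (by omega)
  have hN2 := h.ne_zero (N + 2) (by omega)
  have hq := h.q_ne_zero
  have hp : q ^ 2 ≠ 0 := pow_ne_zero _ hq
  obtain ⟨k, hk⟩ := h.exists_last_sq_eq
  have hpk := zpow_ne_zero k hp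
  -- Duality permutes the genericity conditions up to inversion and powers of q²: ab and z are
  -- interchanged, ad and bd are interchanged, ac and bc are fixed.
  refine ⟨hq, h.not_root_of_unity, h.pos, fun i => h.m_pos _, fun i hi => h.dualParam_ne_zero hi,
    fun i => ?_, ?_, ?_, ?_, ?_, ?_, ?_⟩
  · have hr := h.ratio i.rev
    have hi := i.isLt
    rw [Fin.val_rev, show N - (i.val + 1) + 2 = N + 2 - (i + 1) by omega,
      show N - (i.val + 1) + 1 = N + 2 - (i + 2) by omega] at hr
    rw [dualParam_of_le q α (by omega) (by omega), dualParam_of_le q α (by omega) (by omega), ← hr]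
    have hx := h.ne_zero (N + 2 - (i + 1)) (by omega)
    have hy := h.ne_zero (N + 2 - (i + 2)) (by omega)
    field_simp
  · have := NotPow.mul_zpow hp h.generic_z 1
    refine fun j hj => this j (hj ▸ ?_)
    rw [dualParam_zero, dualParam_of_le q α (by omega) (by omega), zpow_one,
      show N + 2 - 1 = N + 1 by omega]
    field_simp
  · rw [h.dualParam_mul_last]
    exact h.generic_ac
  · have := NotPow.mul_zpow hp (NotPow.inv h.generic_bd) (1 + k)
    refine fun j hj => this j (hj ▸ ?_)
    rw [dualParam_last, dualParam_of_le q α (by omega) (by omega), zpow_add₀ hp, zpow_one,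
      show N + 2 - (N + 1) = 1 by omega]
    field_simp
    linear_combination -hk
  · rw [h.dualParam_mul_last, dualParam_zero]
    exact h.generic_bc
  · have := NotPow.mul_zpow hp (NotPow.inv h.generic_ad) (1 + k)
    refine fun j hj => this j (hj ▸ ?_)
    rw [dualParam_last, dualParam_zero, dualParam_of_le q α (by omega) (by omega), zpow_add₀ hp,
      zpow_one, show N + 2 - (N + 1) = 1 by omega]
    field_simp
    linear_combination -hk
  · have := NotPow.mul_zpow hp h.generic_ab (-1)
    refine fun j hj => this j (hj ▸ ?_)
    rw [dualParam_last, zpow_neg, zpow_one]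
    field_simp

/-- The duality of the discretized polynomials. -/
theorem grPolyNormalized_dualParam {n nt : Fin N → ℕ} (hn : ∀ i, n i ≤ m i)
    (hnt : ∀ i, nt i ≤ m i.rev) :
    grPolyNormalized q (dualParam N q α) nt (supportZ q (dualParam N q α) fun i => (n i : ℤ)) =
      grPolyNormalized q α n (supportZ q α fun i => (nt i : ℤ)) := by
  have hd := h.isSupportData
  have h0 := h.ne_zero 0 (by omega)
  have hN := h.ne_zero (N + 1) (by omega)
  have hN2 := h.ne_zero (N + 2) (by omega)
  have hq := h.q_ne_zero
  have bc := hd.bc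
  rw [paramSeq_of_le α le_rfl] at bc
  rw [h.grPolyNormalized_eq_closedForm n nt hn hnt, h.dual.grPolyNormalized_eq_closedForm nt n hnt
    (fun i => by simpa using hn i), h.dualParam_mul_last, dualParam_zero]
  refine closedForm_eq_of_dual hd.base.ne_zero h.generic_ac bc ?_ ?_ ?_ ?_ ?_ ?_ ?_
  · intro i hi
    simp only [show N - (N - i) = i by omega]
  · intro i _
    rfl
  · intro i hi
    simp only [show N - 1 - i = N - (i + 1) by omega]
  · intro i hi
    simp only [show N - (N - 1 - i + 1) = i by omega]
  · intro i hi
    simp only [seqExt, hi, show N - 1 - i < N by omega, dif_pos]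
    congr 1
    ext
    simp only [Fin.val_rev]
    omega
  · intro i hi
    have hA := h.paramSeq_ne_zero i
    rw [paramSeq_dualParam q α (by omega), show N - (N - i) = i by omega]
    field_simp
  · intro i hi
    have hA := h.paramSeq_ne_zero (i + 1)
    rw [paramSeq_dualParam q α (by omega), show N - (N - (i + 1)) = i + 1 by omega]
    field_simp

lemma dualZ_eq (n : Fin N → ℤ) : dualZ q α n = supportZ q (dualParam N q α) n := by
  funext i
  have h0 := h.ne_zero 0 (by omega)
  have hN := h.ne_zero (N + 1) (by omega)
  have hN2 := h.ne_zero (N + 2) (by omega)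
  have hq := h.q_ne_zero
  have hx := h.ne_zero (N + 1 - i) (by omega)
  rw [dualZ, supportZ, h.dualParam_mul_last, dualParam_of_le q α (by omega) (by omega),
    show N + 2 - (i.val + 1) = N + 1 - i by omega]
  field_simp

/-- The dual variables are the discrete support of the dual parameters. Hence every statement about
𝔻_n is one about 𝔻* for dual parameters. -/
lemma Dn_eq {V : Type*} [AddCommGroup V] [Module ℂ V] (f : (Fin N → ℤ) → V) (n : Fin N → ℤ) :
    Dn q α f n = DStarNt q (dualParam N q α) f n := by
  rw [Dn, DStarNt, h.dualZ_eq]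

lemma thetaStar_dualParam (p : ℤ) : thetaStar N q (dualParam N q α) p = theta N q α p := by
  have h0 := h.ne_zero 0 (by omega)
  have h1 := h.ne_zero 1 (by omega)
  have hN := h.ne_zero (N + 1) (by omega)
  have hN2 := h.ne_zero (N + 2) (by omega)
  have hq := h.q_ne_zero
  rw [thetaStar, theta, dualParam_zero, dualParam_of_le q α (by omega) (by omega),
    show N + 2 - (N + 1) = 1 by omega]
  congr 2
  · field_simp
  · field_simp

lemma theta_dualParam (p : ℤ) : theta N q (dualParam N q α) p = thetaStar N q α p := by
  have h0 := h.ne_zero 0 (by omega)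
  have hN := h.ne_zero (N + 1) (by omega)
  have hN2 := h.ne_zero (N + 2) (by omega)
  have hq := h.q_ne_zero
  rw [thetaStar, theta, h.dualParam_mul_last, dualParam_of_le q α (by omega) (by omega),
    show N + 2 - 1 = N + 1 by omega]
  congr 2
  · field_simp
  · field_simp

/-- The recurrence in the dual indices, on the grid. -/
theorem DStarNt_discretizedPoly (n : Grid m) (f : (Fin N → ℤ) → ℂ)
    (hf : ∀ nt : DualGrid m, f (Grid.toInt nt) = discretizedPoly q α n nt) (nt : DualGrid m) :
    1 / 2 * DStarNt q α f (Grid.toInt nt) =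
      thetaStar N q α (psum n.toInt N) * discretizedPoly q α n nt := by
  rw [n.psum_toInt]
  refine h.DStarNt_grPolyNormalized n.toNat (Grid.toInt nt) (Grid.toInt_mem nt) f fun y hy => ?_
  obtain ⟨g, rfl⟩ := Grid.exists_toInt hy
  exact hf g

/-- The recurrence in the indices, on the grid. -/
theorem Dn_discretizedPoly (nt : DualGrid m) (f : (Fin N → ℤ) → ℂ)
    (hf : ∀ n : Grid m, f n.toInt = discretizedPoly q α n nt) (n : Grid m) :
    1 / 2 * Dn q α f n.toInt =
      theta N q α (psum (Grid.toInt nt) N) * discretizedPoly q α n nt := by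
  rw [h.Dn_eq, Grid.psum_toInt, ← h.thetaStar_dualParam, discretizedPoly, Grid.toInt_eq nt,
    ← h.grPolyNormalized_dualParam n.toNat_le (Grid.toNat_le nt)]
  refine h.dual.DStarNt_grPolyNormalized (Grid.toNat nt) n.toInt
    (fun i => by simpa using n.toInt_mem i) f fun y hy => ?_
  obtain ⟨g, rfl⟩ := Grid.exists_toInt (m := m) (y := y) (fun i => by simpa using hy i)
  rw [hf, discretizedPoly, Grid.toInt_eq nt, ← h.grPolyNormalized_dualParam g.toNat_le
    (Grid.toNat_le nt)]
  rfl

end Admissible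

/-! ### Detailed balance -/

lemma exists_balancing (a b : ℤ → ℂ) : ∃ φ : ℤ → ℂ, (∀ i, φ i ≠ 0) ∧
    ∀ i, a i ≠ 0 → b i ≠ 0 → φ (i + 1) * b i = φ i * a i := by
  -- The ratio φ (i + 1)/φ i. Nothing is required where a coefficient vanishes, and the value 1
  -- keeps φ nonzero there.
  let ρ : ℤ → ℂ := fun i => if a i = 0 ∨ b i = 0 then 1 else a i / b i
  have hρ : ∀ i, ρ i ≠ 0 := fun i => by
    simp only [ρ]
    split_ifs with h
    · exact one_ne_zero
    · rw [not_or] at h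
      exact div_ne_zero h.1 h.2
  let φ : ℤ → ℂ := fun i => (∏ k ∈ range i.toNat, ρ k) * (∏ k ∈ range (-i).toNat, ρ (-k - 1))⁻¹
  have hφ : ∀ i, φ i ≠ 0 := fun i => mul_ne_zero (Finset.prod_ne_zero_iff.mpr fun _ _ => hρ _)
    (inv_ne_zero (Finset.prod_ne_zero_iff.mpr fun _ _ => hρ _))
  have step : ∀ i, φ (i + 1) = φ i * ρ i := by
    intro i
    rcases le_or_gt 0 i with hi | hi
    · lift i to ℕ using hi
      have h1 : (-(i : ℤ)).toNat = 0 := by omega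
      have h2 : (-((i : ℤ) + 1)).toNat = 0 := by omega
      have h3 : ((i : ℤ) + 1).toNat = i + 1 := by omega
      simp only [φ, h1, h2, h3, Int.toNat_natCast, Finset.prod_range_succ, Finset.range_zero,
        Finset.prod_empty, inv_one, mul_one]
    · obtain ⟨j, rfl⟩ : ∃ j : ℕ, i = -j - 1 := ⟨(-i - 1).toNat, by omega⟩
      have h1 : (-(-(j : ℤ) - 1)).toNat = j + 1 := by omega
      have h2 : (-(-(j : ℤ) - 1 + 1)).toNat = j := by omega
      have h3 : (-(j : ℤ) - 1 + 1).toNat = 0 := by omega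
      have h4 : (-(j : ℤ) - 1).toNat = 0 := by omega
      have := hρ (-j - 1)
      simp only [φ, h1, h2, h3, h4, Finset.prod_range_succ, Finset.range_zero, Finset.prod_empty,
        one_mul, mul_inv]
      rw [mul_assoc, inv_mul_cancel₀ this, mul_one]
  refine ⟨φ, hφ, fun i ha hb => ?_⟩
  have : ρ i = a i / b i := if_neg (not_or.mpr ⟨ha, hb⟩)
  rw [step, this]
  field_simp

lemma exists_balancing_signType (c : ℤ → SignType → ℂ) (hpos : ∀ i, c i .pos ≠ 0)
    (hneg : ∀ i, c i .neg ≠ 0) : ∃ g : ℤ → ℂ, (∀ i, g i ≠ 0) ∧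
    ∀ (i : ℤ) (e : SignType), g (i + e) * c (i + e) (-e) = g i * c i e := by
  obtain ⟨g, hg, h⟩ := exists_balancing (fun i => c i .pos) fun i => c (i + 1) .neg
  refine ⟨g, hg, fun i e => ?_⟩
  match e with
  | .zero =>
    have : (i : ℤ) + ((SignType.zero : SignType) : ℤ) = i := add_zero i
    rw [this]
    rfl
  | .pos => exact h i (hpos i) (hneg _)
  | .neg =>
    have h1 := h (i - 1) (hpos _) (hneg _)
    rw [sub_add_cancel] at h1
    exact h1.symm

/-- Shifts by two are composed of unit steps, so one function balances all lengths. Nonvanishing is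
needed only for the steps actually traversed, which admits factors with zeros at the ends of a
finite interval. -/
lemma exists_balancing_shiftFactor {p : ℂ} (hp : p ≠ 0) (s : ℂ) {σ : ℂ} (hσ : σ ≠ 0) :
    ∃ φ : ℤ → ℂ, (∀ i, φ i ≠ 0) ∧ ∀ i t : ℤ, -2 ≤ t → t ≤ 2 →
      (∀ j, min i (i + t) ≤ j → j < max i (i + t) →
        1 - s * (σ * p ^ j) ≠ 0 ∧ 1 - s * (σ * p ^ (j + 1))⁻¹ ≠ 0) →
      φ (i + t) * shiftFactor p s (-t) (σ * p ^ (i + t)) = φ i * shiftFactor p s t (σ * p ^ i) := by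
  obtain ⟨φ, hφ, h⟩ := exists_balancing (fun j => 1 - s * (σ * p ^ j))
    fun j => 1 - s * (σ * p ^ (j + 1))⁻¹
  have key : ∀ i t : ℤ, 0 ≤ t → t ≤ 2 →
      (∀ j, i ≤ j → j < i + t →
        1 - s * (σ * p ^ j) ≠ 0 ∧ 1 - s * (σ * p ^ (j + 1))⁻¹ ≠ 0) →
      φ (i + t) * shiftFactor p s (-t) (σ * p ^ (i + t)) = φ i * shiftFactor p s t (σ * p ^ i) := by
    intro i t h0 h2 hj
    rw [shiftFactor_neg]
    obtain rfl | rfl | rfl : t = 0 ∨ t = 1 ∨ t = 2 := by omega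
    · rw [add_zero, shiftFactor_zero, shiftFactor_zero]
    · rw [shiftFactor_one, shiftFactor_one]
      have := hj i le_rfl (by omega)
      exact h i this.1 this.2
    · rw [shiftFactor_two, shiftFactor_two]
      have e1 := hj i le_rfl (by omega)
      have e2 := hj (i + 1) (by omega) (by omega)
      have a1 := h i e1.1 e1.2
      have a2 := h (i + 1) e2.1 e2.2
      have b1 : s * p * (σ * p ^ i) = s * (σ * p ^ (i + 1)) := by rw [zpow_add_one₀ hp]; ring
      have b2 : s * p * (σ * p ^ (i + 2))⁻¹ = s * (σ * p ^ (i + 1))⁻¹ := by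
        rw [show i + 2 = i + 1 + 1 by ring, zpow_add_one₀ hp (i + 1)]
        have := zpow_ne_zero (i + 1) hp
        field_simp
      rw [b1, b2]
      rw [show i + 1 + 1 = i + 2 by ring] at a2
      linear_combination (1 - s * (σ * p ^ (i + 1))⁻¹) * a2 + (1 - s * (σ * p ^ (i + 1))) * a1
  refine ⟨φ, hφ, fun i t h1 h2 hj => ?_⟩
  rcases le_total 0 t with ht | ht
  · exact key i t ht h2 fun j hj1 hj2 => hj j (by rwa [min_eq_left (by omega)])
      (by rwa [max_eq_right (by omega)])
  · have := key (i + t) (-t) (by omega) (by omega) fun j hj1 hj2 => hj j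
      (by rwa [min_eq_right (by omega)]) (by rw [max_eq_left (by omega)]; omega)
    rw [add_neg_cancel_right, neg_neg] at this
    exact this.symm

lemma neg_signType_coe (e : SignType) : ((-e : SignType) : ℤ) = -e := by cases e <;> rfl

namespace IsSupportData

variable {p τ w : ℂ} {A : ℕ → ℂ} {m : ℕ → ℕ} {N : ℕ} (h : IsSupportData p τ w A m N)
include h

lemma exists_balancing_site {j : ℕ} (hj : j < N) : ∃ u : ℤ → ℂ, (∀ i, u i ≠ 0) ∧
    ∀ (i : ℤ) (e : SignType), u (i + e) * siteWeight p (A N * w / A j * p ^ (i + e : ℤ)) (-e) =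
      u i * siteWeight p (A N * w / A j * p ^ i) e := by
  have hp := h.base.ne_zero
  have key : ∀ i : ℤ, NotPow p ((A N * w / A j * p ^ i) ^ 2) :=
    fun i => h.notPow_supportVar_sq (fun _ => i) hj.le
  refine exists_balancing_signType (fun i e => siteWeight p (A N * w / A j * p ^ i) e)
    (fun i => ?_) fun i => ?_
  · obtain ⟨h1, h2, -⟩ := NotPow.ne_zero_factors hp (key i)
    exact one_div_ne_zero (mul_ne_zero h1 h2)
  · have := (key i).inv
    rw [← inv_pow] at this
    obtain ⟨h1, h2, -⟩ := NotPow.ne_zero_factors hp this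
    exact one_div_ne_zero (mul_ne_zero h1 h2)

lemma exists_balancing_left : ∃ g : ℤ → ℂ, (∀ i, g i ≠ 0) ∧
    ∀ (i : ℤ) (e : SignType),
      g (i + e) * pairing p (1, A 0 + τ * A 0, A 0 * (τ * A 0))
        (sitePair p (A N * w / A 0 * p ^ (i + e : ℤ)) (-e)) =
      g i * pairing p (1, A 0 + τ * A 0, A 0 * (τ * A 0))
        (sitePair p (A N * w / A 0 * p ^ i) e) := by
  have hp := h.base.ne_zero
  refine exists_balancing_signType (fun i e => pairing p (1, A 0 + τ * A 0, A 0 * (τ * A 0))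
        (sitePair p (A N * w / A 0 * p ^ i) e)) ?_ ?_
  · intro i
    have e1 := h.mul_supportVar (fun _ => i) 0
    rw [supportVar] at e1
    rw [pairing_sitePair_pos h.base, mul_assoc, e1]
    exact mul_ne_zero (h.ac.one_sub_mul_zpow_ne_zero hp i)
      (by rw [← mul_assoc]; exact h.bc.one_sub_mul_zpow_ne_zero hp i)
  · intro i
    obtain ⟨k, e1⟩ := h.exists_mul_inv_supportVar (fun _ => i) (Nat.zero_le N)
    rw [supportVar] at e1
    rw [pairing_sitePair_neg h.base, mul_assoc, e1]
    exact mul_ne_zero (h.ad.one_sub_mul_zpow_ne_zero hp k)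
      (by rw [← mul_assoc]; exact h.bd.one_sub_mul_zpow_ne_zero hp k)

lemma exists_balancing_add {j : ℕ} (hj : j < N) : ∃ φ : ℤ → ℂ, (∀ i, φ i ≠ 0) ∧
    ∀ i t : ℤ, -2 ≤ t → t ≤ 2 →
      φ (i + t) * shiftFactor p (A (j + 1) / A j) (-t)
          (A N * w / A j * (A N * w / A (j + 1)) * p ^ (i + t)) =
        φ i * shiftFactor p (A (j + 1) / A j) t
          (A N * w / A j * (A N * w / A (j + 1)) * p ^ i) := by
  have hp := h.base.ne_zero
  have hA := h.A_ne_zero j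
  have hA1 := h.A_ne_zero (j + 1)
  have hAN := h.A_ne_zero N
  have hw := h.w_ne_zero
  obtain ⟨φ, hφ, key⟩ := exists_balancing_shiftFactor hp (A (j + 1) / A j)
    (σ := A N * w / A j * (A N * w / A (j + 1))) (by positivity)
  refine ⟨φ, hφ, fun i t h1 h2 => key i t h1 h2 fun k _ _ => ⟨?_, ?_⟩⟩
  · have := h.notPow_supportVar_sq (fun _ => 0) hj.le
    convert this.one_sub_mul_zpow_ne_zero hp k using 2
    rw [supportVar, zpow_zero]
    field_simp
  · have := h.notPow_supportVar_sq (fun _ => 0) (show j + 1 ≤ N from hj)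
    convert this.inv.one_sub_mul_zpow_ne_zero hp (-(k + 1)) using 2
    rw [supportVar, zpow_zero, zpow_neg]
    have := zpow_ne_zero (k + 1) hp
    field_simp

/-- The transition factors in the difference Y j - Y (j + 1) are 1 - p^{k-m} and 1 - p^{-(k+1)}.
They are nonzero for 0 ≤ k < m, hence along every step inside the grid. -/
lemma exists_balancing_sub {j : ℕ} (hj : j < N) : ∃ φ : ℤ → ℂ, (∀ i, φ i ≠ 0) ∧
    ∀ i t : ℤ, -2 ≤ t → t ≤ 2 → 0 ≤ i → i ≤ m j → 0 ≤ i + t → i + t ≤ m j →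
      φ (i + t) * shiftFactor p (A (j + 1) / A j) (-t) (A (j + 1) / A j * p ^ (i + t)) =
        φ i * shiftFactor p (A (j + 1) / A j) t (A (j + 1) / A j * p ^ i) := by
  have hp := h.base.ne_zero
  have hs := div_ne_zero (h.A_ne_zero (j + 1)) (h.A_ne_zero j)
  obtain ⟨φ, hφ, key⟩ := exists_balancing_shiftFactor hp (A (j + 1) / A j) hs
  refine ⟨φ, hφ, fun i t h1 h2 h3 h4 h5 h6 => key i t h1 h2 fun k hk1 hk2 => ⟨?_, ?_⟩⟩
  · rw [← mul_assoc, ← pow_two, h.ratio j hj, ← zpow_add₀ hp]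
    refine h.base.one_sub_zpow_ne_zero ?_
    rcases le_total i (i + t) with hh | hh <;> simp [hh] at hk1 hk2 <;> omega
  · rw [mul_inv, mul_inv_cancel_left₀ hs, ← zpow_neg]
    refine h.base.one_sub_zpow_ne_zero ?_
    rcases le_total i (i + t) with hh | hh <;> simp [hh] at hk1 hk2 <;> omega

/-- Detailed balance for the coefficients of the operators on the discrete support. -/
theorem exists_balancing_weight : ∃ K : (ℕ → ℤ) → ℂ, (∀ Y, K Y ≠ 0) ∧
    ∀ k ≤ N, ∀ (Y : ℕ → ℤ) (ε : ℕ → SignType), IsGridSeq m N Y →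
      IsGridSeq m N (fun j => Y j + ε j) → (∀ j, k ≤ j → ε j = 0) →
      K (fun j => Y j + ε j) * chainCoeff p k (1, A 0 + τ * A 0, A 0 * (τ * A 0)) A
          (supportVar p w A N fun j => Y j + ε j) (fun j => -ε j) =
        K Y * chainCoeff p k (1, A 0 + τ * A 0, A 0 * (τ * A 0)) A (supportVar p w A N Y) ε := by
  obtain ⟨g, hg, g_eq⟩ := h.exists_balancing_left
  choose! u hu u_eq using fun j (hj : j < N) => h.exists_balancing_site hj
  choose! a ha a_eq using fun j (hj : j < N) => h.exists_balancing_add hj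
  choose! b hb b_eq using fun j (hj : j < N) => h.exists_balancing_sub hj
  -- Every factor of a coefficient depends on one of Y 0, Y j, Y j + Y (j + 1), Y j - Y (j + 1), so
  -- the weight is a product of one-variable solutions and does not depend on k.
  refine ⟨fun Y => g (Y 0) * ∏ j ∈ range N, (u j (Y j) * a j (Y j + Y (j + 1)) *
    b j (Y j - Y (j + 1))), fun Y => mul_ne_zero (hg _) (Finset.prod_ne_zero_iff.mpr fun j hj =>
      have hj := Finset.mem_range.mp hj
      mul_ne_zero (mul_ne_zero (hu j hj _) (ha j hj _)) (hb j hj _)), ?_⟩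
  intro k hk Y ε hY hYε hε
  -- Sites from k on are not moved; this is why one weight serves the operators of all orders.
  have htail : ∀ j ∈ Ico k N, u j (Y j + ε j) * a j (Y j + ε j + (Y (j + 1) + ε (j + 1))) *
      b j (Y j + ε j - (Y (j + 1) + ε (j + 1))) =
      u j (Y j) * a j (Y j + Y (j + 1)) * b j (Y j - Y (j + 1)) := by
    intro j hj
    have hj := Finset.mem_Ico.mp hj
    simp [hε j hj.1, hε (j + 1) (by omega)]
  have hhead : ∀ j ∈ range k, u j (Y j + ε j) * a j (Y j + ε j + (Y (j + 1) + ε (j + 1))) *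
      b j (Y j + ε j - (Y (j + 1) + ε (j + 1))) *
      (siteWeight p (supportVar p w A N (fun j => Y j + ε j) j) (-ε j) *
        pairing p (scale (A (j + 1) / A j)
          (sitePair p (supportVar p w A N (fun j => Y j + ε j) j) (-ε j)))
          (sitePair p (supportVar p w A N (fun j => Y j + ε j) (j + 1)) (-ε (j + 1)))) =
      u j (Y j) * a j (Y j + Y (j + 1)) * b j (Y j - Y (j + 1)) *
      (siteWeight p (supportVar p w A N Y j) (ε j) *
        pairing p (scale (A (j + 1) / A j) (sitePair p (supportVar p w A N Y j) (ε j)))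
          (sitePair p (supportVar p w A N Y (j + 1)) (ε (j + 1)))) := by
    intro j hj
    have hj : j < N := (Finset.mem_range.mp hj).trans_le hk
    have hu' := u_eq j hj (Y j) (ε j)
    have hpair : a j (Y j + ε j + (Y (j + 1) + ε (j + 1))) *
        b j (Y j + ε j - (Y (j + 1) + ε (j + 1))) *
        pairing p (scale (A (j + 1) / A j)
          (sitePair p (supportVar p w A N (fun j => Y j + ε j) j) (-ε j)))
          (sitePair p (supportVar p w A N (fun j => Y j + ε j) (j + 1)) (-ε (j + 1))) =
        a j (Y j + Y (j + 1)) * b j (Y j - Y (j + 1)) *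
        pairing p (scale (A (j + 1) / A j) (sitePair p (supportVar p w A N Y j) (ε j)))
          (sitePair p (supportVar p w A N Y (j + 1)) (ε (j + 1))) := by
      -- The pairing of two unshifted sites does not factor, but then nothing in this term changes.
      by_cases h00 : ε j = 0 ∧ ε (j + 1) = 0
      · simp [supportVar, h00.1, h00.2]
      have h00' : ¬(-ε j = 0 ∧ -ε (j + 1) = 0) := by
        revert h00
        cases ε j <;> cases ε (j + 1) <;> decide
      have bound : ∀ e : SignType, -1 ≤ (e : ℤ) ∧ (e : ℤ) ≤ 1 := by
        intro e; cases e <;> decide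
      have b1 := bound (ε j)
      have b2 := bound (ε (j + 1))
      have za : ∀ Y, supportVar p w A N Y j * supportVar p w A N Y (j + 1) =
          A N * w / A j * (A N * w / A (j + 1)) * p ^ (Y j + Y (j + 1)) := by
        intro Y
        rw [supportVar, supportVar, zpow_add₀ h.base.ne_zero]
        ring
      have A1 := a_eq j hj (Y j + Y (j + 1)) (ε j + ε (j + 1)) (by omega) (by omega)
      have y1 := hY.nonneg j hj
      have y2 := hY.le j hj
      have y3 := hYε.nonneg j hj
      have y4 := hYε.le j hj
      have B1 := b_eq j hj (Y j - Y (j + 1)) (ε j - ε (j + 1)) (by omega) (by omega) y1 y2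
        (by omega) (by omega)
      rw [pairing_sitePair_sitePair h.base (h.supportVar_ne_zero _ _) (h.supportVar_ne_zero _ _) _
        h00, pairing_sitePair_sitePair h.base (h.supportVar_ne_zero _ _) (h.supportVar_ne_zero _ _) _
        h00', za, za, h.supportVar_div, h.supportVar_div, neg_signType_coe, neg_signType_coe]
      have c1 : Y j + ε j + (Y (j + 1) + ε (j + 1)) = Y j + Y (j + 1) + (ε j + ε (j + 1)) := by ring
      have c2 : Y j + ε j - (Y (j + 1) + ε (j + 1)) = Y j - Y (j + 1) + (ε j - ε (j + 1)) := by ring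
      have c3 : -(ε j : ℤ) + -(ε (j + 1) : ℤ) = -(ε j + ε (j + 1)) := by ring
      have c4 : -(ε j : ℤ) - -(ε (j + 1) : ℤ) = -(ε j - ε (j + 1)) := by ring
      rw [c1, c2, c3, c4]
      linear_combination b j (Y j - Y (j + 1) + (ε j - ε (j + 1))) *
        shiftFactor p (A (j + 1) / A j) (-(ε j - ε (j + 1)))
          (A (j + 1) / A j * p ^ (Y j - Y (j + 1) + (ε j - ε (j + 1)))) * A1 +
        a j (Y j + Y (j + 1)) * shiftFactor p (A (j + 1) / A j) (ε j + ε (j + 1))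
          (A N * w / A j * (A N * w / A (j + 1)) * p ^ (Y j + Y (j + 1))) * B1
    change u j _ * siteWeight p (supportVar p w A N (fun j => Y j + ε j) j) _ =
      u j _ * siteWeight p (supportVar p w A N Y j) _ at hu'
    linear_combination a j (Y j + ε j + (Y (j + 1) + ε (j + 1))) *
        b j (Y j + ε j - (Y (j + 1) + ε (j + 1))) *
        pairing p (scale (A (j + 1) / A j)
          (sitePair p (supportVar p w A N (fun j => Y j + ε j) j) (-ε j)))
          (sitePair p (supportVar p w A N (fun j => Y j + ε j) (j + 1)) (-ε (j + 1))) * hu' +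
      u j (Y j) * siteWeight p (supportVar p w A N Y j) (ε j) * hpair
  have combine : ∀ {g₁ P₁ H₁ C₁ g₀ P₀ H₀ C₀ R : ℂ}, g₁ * H₁ = g₀ * H₀ → P₁ * C₁ = P₀ * C₀ →
      g₁ * (P₁ * R) * (H₁ * C₁) = g₀ * (P₀ * R) * (H₀ * C₀) := by
    intro g₁ P₁ H₁ C₁ g₀ P₀ H₀ C₀ R e1 e2
    linear_combination R * P₁ * C₁ * e1 + g₀ * H₀ * R * e2
  rw [chainCoeff, chainCoeff]
  simp only
  rw [← Finset.prod_range_mul_prod_Ico _ hk, ← Finset.prod_range_mul_prod_Ico _ hk,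
    Finset.prod_congr rfl htail]
  refine combine (g_eq (Y 0) (ε 0)) ?_
  rw [← Finset.prod_mul_distrib, ← Finset.prod_mul_distrib]
  exact Finset.prod_congr rfl hhead

end IsSupportData

/-! ### Orthogonality of the discretized polynomials -/

lemma gridExp_injective {N : ℕ} : Function.Injective (gridExp : (Fin N → ℤ) → ℕ → ℤ) := by
  intro x y hxy
  funext i
  have h1 := gridExp_sub x i.rev
  have h2 := gridExp_sub y i.rev
  rw [Fin.rev_rev] at h1 h2
  rw [← h1, ← h2, hxy]

/-- The points of the discrete support are indexed by the grid. -/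
lemma IsGridSeq.exists_grid {N : ℕ} {m : Fin N → ℕ} {a : DualGrid m} {ε : ℕ → SignType}
    (h : IsGridSeq (seqExt m) N fun j => gridExp (Grid.toInt a) j + ε j) :
    ∃ b : DualGrid m, gridExp (Grid.toInt b) = fun j => gridExp (Grid.toInt a) j + ε j := by
  have hε0 : ∀ j, N ≤ j → ε j = 0 := by
    intro j hj
    have := h.zero j hj
    rw [gridExp_of_le _ hj, zero_add] at this
    revert this
    cases ε j <;> decide
  have hexp : gridExp (Grid.toInt a + indexShift fun i => (ε i : ℤ)) =
      fun j => gridExp (Grid.toInt a) j + ε j := by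
    rw [gridExp_add_indexShift, seqExt_coe hε0]
  rw [← hexp] at h ⊢
  obtain ⟨b, hb⟩ := Grid.exists_toInt ((isGridSeq_gridExp_iff m _).mp h)
  exact ⟨b, by rw [hb]⟩

lemma isGridSeq_gridExp {N : ℕ} {m : Fin N → ℕ} (a : DualGrid m) :
    IsGridSeq (seqExt m) N (gridExp (Grid.toInt a)) :=
  (isGridSeq_gridExp_iff m _).mpr (Grid.toInt_mem a)

lemma seqExt_neg {k : ℕ} (ε : Fin k → SignType) : seqExt (-ε) = fun j => -seqExt ε j := by
  funext j
  by_cases h : j < k <;> simp [seqExt, h]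

/-- The family of commuting operators that are diagonal on the discretized polynomials, symmetric
with respect to a common weight. -/
theorem Admissible.exists_symmetric_matrices {N : ℕ} {q : ℂ} {α : ℕ → ℂ} {m : Fin N → ℕ}
    (h : Admissible q α m) : ∃ K : DualGrid m → ℂ, (∀ a, K a ≠ 0) ∧
    ∀ k ≤ N, ∃ M : Matrix (DualGrid m) (DualGrid m) ℂ, (∀ a b, K a * M a b = K b * M b a) ∧
      ∀ n : Fin N → ℕ,
        M.mulVec (fun a => grPolyNormalized q α n (supportZ q α (Grid.toInt a))) =
          (((q ^ 2) ^ psum n k)⁻¹ +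
            (α 0 ^ 2)⁻¹ * paramSeq N α k ^ 2 / q ^ 2 * (q ^ 2) ^ psum n k) •
          fun a => grPolyNormalized q α n (supportZ q α (Grid.toInt a)) := by
  classical
  have hd := h.isSupportData
  have hp0 := hd.base.ne_zero
  have hp1 := hd.base.one_add_ne_zero
  obtain ⟨K, hK, hbal⟩ := hd.exists_balancing_weight
  refine ⟨fun a => K (gridExp (Grid.toInt a)), fun a => hK _, fun k hk => ?_⟩
  have hA0 := hd.A_ne_zero 0
  set A := paramSeq N α with hA
  set τ := (α 0 ^ 2)⁻¹ with hτ
  set p := q ^ 2 with hp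
  set Y : DualGrid m → ℕ → ℤ := fun a => gridExp (Grid.toInt a) with hY
  set c : DualGrid m → (ℕ → SignType) → ℂ := fun a =>
    chainCoeff p k (1, A 0 + τ * A 0, A 0 * (τ * A 0)) A (supportVar p (α (N + 2)) A N (Y a)) with hc
  set z : DualGrid m → ℂ := fun a => supportVar p (α (N + 2)) A N (Y a) k with hz
  -- This diagonal term cancels the part of the factor in `chainOperator_support` that depends on z
  -- k, which leaves a true eigenvalue.
  set D : DualGrid m → ℂ := fun a => A k * (1 + τ) * (z a + (z a)⁻¹) / (1 + p) with hD
  refine ⟨fun a b => (∑ ε : Fin k → SignType, if Y b = (fun j => Y a j + seqExt ε j) then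
    c a (seqExt ε) else 0) + if a = b then D a else 0, ?_, ?_⟩
  · intro a b
    beta_reduce
    rw [mul_add, mul_add]
    congr 1
    -- The shifts from a to b are the negatives of those from b to a, and detailed balance compares
    -- ε with -ε.
    · rw [Finset.mul_sum, Finset.mul_sum, ← Equiv.sum_comp (Equiv.neg (Fin k → SignType))]
      refine Finset.sum_congr rfl fun ε _ => ?_
      have hiff : Y b = (fun j => Y a j + seqExt ((Equiv.neg (Fin k → SignType)) ε) j) ↔
          Y a = fun j => Y b j + seqExt ε j := by
        rw [Equiv.neg_apply, seqExt_neg, funext_iff, funext_iff]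
        refine forall_congr' fun j => ?_
        rw [neg_signType_coe]
        constructor <;> intro hj <;> omega
      simp only [hiff]
      split_ifs with hab
      · have := hbal k hk (Y b) (seqExt ε) (isGridSeq_gridExp b) (hab ▸ isGridSeq_gridExp a)
          fun j hj => by simp [seqExt, not_lt.mpr hj]
        rw [← hab, ← seqExt_neg] at this
        exact this
      · simp
    · by_cases hab : a = b
      · simp [hab]
      · simp [hab, Ne.symm hab]
  · intro n
    obtain ⟨C, hC⟩ := h.grPolyNormalized_supportZ n
    set Q : DualGrid m → ℂ := fun a => grPolyNormalized q α n (supportZ q α (Grid.toInt a)) with hQ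
    funext a
    have key := hd.chainOperator_support (isGridSeq_gridExp a) hk (seqExt n)
      (fun ε => ∑ b, if Y b = (fun j => Y a j + ε j) then Q b else 0) C ?_
    · rw [← hC] at key
      have e1 : (Matrix.mulVec (fun a b => (∑ ε : Fin k → SignType,
          if Y b = (fun j => Y a j + seqExt ε j) then c a (seqExt ε) else 0) +
          if a = b then D a else 0) Q) a =
          chainOperator p k (1, A 0 + τ * A 0, A 0 * (τ * A 0)) A
            (supportVar p (α (N + 2)) A N (Y a))
            (fun ε => ∑ b, if Y b = (fun j => Y a j + ε j) then Q b else 0) +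
          D a * Q a := by
        simp only [Matrix.mulVec, dotProduct, add_mul, Finset.sum_add_distrib, chainOperator]
        congr 1
        · simp only [Finset.sum_mul, smul_eq_mul, Finset.mul_sum]
          rw [Finset.sum_comm]
          refine Finset.sum_congr rfl fun ε _ => Finset.sum_congr rfl fun b _ => ?_
          split_ifs <;> simp [hc]
        · simp
      rw [e1, key, hD, Pi.smul_apply, smul_eq_mul, psum_eq_sum_range]
      have hP : p ^ ∑ i ∈ range k, seqExt n i ≠ 0 := pow_ne_zero _ hp0
      change _ * pairing p _ (sitePair p (z a) SignType.zero) * Q a + _ = _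
      generalize p ^ ∑ i ∈ range k, seqExt n i = P at *
      simp only [pairing, scale, sitePair]
      generalize z a = x
      field_simp
      ring
    · intro ε hε
      obtain ⟨b, hb⟩ := IsGridSeq.exists_grid hε
      rw [Finset.sum_eq_single b]
      · rw [if_pos hb, hQ]
        simp only
        rw [hC, hb]
      · intro b' _ hb'
        rw [if_neg]
        intro hY'
        exact hb' (Grid.toInt_injective (gridExp_injective (hY'.trans hb.symm)))
      · simp

/-- The difference of the two sides is (pⁱ - pʲ)(c/p - p^{-i-j}), so i ≠ j would make c a power of
p. -/
lemma inv_add_mul_injective {p c : ℂ} (hp : IsGenericBase p) (hc : NotPow p c) {i j : ℕ}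
    (h : (p ^ i)⁻¹ + c / p * p ^ i = (p ^ j)⁻¹ + c / p * p ^ j) : i = j := by
  have hp0 := hp.ne_zero
  by_contra hij
  have hi := pow_ne_zero i hp0
  have hj := pow_ne_zero j hp0
  have hne : p ^ i - p ^ j ≠ 0 := by
    rw [sub_ne_zero]
    intro h'
    exact hij (by exact_mod_cast hp.zpow_injective (i := i) (j := j) (by exact_mod_cast h'))
  apply hc (1 - i - j)
  rw [zpow_sub₀ hp0, zpow_sub₀ hp0, zpow_one, zpow_natCast, zpow_natCast, div_div,
    eq_div_iff (mul_ne_zero hi hj)]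
  apply mul_left_cancel₀ hne
  field_simp at h
  linear_combination h

/-- Eigenvectors of a family of endomorphisms that are separated by the eigenvalues are linearly
independent. -/
lemma linearIndependent_of_separating {ι κ V : Type*} [AddCommGroup V] [Module ℂ V]
    (T : κ → Module.End ℂ V) (e : κ → ι → ℂ) (v : ι → V) (hv : ∀ i, v i ≠ 0)
    (hT : ∀ k i, T k (v i) = e k i • v i) (hsep : ∀ i j, i ≠ j → ∃ k, e k i ≠ e k j) :
    LinearIndependent ℂ v := by
  classical
  rw [linearIndependent_iff']
  intro s
  induction s using Finset.induction with
  | empty => simp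
  | insert i s his ih =>
    intro g hg
    rw [Finset.sum_insert his] at hg
    -- For given j an operator separating i from j is chosen; T k - e k i removes v i and multiplies
    -- the coefficient of v j by a nonzero number.
    have hs : ∀ j ∈ s, g j = 0 := by
      intro j hj
      obtain ⟨k, hk⟩ := hsep i j (fun hij => his (hij ▸ hj))
      have h1 := congrArg (T k - e k i • (1 : Module.End ℂ V)) hg
      have := ih (fun j => g j * (e k j - e k i)) ?_ j hj
      · exact (mul_eq_zero.mp this).resolve_right (sub_ne_zero.mpr (Ne.symm hk))
      · rw [map_zero, map_add, map_sum] at h1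
        rw [← h1]
        have h0 : ∀ x, (T k - e k i • (1 : Module.End ℂ V)) (g x • v x) = (g x * (e k x - e k i)) • v x := by
          intro x
          simp only [LinearMap.sub_apply, map_smul, hT, LinearMap.smul_apply, Module.End.one_apply]
          module
        rw [h0, sub_self, mul_zero, zero_smul, zero_add]
        exact Finset.sum_congr rfl fun x _ => (h0 x).symm
    rw [Finset.sum_eq_zero (fun j hj => by rw [hs j hj, zero_smul]), add_zero] at hg
    intro j hj
    rcases Finset.mem_insert.mp hj with rfl | hj
    · exact (smul_eq_zero.mp hg).resolve_right (hv _)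
    · exact hs j hj

lemma sum_mul_eq_zero_of_symmetric {I : Type*} [Fintype I] {K : I → ℂ} {M : Matrix I I ℂ}
    (hM : ∀ a b, K a * M a b = K b * M b a) {f g : I → ℂ} {x y : ℂ} (hf : M.mulVec f = x • f)
    (hg : M.mulVec g = y • g) (hxy : x ≠ y) : ∑ a, K a * f a * g a = 0 := by
  have h1 : x * ∑ a, K a * f a * g a = ∑ a, ∑ b, K a * M a b * f b * g a := by
    rw [Finset.mul_sum]
    refine Finset.sum_congr rfl fun a _ => ?_
    have := congrFun hf a
    rw [Pi.smul_apply, smul_eq_mul, Matrix.mulVec, dotProduct] at this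
    rw [show x * (K a * f a * g a) = K a * (x * f a) * g a by ring, ← this, Finset.mul_sum,
      Finset.sum_mul]
    exact Finset.sum_congr rfl fun b _ => by ring
  have h2 : y * ∑ a, K a * f a * g a = ∑ a, ∑ b, K a * M a b * f a * g b := by
    rw [Finset.mul_sum]
    refine Finset.sum_congr rfl fun a _ => ?_
    have := congrFun hg a
    rw [Pi.smul_apply, smul_eq_mul, Matrix.mulVec, dotProduct] at this
    rw [show y * (K a * f a * g a) = K a * f a * (y * g a) by ring, ← this, Finset.mul_sum]
    exact Finset.sum_congr rfl fun b _ => by ring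
  have h3 : x * ∑ a, K a * f a * g a = y * ∑ a, K a * f a * g a := by
    rw [h1, h2, Finset.sum_comm]
    refine Finset.sum_congr rfl fun a _ => Finset.sum_congr rfl fun b _ => ?_
    rw [hM b a]
  by_contra hne
  exact hxy (mul_right_cancel₀ hne h3)

namespace Admissible

variable {N : ℕ} {q : ℂ} {α : ℕ → ℂ} {m : Fin N → ℕ} (h : Admissible q α m)
include h

/-- The k-th eigenvalue determines n₁ + ⋯ + n_k, and these partial sums determine n. -/
lemma exists_separating {n n' : Grid m} (hn : n ≠ n') : ∃ k ≤ N,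
    ((q ^ 2) ^ psum n.toNat k)⁻¹ +
        (α 0 ^ 2)⁻¹ * paramSeq N α k ^ 2 / q ^ 2 * (q ^ 2) ^ psum n.toNat k ≠
      ((q ^ 2) ^ psum n'.toNat k)⁻¹ +
        (α 0 ^ 2)⁻¹ * paramSeq N α k ^ 2 / q ^ 2 * (q ^ 2) ^ psum n'.toNat k := by
  have hd := h.isSupportData
  by_contra! hall
  have key : ∀ k ≤ N, psum n.toNat k = psum n'.toNat k := fun k hk =>
    inv_add_mul_injective hd.base (hd.notPow_ab hk) (hall k hk)
  apply hn
  funext i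
  have h1 := key i i.isLt.le
  have h2 := key (i + 1) i.isLt
  rw [psum_eq_sum_range, psum_eq_sum_range] at h1 h2
  rw [Finset.sum_range_succ, Finset.sum_range_succ, h1] at h2
  have := Nat.add_left_cancel h2
  simp only [seqExt, i.isLt, dif_pos] at this
  exact Fin.ext this

/-- The discretized polynomials do not vanish at the origin. -/
lemma discretizedPoly_zero_ne_zero (n : Grid m) : discretizedPoly q α n (fun _ => 0) ≠ 0 := by
  have hd := h.isSupportData
  have bc := hd.bc
  rw [paramSeq_of_le α le_rfl] at bc
  have hl := latticeFactor_ne_zero hd.base.ne_zero h.generic_ac bc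
  have := h.grPolyNormalized_eq_closedForm n.toNat (fun _ => 0) n.toNat_le (fun _ => Nat.zero_le _)
  have e : discretizedPoly q α n (fun _ => 0) =
      grPolyNormalized q α n.toNat (supportZ q α fun _ : Fin N => ((0 : ℕ) : ℤ)) := rfl
  rw [e, this, closedForm]
  refine mul_ne_zero (div_ne_zero (Finset.prod_ne_zero_iff.mpr fun _ _ => hl _ _) (hl _ _))
    (Finset.prod_ne_zero_iff.mpr fun i _ => mul_ne_zero (inv_ne_zero (hl _ _)) ?_)
  -- At ñ = 0 each series reduces to its first term 1, so only nonzero lattice factors remain.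
  have h0 : seqExt (fun _ : Fin N => 0) (N - (i + 1)) = 0 := by simp [seqExt]
  rw [h0, gridSeries_zero_right]
  exact one_ne_zero

/-- The discretized polynomials are linearly independent and orthogonal. -/
theorem exists_weight : LinearIndependent ℂ (discretizedPoly q α : Grid m → DualGrid m → ℂ) ∧
    ∃ K : DualGrid m → ℂ, (∀ a, K a ≠ 0) ∧ ∀ n n' : Grid m, n ≠ n' →
      ∑ a, K a * discretizedPoly q α n a * discretizedPoly q α n' a = 0 := by
  obtain ⟨K, hK, hM⟩ := h.exists_symmetric_matrices
  choose! M hsymm hM using hM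
  refine ⟨?_, K, hK, fun n n' hn => ?_⟩
  · have hM' : ∀ (k : Fin (N + 1)) (n : Grid m), (M k).mulVecLin (discretizedPoly q α n) =
        (((q ^ 2) ^ psum n.toNat k)⁻¹ +
          (α 0 ^ 2)⁻¹ * paramSeq N α k ^ 2 / q ^ 2 * (q ^ 2) ^ psum n.toNat k) •
          discretizedPoly q α n :=
      fun k n => hM k (Nat.lt_succ_iff.mp k.isLt) n.toNat
    refine linearIndependent_of_separating _ _ _
      (fun n hn => h.discretizedPoly_zero_ne_zero n (congrFun hn _)) hM' fun n n' hn => ?_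
    obtain ⟨k, hk, hne⟩ := h.exists_separating hn
    exact ⟨⟨k, Nat.lt_succ_iff.mpr hk⟩, hne⟩
  · obtain ⟨k, hk, hne⟩ := h.exists_separating hn
    have e1 := hM k hk n.toNat
    have e2 := hM k hk n'.toNat
    exact sum_mul_eq_zero_of_symmetric (hsymm k hk) e1 e2 hne

end Admissible

/-! ### Bases of eigenvectors with a tridiagonal action -/

/-- `A` is diagonal in the basis `b` with eigenvalues `θ (deg i)`, and `B` changes `deg` by at most
one. -/
structure IsTridiagonalAction {I V : Type*} [AddCommGroup V] [Module ℂ V] (b : Module.Basis I ℂ V)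
    (deg : I → ℕ) (θ : ℕ → ℂ) (A B : Module.End ℂ V) : Prop where
  eigen : ∀ i, A (b i) = θ (deg i) • b i
  step : ∀ (i : I) (S : Submodule ℂ V),
    (∀ j, deg j ≤ deg i + 1 → deg i ≤ deg j + 1 → b j ∈ S) → B (b i) ∈ S

namespace IsTridiagonalAction

variable {I V : Type*} [AddCommGroup V] [Module ℂ V] {b : Module.Basis I ℂ V}
  {deg : I → ℕ} {θ : ℕ → ℂ} {A B : Module.End ℂ V}

lemma mem_eigenspace (h : IsTridiagonalAction b deg θ A B) (i : I) :
    b i ∈ A.eigenspace (θ (deg i)) := Module.End.mem_eigenspace_iff.mpr (h.eigen i)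

lemma isDiagonalizable (h : IsTridiagonalAction b deg θ A B) : IsDiagonalizable A := by
  rw [IsDiagonalizable, eq_top_iff, ← b.span_eq, Submodule.span_le]
  rintro _ ⟨i, rfl⟩
  exact Submodule.mem_iSup_of_mem _ (h.mem_eigenspace i)

lemma eq_of_repr_ne_zero (h : IsTridiagonalAction b deg θ A B) {x : ℂ} {u : V} (hu : A u = x • u)
    {i : I} (hi : b.repr u i ≠ 0) : θ (deg i) = x := by
  have h1 : b.coord i ∘ₗ A = θ (deg i) • b.coord i := by
    refine b.ext fun j => ?_
    simp only [LinearMap.comp_apply, h.eigen, map_smul, LinearMap.smul_apply, Module.Basis.coord_apply,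
      Module.Basis.repr_self, smul_eq_mul]
    by_cases hij : j = i
    · rw [hij]
    · rw [Finsupp.single_eq_of_ne (Ne.symm hij), mul_zero, mul_zero]
  have h2 := LinearMap.congr_fun h1 u
  simp only [LinearMap.comp_apply, hu, map_smul, LinearMap.smul_apply, Module.Basis.coord_apply,
    smul_eq_mul] at h2
  exact (mul_right_cancel₀ hi h2).symm

lemma hasEigenvalue_iff (h : IsTridiagonalAction b deg θ A B) (x : ℂ) :
    A.HasEigenvalue x ↔ ∃ i, θ (deg i) = x := by
  constructor
  · intro hx
    obtain ⟨u, hu⟩ := hx.exists_hasEigenvector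
    have : b.repr u ≠ 0 := by simpa using hu.2
    obtain ⟨i, hi⟩ := Finsupp.ne_iff.mp this
    exact ⟨i, h.eq_of_repr_ne_zero hu.apply_eq_smul hi⟩
  · rintro ⟨i, rfl⟩
    exact Module.End.hasEigenvalue_of_hasEigenvector ⟨h.mem_eigenspace i, b.ne_zero i⟩

lemma isStandardOrdering [Fintype I] (h : IsTridiagonalAction b deg θ A B) {d : ℕ} (hdeg : ∀ i, deg i ≤ d)
    (hsurj : ∀ p ≤ d, ∃ i, deg i = p) (hθ : Function.Injective θ) :
    IsStandardOrdering A B d fun p => θ p where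
  injective p p' hp := Fin.ext (hθ hp)
  hasEigenvalue_iff μ := by
    rw [h.hasEigenvalue_iff]
    constructor
    · rintro ⟨i, rfl⟩
      exact ⟨⟨deg i, Nat.lt_succ_iff.mpr (hdeg i)⟩, rfl⟩
    · rintro ⟨p, rfl⟩
      obtain ⟨i, hi⟩ := hsurj p (Nat.lt_succ_iff.mp p.isLt)
      exact ⟨i, by rw [hi]⟩
  tridiagonal p := by
    rintro _ ⟨u, hu, rfl⟩
    rw [← b.sum_repr u, map_sum]
    refine Submodule.sum_mem _ fun i _ => ?_
    rw [map_smul]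
    by_cases hi : b.repr u i = 0
    · rw [hi, zero_smul]
      exact Submodule.zero_mem _
    have hpi : deg i = p := hθ (h.eq_of_repr_ne_zero (Module.End.mem_eigenspace_iff.mp hu) hi)
    refine Submodule.smul_mem _ _ (h.step i _ fun j h1 h2 => ?_)
    exact Submodule.mem_iSup_of_mem
      (⟨⟨deg j, Nat.lt_succ_iff.mpr (hdeg j)⟩, by simp only; omega⟩ :
        {r : Fin (d + 1) // r.val ≤ p.val + 1 ∧ p.val ≤ r.val + 1}) (h.mem_eigenspace j)

/-- On b i with eigenvalue x, the difference of the two sides is (A - x)(A² - (q² + q⁻²)xA + x² -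
ρ)B (b i). As B (b i) lies in the span of the b j of equal or adjacent degree, it suffices that the
cubic vanishes at their eigenvalues. -/
lemma qOnsager_relation (h : IsTridiagonalAction b deg θ A B) {q ρ : ℂ} (hq : q ≠ 0)
    (hθ : ∀ p p' : ℕ, p' ≤ p + 1 → p ≤ p' + 1 → (θ p' - θ p) *
      (θ p' ^ 2 - (q ^ 2 + (q ^ 2)⁻¹) * (θ p * θ p') + θ p ^ 2 - ρ) = 0) :
    ⁅A, qComm q⁻¹ A (qComm q A B)⁆ = ρ • ⁅A, B⁆ := by
  refine b.ext fun i => ?_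
  let x := θ (deg i)
  let R : Module.End ℂ V := (A - x • 1) * (A * A - ((q ^ 2 + (q ^ 2)⁻¹) * x) • A + (x ^ 2 - ρ) • 1)
  have hR : B (b i) ∈ LinearMap.ker R := by
    refine h.step i _ fun j h1 h2 => ?_
    rw [LinearMap.mem_ker]
    have := hθ _ _ h1 h2
    simp only [R, Module.End.mul_apply, LinearMap.sub_apply, LinearMap.add_apply,
      LinearMap.smul_apply, Module.End.one_apply, map_add, map_sub, map_smul, h.eigen]
    have e : ((θ (deg j) - x) *
      (θ (deg j) ^ 2 - (q ^ 2 + (q ^ 2)⁻¹) * (x * θ (deg j)) + x ^ 2 - ρ)) • b j = 0 := by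
      rw [this, zero_smul]
    rw [← e]
    module
  rw [LinearMap.mem_ker] at hR
  simp only [R, Module.End.mul_apply, LinearMap.sub_apply, LinearMap.add_apply,
      LinearMap.smul_apply, Module.End.one_apply, map_add, map_sub, map_smul] at hR
  simp only [Ring.lie_def, qComm, Module.End.mul_apply, LinearMap.sub_apply,
    LinearMap.smul_apply, map_sub, map_smul, h.eigen, inv_inv]
  rw [← sub_eq_zero, ← hR]
  match_scalars <;> field_simp <;> ring

end IsTridiagonalAction

/-! ### Orthogonal bases -/

/-- An invertible square matrix with orthogonal rows has orthogonal columns after rescaling; the new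
weight consists of the inverse squares of the rows. -/
lemma exists_dual_weight {I J : Type*} [Fintype I] [Fintype J] [DecidableEq I] [DecidableEq J]
    (hcard : Fintype.card I = Fintype.card J) {Q : I → J → ℂ} (hQ : LinearIndependent ℂ Q)
    {K : J → ℂ} (hK : ∀ j, K j ≠ 0) (horth : ∀ i i', i ≠ i' → ∑ j, K j * Q i j * Q i' j = 0) :
    ∃ H : I → ℂ, (∀ i, H i ≠ 0) ∧
      ∀ j j', ∑ i, (H i)⁻¹ * Q i j * Q i j' = if j = j' then (K j)⁻¹ else 0 := by
  have hH : ∀ i, ∑ j, K j * Q i j * Q i j ≠ 0 := by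
    -- A row orthogonal to itself would be orthogonal to all rows. These span, and K has no zeros,
    -- so the row would vanish.
    intro i hi
    let L : (J → ℂ) →ₗ[ℂ] ℂ := ∑ j, (K j * Q i j) • LinearMap.proj j
    have hL : ∀ f, L f = ∑ j, K j * Q i j * f j := fun f => by simp [L]
    have htop : Submodule.span ℂ (Set.range Q) = ⊤ :=
      hQ.span_eq_top_of_card_eq_finrank' (by simp [hcard])
    have hker : LinearMap.ker L = ⊤ := by
      rw [eq_top_iff, ← htop, Submodule.span_le]
      rintro _ ⟨i', rfl⟩
      change L (Q i') = 0
      rw [hL]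
      by_cases h : i = i'
      · rw [← h, hi]
      · exact horth i i' h
    apply hQ.ne_zero i
    funext j
    have : L (Pi.single j 1) = 0 := by
      rw [← LinearMap.mem_ker, hker]
      trivial
    rw [hL] at this
    simpa [Pi.single_apply, hK j] using this
  refine ⟨fun i => ∑ j, K j * Q i j * Q i j, hH, fun j j' => ?_⟩
  set H : I → ℂ := fun i => ∑ j, K j * Q i j * Q i j with hHdef
  have h1 : Matrix.of (fun i j => K j * Q i j) * Matrix.of (fun j i => Q i j * (H i)⁻¹) =
      (1 : Matrix I I ℂ) := by
    ext i i'
    rw [Matrix.mul_apply, Matrix.one_apply]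
    simp only [Matrix.of_apply, ← mul_assoc, ← Finset.sum_mul]
    split_ifs with h
    · rw [← h]
      exact mul_inv_cancel₀ (hH i)
    · rw [horth i i' h, zero_mul]
  -- A right inverse of a square matrix is a left inverse: row orthogonality becomes column
  -- orthogonality.
  have h2 := (Matrix.mul_eq_one_comm_of_equiv (Fintype.equivOfCardEq hcard)).mp h1
  have h3 := congrFun (congrFun h2 j) j'
  rw [Matrix.mul_apply, Matrix.one_apply] at h3
  simp only [Matrix.of_apply] at h3
  have h4 : K j' * ∑ i, (H i)⁻¹ * Q i j * Q i j' = if j = j' then 1 else 0 := by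
    rw [← h3, Finset.mul_sum]
    exact Finset.sum_congr rfl fun i _ => by ring
  apply mul_left_cancel₀ (hK j')
  rw [h4]
  split_ifs with h
  · rw [h, mul_inv_cancel₀ (hK j')]
  · rw [mul_zero]

/-! ### The difference operators on grid bases -/

lemma extendByZero_toInt {N : ℕ} {m : Fin N → ℕ} {V : Type*} [Zero V] (f : Grid m → V)
    (n : Grid m) : extendByZero f n.toInt = f n := Grid.toInt_injective.extend_apply f 0 n

lemma extendByZero_of_forall_ne {N : ℕ} {m : Fin N → ℕ} {V : Type*} [Zero V] (f : Grid m → V)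
    {x : Fin N → ℤ} (hx : ∀ n : Grid m, n.toInt ≠ x) : extendByZero f x = 0 := by
  rw [extendByZero, Function.extend_apply' _ _ _ fun ⟨n, hn⟩ => hx n hn]
  rfl

lemma map_extendByZero {N : ℕ} {m : Fin N → ℕ} {V V' : Type*} [AddCommGroup V] [Module ℂ V]
    [AddCommGroup V'] [Module ℂ V'] (L : V →ₗ[ℂ] V') (f : Grid m → V) (x : Fin N → ℤ) :
    L (extendByZero f x) = extendByZero (fun n => L (f n)) x := by
  by_cases hx : ∃ n : Grid m, n.toInt = x
  · obtain ⟨n, rfl⟩ := hx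
    rw [extendByZero_toInt, extendByZero_toInt]
  · push Not at hx
    rw [extendByZero_of_forall_ne _ hx, extendByZero_of_forall_ne _ hx, map_zero]

lemma indexShift_zero {N : ℕ} : indexShift (0 : Fin N → ℤ) = 0 := by
  funext i
  simp [indexShift]

lemma psum_add {N : ℕ} (x y : Fin N → ℤ) (k : ℕ) : psum (x + y) k = psum x k + psum y k := by
  simp [psum, Finset.sum_add_distrib]

lemma signType_bounds (e : SignType) : -1 ≤ (e : ℤ) ∧ (e : ℤ) ≤ 1 := by cases e <;> decide

namespace Grid

variable {N : ℕ} {m : Fin N → ℕ}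

lemma psum_toNat (n : Grid m) : psum n.toNat N = ∑ i, n.toNat i := by
  simp [psum]

lemma psum_toNat_le (n : Grid m) : psum n.toNat N ≤ ∑ i, m i := by
  rw [psum_toNat]
  exact Finset.sum_le_sum fun i _ => n.toNat_le i

lemma exists_psum_eq {p : ℕ} (hp : p ≤ ∑ i, m i) : ∃ n : Grid m, psum n.toNat N = p := by
  suffices h : ∃ v : Fin N → ℕ, (∀ i, v i ≤ m i) ∧ ∑ i, v i = p by
    obtain ⟨v, hv, hs⟩ := h
    exact ⟨fun i => ⟨v i, Nat.lt_succ_iff.mpr (hv i)⟩, by rw [psum_toNat, ← hs]; rfl⟩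
  induction p with
  | zero => exact ⟨0, by simp⟩
  | succ p ih =>
    obtain ⟨v, hv, hs⟩ := ih (by omega)
    obtain ⟨i, -, hi⟩ := Finset.exists_lt_of_sum_lt (s := Finset.univ) (f := v) (g := m) (by omega)
    refine ⟨v + Pi.single i 1, fun j => ?_, ?_⟩
    · by_cases hj : j = i
      · subst hj
        simpa using hi
      · simpa [hj] using hv j
    · simp [Finset.sum_add_distrib, hs]

end Grid

namespace Admissible

variable {N : ℕ} {q : ℂ} {α : ℕ → ℂ} {m : Fin N → ℕ} (h : Admissible q α m)
include h

lemma DStarNt_eq {V : Type*} [AddCommGroup V] [Module ℂ V] (f : (Fin N → ℤ) → V)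
    (nt : Fin N → ℤ) : DStarNt q α f nt = (α 0 * q / α (N + 1)) •
      (chainOperator (q ^ 2) N (1, paramSeq N α 0 + (α 0 ^ 2)⁻¹ * paramSeq N α 0,
          paramSeq N α 0 * ((α 0 ^ 2)⁻¹ * paramSeq N α 0)) (paramSeq N α)
          (supportVar (q ^ 2) (α (N + 2)) (paramSeq N α) N (gridExp nt))
        (fun ε => f (nt + indexShift fun i => (ε i : ℤ))) +
      (α (N + 1) / α 0 * (α 0 + (α 0)⁻¹) * (α (N + 2) + (α (N + 2))⁻¹) / (1 + q ^ 2)) • f nt) := by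
  have hd := h.isSupportData
  rw [DStarNt, operatorAt_eq_chainOperator hd.base α h.ne_zero _ _ (paramSeq N α)
      (supportVar (q ^ 2) (α (N + 2)) (paramSeq N α) N (gridExp nt)) h.paramSeq_ne_zero
      (fun j hj => paramSeq_of_le α hj) (fun i => (supportZ_eq q α nt i).symm) (h.supportVar_last nt)
      (hd.supportVar_ne_zero _) (fun j hj => hd.notPow_supportVar_sq _ hj.le), indexShift_zero,
      add_zero]

lemma map_DStarNt {V V' : Type*} [AddCommGroup V] [Module ℂ V] [AddCommGroup V'] [Module ℂ V']
    (L : V →ₗ[ℂ] V') (f : (Fin N → ℤ) → V) (nt : Fin N → ℤ) :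
    L (DStarNt q α f nt) = DStarNt q α (fun x => L (f x)) nt := by
  rw [h.DStarNt_eq, h.DStarNt_eq]
  simp only [map_smul, map_add, chainOperator, map_sum]

lemma map_Dn {V V' : Type*} [AddCommGroup V] [Module ℂ V] [AddCommGroup V'] [Module ℂ V']
    (L : V →ₗ[ℂ] V') (f : (Fin N → ℤ) → V) (n : Fin N → ℤ) :
    L (Dn q α f n) = Dn q α (fun x => L (f x)) n := by
  rw [h.Dn_eq, h.Dn_eq, h.dual.map_DStarNt]

lemma DStarNt_mem {V : Type*} [AddCommGroup V] [Module ℂ V] {f : (Fin N → ℤ) → V}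
    {nt : Fin N → ℤ} {S : Submodule ℂ V}
    (hS : ∀ x, psum x N ≤ psum nt N + 1 → psum nt N ≤ psum x N + 1 → f x ∈ S) :
    DStarNt q α f nt ∈ S := by
  rw [h.DStarNt_eq]
  refine Submodule.smul_mem _ _ (Submodule.add_mem _ (Submodule.sum_mem _ fun ε _ =>
    Submodule.smul_mem _ _ (hS _ ?_ ?_)) (Submodule.smul_mem _ _ (hS _ (by omega) (by omega)))) <;>
  -- The total degree changes only by the shift in z₁, which is -1, 0 or 1.
  · rw [psum_add, psum_indexShift _ le_rfl, Nat.sub_self]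
    have : 0 < N := h.pos
    simp only [seqExt, this, dif_pos]
    have := signType_bounds (ε ⟨0, this⟩)
    omega

lemma isTridiagonalAction {m' : Fin N → ℕ} {V : Type*} [AddCommGroup V] [Module ℂ V]
    {b : Module.Basis (Grid m') ℂ V} {A B : Module.End ℂ V}
    (hA : ∀ n, A (b n) = theta N q α (psum n.toInt N) • b n)
    (hB : ∀ n, B (b n) = (1 / 2 : ℂ) • DStarNt q α (extendByZero b) n.toInt) :
    IsTridiagonalAction b (fun n => psum n.toNat N) (fun p => theta N q α p) A B where
  eigen n := by rw [hA, n.psum_toInt]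
  step n S hS := by
    rw [hB]
    refine Submodule.smul_mem _ _ (h.DStarNt_mem fun x h1 h2 => ?_)
    by_cases hx : ∃ n' : Grid m', n'.toInt = x
    · obtain ⟨n', rfl⟩ := hx
      rw [extendByZero_toInt]
      rw [n.psum_toInt, n'.psum_toInt] at h1 h2
      exact hS n' (by omega) (by omega)
    · push Not at hx
      rw [extendByZero_of_forall_ne _ hx]
      exact S.zero_mem

/-- A coincidence makes (α_{N+1} α_{N+2}/α₁)² a power of q². Since (α_{N+1}/α₁)² is one, α_{N+2}²
would be one too, which `generic_z` excludes. -/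
lemma theta_injective : Function.Injective fun p : ℕ => theta N q α p := by
  intro i j hij
  have hq := h.q_ne_zero
  have hp := h.isGenericBase
  have hp0 := hp.ne_zero
  have h1 := h.ne_zero 1 (by omega)
  have hN := h.ne_zero (N + 1) (by omega)
  have hN2 := h.ne_zero (N + 2) (by omega)
  by_contra hne
  have hi := pow_ne_zero i hp0
  have hj := pow_ne_zero j hp0
  have hsub : (q ^ 2) ^ i - (q ^ 2) ^ j ≠ 0 := by
    rw [sub_ne_zero]
    intro h'
    exact hne (by exact_mod_cast hp.zpow_injective (i := i) (j := j) (by exact_mod_cast h'))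
  have e : ∀ p : ℕ, q ^ (2 * (p : ℤ)) = (q ^ 2) ^ p := fun p => by
    rw [zpow_mul, zpow_natCast]; norm_cast
  simp only [theta, neg_mul, zpow_neg, e] at hij
  obtain ⟨k, hk⟩ := h.exists_last_sq_eq
  have hkne := zpow_ne_zero k hp0
  apply h.generic_z (-k - i - j)
  rw [zpow_sub₀ hp0, zpow_sub₀ hp0, zpow_natCast, zpow_natCast, zpow_neg]
  have key : (α (N + 1) * α (N + 2)) ^ 2 * ((q ^ 2) ^ i * (q ^ 2) ^ j) = α 1 ^ 2 := by
    apply mul_left_cancel₀ hsub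
    field_simp at hij
    linear_combination hij
  rw [mul_pow, hk] at key
  field_simp
  apply mul_left_cancel₀ (pow_ne_zero 2 h1)
  linear_combination key

/-- Here θ_p = (x + x⁻¹)/2, where x is multiplied by q² from p to p + 1. Any two such consecutive
values satisfy the quadratic relation, and ρ is its constant term. -/
lemma theta_relation (p p' : ℕ) (h1 : p' ≤ p + 1) (h2 : p ≤ p' + 1) :
    (theta N q α p' - theta N q α p) * (theta N q α p' ^ 2 -
      (q ^ 2 + (q ^ 2)⁻¹) * (theta N q α p * theta N q α p') + theta N q α p ^ 2 -
        -(q ^ 2 - q ^ (-2 : ℤ)) ^ 2 / 4) = 0 := by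
  have hq := h.q_ne_zero
  have hp0 := h.isGenericBase.ne_zero
  have h1' := h.ne_zero 1 (by omega)
  have hN := h.ne_zero (N + 1) (by omega)
  have hN2 := h.ne_zero (N + 2) (by omega)
  have key : ∀ p : ℕ, theta N q α (p + 1 : ℕ) ^ 2 -
      (q ^ 2 + (q ^ 2)⁻¹) * (theta N q α p * theta N q α (p + 1 : ℕ)) + theta N q α p ^ 2 -
        -(q ^ 2 - q ^ (-2 : ℤ)) ^ 2 / 4 = 0 := by
    intro p
    have e : ∀ p : ℕ, q ^ (2 * (p : ℤ)) = (q ^ 2) ^ p := fun p => by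
      rw [zpow_mul, zpow_natCast]; norm_cast
    have e2 : q ^ (-2 : ℤ) = (q ^ 2)⁻¹ := by rw [zpow_neg]; norm_cast
    have hpp := pow_ne_zero p hp0
    simp only [theta, neg_mul, zpow_neg, e, e2, pow_succ (q ^ 2) p]
    generalize (q ^ 2) ^ p = P at *
    field_simp
    ring
  obtain rfl | rfl | rfl : p' = p ∨ p' = p + 1 ∨ p = p' + 1 := by omega
  · rw [sub_self, zero_mul]
  · rw [key, mul_zero]
  · have := key p'
    rw [mul_eq_zero]
    right
    linear_combination this

lemma actsOnDualBasis_isTridiagonalAction {V : Type*} [AddCommGroup V] [Module ℂ V] {W₀ W₁ : Module.End ℂ V}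
    {φ : Module.Basis (DualGrid m) ℂ V} (hφ : ActsOnDualBasis q α W₀ W₁ φ) :
    IsTridiagonalAction φ (fun n => psum (Grid.toNat n) N) (fun p => theta N q α p) W₀ W₁ :=
  h.isTridiagonalAction (fun n => (hφ n).1) fun n => (hφ n).2

lemma actsOnBasis_isTridiagonalAction {V : Type*} [AddCommGroup V] [Module ℂ V]
    {W₀ W₁ : Module.End ℂ V} {ψ : Module.Basis (Grid m) ℂ V} (hψ : ActsOnBasis q α W₀ W₁ ψ) :
    IsTridiagonalAction ψ (fun n => psum n.toNat N) (fun p => thetaStar N q α p) W₁ W₀ := by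
  have := h.dual.isTridiagonalAction (b := ψ) (A := W₁) (B := W₀)
    (fun n => by rw [h.theta_dualParam]; exact (hψ n).2)
    fun n => by rw [← h.Dn_eq]; exact (hψ n).1
  simpa only [h.theta_dualParam] using this

end Admissible

/-! ### Representations of the `q`-Onsager algebra -/

lemma map_qComm {R S : Type*} [Ring R] [Algebra ℂ R] [Ring S] [Algebra ℂ S] (f : R →ₐ[ℂ] S) (q : ℂ)
    (x y : R) : f (qComm q x y) = qComm q (f x) (f y) := by
  simp [qComm]

lemma exists_qOnsager_rep {V : Type*} [AddCommGroup V] [Module ℂ V] {q ρ : ℂ}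
    {W : Fin 2 → Module.End ℂ V}
    (hW : ∀ i j, i ≠ j → ⁅W i, qComm q⁻¹ (W i) (qComm q (W i) (W j))⁆ = ρ • ⁅W i, W j⁆) :
    ∃ π : QOnsager q ρ →ₐ[ℂ] Module.End ℂ V, ∀ i, π (QOnsager.W q ρ i) = W i := by
  have hrel : ∀ ⦃x y⦄, OnsagerRel q ρ x y → FreeAlgebra.lift ℂ W x = FreeAlgebra.lift ℂ W y := by
    rintro _ _ ⟨i, j, hij⟩
    simp only [Ring.lie_def, map_sub, map_mul, map_qComm, map_smul, FreeAlgebra.lift_ι_apply]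
    exact hW i j hij
  refine ⟨RingQuot.liftAlgHom ℂ ⟨FreeAlgebra.lift ℂ W, hrel⟩, fun i => ?_⟩
  exact (RingQuot.liftAlgHom_mkAlgHom_apply ℂ _ hrel _).trans (FreeAlgebra.lift_ι_apply _ _)

lemma mem_of_generators_mem {V : Type*} [AddCommGroup V] [Module ℂ V] {q ρ : ℂ}
    (π : QOnsager q ρ →ₐ[ℂ] Module.End ℂ V) {S : Submodule ℂ V}
    (hS : ∀ i, ∀ u ∈ S, π (QOnsager.W q ρ i) u ∈ S) (a : QOnsager q ρ) : ∀ u ∈ S, π a u ∈ S := by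
  obtain ⟨x, rfl⟩ := RingQuot.mkAlgHom_surjective ℂ (OnsagerRel q ρ) a
  induction x using FreeAlgebra.induction with
  | grade0 r =>
    intro u hu
    have : π (RingQuot.mkAlgHom ℂ (OnsagerRel q ρ) (algebraMap ℂ _ r)) = algebraMap ℂ _ r :=
      (π.comp (RingQuot.mkAlgHom ℂ (OnsagerRel q ρ))).commutes r
    rw [this, Module.algebraMap_end_apply]
    exact S.smul_mem r hu
  | grade1 i => exact hS i
  | mul x y hx hy =>
    intro u hu
    have : π (RingQuot.mkAlgHom ℂ (OnsagerRel q ρ) (x * y)) =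
        π (RingQuot.mkAlgHom ℂ (OnsagerRel q ρ) x) * π (RingQuot.mkAlgHom ℂ (OnsagerRel q ρ) y) :=
      map_mul (π.comp (RingQuot.mkAlgHom ℂ (OnsagerRel q ρ))) x y
    rw [this]
    exact hx _ (hy _ hu)
  | add x y hx hy =>
    intro u hu
    have : π (RingQuot.mkAlgHom ℂ (OnsagerRel q ρ) (x + y)) =
        π (RingQuot.mkAlgHom ℂ (OnsagerRel q ρ) x) + π (RingQuot.mkAlgHom ℂ (OnsagerRel q ρ) y) :=
      map_add (π.comp (RingQuot.mkAlgHom ℂ (OnsagerRel q ρ))) x y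
    rw [this]
    exact S.add_mem (hx _ hu) (hy _ hu)

/-! ### Bilinear forms -/

lemma bilinForm_symm_of_diagonal {I U : Type*} [AddCommGroup U] [Module ℂ U]
    {B : LinearMap.BilinForm ℂ U} {b : Module.Basis I ℂ U}
    (horth : ∀ i i', i ≠ i' → B (b i) (b i') = 0) {W : Module.End ℂ U} {μ : I → ℂ}
    (hW : ∀ i, W (b i) = μ i • b i) (u v : U) : B (W u) v = B u (W v) := by
  have : B.comp W LinearMap.id = B.comp LinearMap.id W := by
    refine LinearMap.BilinForm.ext_basis b fun i j => ?_
    simp only [LinearMap.BilinForm.comp_apply, LinearMap.id_apply, hW, map_smul,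
      LinearMap.smul_apply, smul_eq_mul]
    by_cases hij : i = j
    · rw [hij]
    · rw [horth i j hij, mul_zero, mul_zero]
  exact LinearMap.BilinForm.congr_fun this u v

lemma eq_of_bilinForm_basis_eq {I U : Type*} [AddCommGroup U] [Module ℂ U]
    {B : LinearMap.BilinForm ℂ U} (hB : B.Nondegenerate) (b : Module.Basis I ℂ U) {u v : U}
    (h : ∀ i, B (b i) u = B (b i) v) : u = v := by
  rw [← sub_eq_zero]
  refine hB.2 _ fun x => ?_
  have : B.flip (u - v) = 0 := by
    refine b.ext fun i => ?_
    rw [LinearMap.BilinForm.flip_apply, map_sub, h, sub_self, LinearMap.zero_apply]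
  exact LinearMap.congr_fun this x

/-- A form for which a basis is orthogonal with nonzero squares is nondegenerate. -/
lemma bilinForm_nondegenerate_of_basis {I U : Type*} [AddCommGroup U] [Module ℂ U]
    {B : LinearMap.BilinForm ℂ U} (hs : B.IsSymm) {b : Module.Basis I ℂ U}
    (horth : ∀ i i', i ≠ i' → B (b i) (b i') = 0) (hne : ∀ i, B (b i) (b i) ≠ 0) :
    B.Nondegenerate := by
  have key : ∀ u, (∀ v, B u v = 0) → u = 0 := by
    intro u hu
    apply b.repr.injective
    ext i
    have h1 : B.flip (b i) = B (b i) (b i) • b.coord i := by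
      refine b.ext fun j => ?_
      rw [LinearMap.BilinForm.flip_apply, LinearMap.smul_apply, Module.Basis.coord_apply,
        Module.Basis.repr_self, smul_eq_mul]
      by_cases hij : j = i
      · rw [hij, Finsupp.single_eq_same, mul_one]
      · rw [horth j i hij, Finsupp.single_eq_of_ne (Ne.symm hij), mul_zero]
    have h2 := LinearMap.congr_fun h1 u
    rw [LinearMap.BilinForm.flip_apply, hu, LinearMap.smul_apply, Module.Basis.coord_apply,
      smul_eq_mul] at h2
    simpa [hne i] using h2.symm
  exact ⟨key, fun v hv => key v fun u => by rw [hs.eq]; exact hv u⟩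

lemma card_grid_eq {N : ℕ} (m : Fin N → ℕ) : Fintype.card (Grid m) = Fintype.card (DualGrid m) := by
  simp only [Fintype.card_pi, Fintype.card_fin]
  exact (Equiv.prod_comp Fin.revPerm fun i => m i + 1).symm

namespace Admissible

variable {N : ℕ} {q : ℂ} {α : ℕ → ℂ} {m : Fin N → ℕ} (h : Admissible q α m)
include h

/-- Each generator is self-adjoint, being diagonal in an orthogonal basis. Paired with its
eigenbasis, its action on the other basis is the recurrence of the overlap coefficients; extension
by zero is one admissible choice outside the grid. -/
lemma acts_of_overlap {U : Type*} [AddCommGroup U] [Module ℂ U] {ψ : Module.Basis (Grid m) ℂ U}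
    {φ : Module.Basis (DualGrid m) ℂ U} (hP : AreOverlapCoefficients ψ φ (discretizedPoly q α))
    {W₀ W₁ : Module.End ℂ U}
    (h0 : ∀ nt, W₀ (φ nt) = theta N q α (psum (Grid.toInt nt) N) • φ nt)
    (h1 : ∀ n, W₁ (ψ n) = thetaStar N q α (psum n.toInt N) • ψ n) :
    ActsOnBasis q α W₀ W₁ ψ ∧ ActsOnDualBasis q α W₀ W₁ φ := by
  obtain ⟨B, hs, hnd, hψ, hφ, hQ⟩ := hP
  refine ⟨fun n => ⟨?_, h1 n⟩, fun nt => ⟨h0 nt, ?_⟩⟩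
  · refine eq_of_bilinForm_basis_eq hnd φ fun nt => ?_
    rw [← bilinForm_symm_of_diagonal hφ h0, h0, map_smul, LinearMap.smul_apply, hs.eq, hQ, map_smul,
      h.map_Dn, smul_eq_mul, smul_eq_mul,
      ← h.Dn_discretizedPoly nt (fun x => B (φ nt) (extendByZero ψ x)) (fun n => ?_) n]
    rw [extendByZero_toInt, hs.eq, hQ]
  · refine eq_of_bilinForm_basis_eq hnd ψ fun n => ?_
    rw [← bilinForm_symm_of_diagonal hψ h1, h1, map_smul, LinearMap.smul_apply, hQ, map_smul,
      h.map_DStarNt, smul_eq_mul, smul_eq_mul,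
      ← h.DStarNt_discretizedPoly n (fun x => B (ψ n) (extendByZero φ x)) (fun nt => ?_) nt]
    rw [extendByZero_toInt, hQ]

lemma qOnsager_relations {U : Type*} [AddCommGroup U] [Module ℂ U] {ψ : Module.Basis (Grid m) ℂ U}
    {φ : Module.Basis (DualGrid m) ℂ U} {W₀ W₁ : Module.End ℂ U}
    (hψ : ActsOnBasis q α W₀ W₁ ψ) (hφ : ActsOnDualBasis q α W₀ W₁ φ) (i j : Fin 2) (hij : i ≠ j) :
    ⁅![W₀, W₁] i, qComm q⁻¹ (![W₀, W₁] i) (qComm q (![W₀, W₁] i) (![W₀, W₁] j))⁆ =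
      (-(q ^ 2 - q ^ (-2 : ℤ)) ^ 2 / 4) • ⁅![W₀, W₁] i, ![W₀, W₁] j⁆ := by
  have r0 := (h.actsOnDualBasis_isTridiagonalAction hφ).qOnsager_relation h.q_ne_zero h.theta_relation
  have r1 := (h.actsOnBasis_isTridiagonalAction hψ).qOnsager_relation h.q_ne_zero
    fun p p' h1 h2 => by
      have := h.dual.theta_relation p p' h1 h2
      rwa [h.theta_dualParam, h.theta_dualParam] at this
  obtain ⟨rfl, rfl⟩ | ⟨rfl, rfl⟩ : i = 0 ∧ j = 1 ∨ i = 1 ∧ j = 0 := by omega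
  · exact r0
  · exact r1

/-- The module with two dual bases. -/
theorem exists_dual_bases : ∃ (ψ : Module.Basis (Grid m) ℂ (Grid m → ℂ))
    (φ : Module.Basis (DualGrid m) ℂ (Grid m → ℂ)),
    AreOverlapCoefficients ψ φ (discretizedPoly q α) := by
  classical
  obtain ⟨hlin, K, hK, horth⟩ := h.exists_weight
  obtain ⟨H, hH, hdual⟩ := exists_dual_weight (card_grid_eq m) hlin hK horth
  set Q := (discretizedPoly q α : Grid m → DualGrid m → ℂ) with hQ
  let ψ := Pi.basisFun ℂ (Grid m)
  let B : LinearMap.BilinForm ℂ (Grid m → ℂ) := Matrix.toBilin' (Matrix.diagonal H)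
  have hB : ∀ u v, B u v = ∑ n, H n * u n * v n := by
    intro u v
    simp only [B, Matrix.toBilin'_apply']
    simp only [dotProduct, Matrix.mulVec_diagonal]
    exact Finset.sum_congr rfl fun n _ => by ring
  -- As ψ n has square H n, the condition ⟨ψ n, φ ñ⟩ = Q n ñ forces these coordinates.
  let v : DualGrid m → Grid m → ℂ := fun nt n => (H n)⁻¹ * Q n nt
  have hBv : ∀ a b, B (v a) (v b) = if a = b then (K a)⁻¹ else 0 := by
    intro a b
    rw [hB, ← hdual a b]
    refine Finset.sum_congr rfl fun n _ => ?_
    have := hH n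
    simp only [v]
    field_simp
  have hv : LinearIndependent ℂ v := by
    rw [Fintype.linearIndependent_iff]
    intro g hg a
    have h1 : B (∑ b, g b • v b) (v a) = 0 := by rw [hg]; simp
    rw [map_sum, LinearMap.sum_apply] at h1
    simp only [map_smul, LinearMap.smul_apply, hBv, smul_eq_mul] at h1
    simpa [hK a] using h1
  have : Nonempty (DualGrid m) := ⟨fun _ => 0⟩
  let φ := basisOfLinearIndependentOfCardEqFinrank hv (by simp [card_grid_eq m])
  have hφ : ∀ a, φ a = v a := fun a => by simp [φ]
  have hψ : ∀ n n', B (ψ n) (ψ n') = if n = n' then H n else 0 := by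
    intro n n'
    rw [hB]
    simp only [ψ, Pi.basisFun_apply, Pi.single_apply]
    by_cases hn : n = n' <;> simp [hn, eq_comm]
  have hs : B.IsSymm := ⟨fun x y => by
    rw [hB, hB]
    exact Finset.sum_congr rfl fun n _ => by ring⟩
  refine ⟨ψ, φ, B, hs, bilinForm_nondegenerate_of_basis hs (b := ψ) (fun n n' hn => ?_) (fun n => ?_),
    fun n n' hn => ?_, fun a b hab => ?_, fun n a => ?_⟩
  · rw [hψ, if_neg hn]
  · rw [hψ, if_pos rfl]
    exact hH n
  · rw [hψ, if_neg hn]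
  · rw [hφ, hφ, hBv, if_neg hab]
  · rw [hφ, hB]
    simp only [ψ, Pi.basisFun_apply, Pi.single_apply, v]
    simp [hH n]

end Admissible

/-! ### Modules with two dual bases -/

/-- Schur's lemma for representations of the `q`-Onsager algebra. -/
lemma exists_eq_smul_of_commute {U : Type*} [AddCommGroup U] [Module ℂ U] [FiniteDimensional ℂ U]
    {q ρ : ℂ} {π : QOnsager q ρ →ₐ[ℂ] Module.End ℂ U} (hπ : IsIrreducibleRep π)
    {T : Module.End ℂ U} (hT : ∀ i u, T (π (QOnsager.W q ρ i) u) = π (QOnsager.W q ρ i) (T u)) :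
    ∃ c : ℂ, ∀ u, T u = c • u := by
  have := hπ.1
  obtain ⟨c, hc⟩ := Module.End.exists_eigenvalue T
  refine ⟨c, fun u => ?_⟩
  have hinv := mem_of_generators_mem π (S := T.eigenspace c) fun i u hu => by
    rw [Module.End.mem_eigenspace_iff] at hu ⊢
    rw [hT, hu, map_smul]
  rcases hπ.2 _ hinv with h | h
  · exact absurd h hc
  · rw [← Module.End.mem_eigenspace_iff, h]
    trivial

namespace Admissible

variable {N : ℕ} {q : ℂ} {α : ℕ → ℂ} {m : Fin N → ℕ} (h : Admissible q α m)
include h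

/-- The scalars in the action formulas depend only on the indices, so matching the basis vectors
intertwines two such modules. -/
lemma equiv_dualBasis_comm {U U' : Type*} [AddCommGroup U] [Module ℂ U] [AddCommGroup U']
    [Module ℂ U'] {φ : Module.Basis (DualGrid m) ℂ U} {φ' : Module.Basis (DualGrid m) ℂ U'}
    {W : Fin 2 → Module.End ℂ U} {W' : Fin 2 → Module.End ℂ U'}
    (hφ : ActsOnDualBasis q α (W 0) (W 1) φ) (hφ' : ActsOnDualBasis q α (W' 0) (W' 1) φ')
    (i : Fin 2) (u : U) :
    φ.equiv φ' (Equiv.refl _) (W i u) = W' i (φ.equiv φ' (Equiv.refl _) u) := by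
  set T := φ.equiv φ' (Equiv.refl _) with hT
  have hTφ : ∀ nt, T (φ nt) = φ' nt := fun nt => by rw [hT, φ.equiv_apply, Equiv.refl_apply]
  have : T.toLinearMap ∘ₗ W i = W' i ∘ₗ T.toLinearMap := by
    refine φ.ext fun nt => ?_
    rw [LinearMap.comp_apply, LinearMap.comp_apply, LinearEquiv.coe_coe, hTφ]
    obtain rfl | rfl : i = 0 ∨ i = 1 := by omega
    · rw [(hφ nt).1, (hφ' nt).1, map_smul, hTφ]
    · rw [(hφ nt).2, (hφ' nt).2, map_smul, ← LinearEquiv.coe_coe, h.map_DStarNt]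
      simp only [map_extendByZero, LinearEquiv.coe_coe, hTφ]
  exact LinearMap.congr_fun this u

lemma equiv_basis_comm {U U' : Type*} [AddCommGroup U] [Module ℂ U] [AddCommGroup U']
    [Module ℂ U'] {ψ : Module.Basis (Grid m) ℂ U} {ψ' : Module.Basis (Grid m) ℂ U'}
    {W : Fin 2 → Module.End ℂ U} {W' : Fin 2 → Module.End ℂ U'}
    (hψ : ActsOnBasis q α (W 0) (W 1) ψ) (hψ' : ActsOnBasis q α (W' 0) (W' 1) ψ')
    (i : Fin 2) (u : U) :
    ψ.equiv ψ' (Equiv.refl _) (W i u) = W' i (ψ.equiv ψ' (Equiv.refl _) u) := by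
  set T := ψ.equiv ψ' (Equiv.refl _) with hT
  have hTψ : ∀ n, T (ψ n) = ψ' n := fun n => by rw [hT, ψ.equiv_apply, Equiv.refl_apply]
  have : T.toLinearMap ∘ₗ W i = W' i ∘ₗ T.toLinearMap := by
    refine ψ.ext fun n => ?_
    rw [LinearMap.comp_apply, LinearMap.comp_apply, LinearEquiv.coe_coe, hTψ]
    obtain rfl | rfl : i = 0 ∨ i = 1 := by omega
    · rw [(hψ n).1, (hψ' n).1, map_smul, ← LinearEquiv.coe_coe, h.map_Dn]
      simp only [map_extendByZero, LinearEquiv.coe_coe, hTψ]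
    · rw [(hψ n).2, (hψ' n).2, map_smul, hTψ]
  exact LinearMap.congr_fun this u

/-- The module of the `q`-Onsager algebra with two dual bases whose overlap coefficients are the
discretized polynomials. -/
theorem exists_module :
    ∃ (π : QOnsager q (-(q ^ 2 - q ^ (-2 : ℤ)) ^ 2 / 4) →ₐ[ℂ] Module.End ℂ (Grid m → ℂ))
      (ψ : Module.Basis (Grid m) ℂ (Grid m → ℂ)) (φ : Module.Basis (DualGrid m) ℂ (Grid m → ℂ)),
      ActsOnBasis q α (π (QOnsager.W _ _ 0)) (π (QOnsager.W _ _ 1)) ψ ∧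
      ActsOnDualBasis q α (π (QOnsager.W _ _ 0)) (π (QOnsager.W _ _ 1)) φ ∧
      AreOverlapCoefficients ψ φ (discretizedPoly q α) := by
  obtain ⟨ψ, φ, hP⟩ := h.exists_dual_bases
  obtain ⟨hψ, hφ⟩ := h.acts_of_overlap hP
    (W₀ := φ.constr ℂ fun nt => theta N q α (psum (Grid.toInt nt) N) • φ nt)
    (W₁ := ψ.constr ℂ fun n => thetaStar N q α (psum n.toInt N) • ψ n)
    (fun nt => by rw [φ.constr_basis]) fun n => by rw [ψ.constr_basis]
  obtain ⟨π, hπ⟩ := exists_qOnsager_rep (h.qOnsager_relations hψ hφ)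
  refine ⟨π, ψ, φ, ?_, ?_, hP⟩
  · rw [hπ, hπ]
    exact hψ
  · rw [hπ, hπ]
    exact hφ

/-- The overlap coefficients of the two dual bases of an irreducible module. -/
theorem areOverlapCoefficients {U : Type*} [AddCommGroup U] [Module ℂ U]
    {π : QOnsager q (-(q ^ 2 - q ^ (-2 : ℤ)) ^ 2 / 4) →ₐ[ℂ] Module.End ℂ U}
    {ψ : Module.Basis (Grid m) ℂ U} {φ : Module.Basis (DualGrid m) ℂ U}
    (hψ : ActsOnBasis q α (π (QOnsager.W _ _ 0)) (π (QOnsager.W _ _ 1)) ψ)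
    (hφ : ActsOnDualBasis q α (π (QOnsager.W _ _ 0)) (π (QOnsager.W _ _ 1)) φ)
    (hπ : IsIrreducibleRep π) : AreOverlapCoefficients ψ φ (discretizedPoly q α) := by
  obtain ⟨π', ψ', φ', hψ', hφ', B, hs, hnd, hBψ, hBφ, hQ⟩ := h.exists_module
  have : FiniteDimensional ℂ U := Module.Basis.finiteDimensional_of_finite ψ
  have : Nontrivial U := hπ.1
  have hS := h.equiv_basis_comm (W := fun i => π (QOnsager.W _ _ i))
    (W' := fun i => π' (QOnsager.W _ _ i)) hψ hψ'
  have hT := h.equiv_dualBasis_comm (W := fun i => π (QOnsager.W _ _ i))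
    (W' := fun i => π' (QOnsager.W _ _ i)) hφ hφ'
  set S := ψ.equiv ψ' (Equiv.refl _) with hSdef
  set T := φ.equiv φ' (Equiv.refl _) with hTdef
  have hSψ : ∀ n, S (ψ n) = ψ' n := fun n => by rw [hSdef, ψ.equiv_apply, Equiv.refl_apply]
  have hTφ : ∀ nt, T (φ nt) = φ' nt := fun nt => by rw [hTdef, φ.equiv_apply, Equiv.refl_apply]
  -- S matches the bases ψ and T the bases φ; both intertwine, so S⁻¹T commutes with the action and
  -- is a scalar.
  obtain ⟨c, hc⟩ := exists_eq_smul_of_commute hπ (T := (T.trans S.symm).toLinearMap) fun i u => by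
    simp only [LinearEquiv.coe_coe, LinearEquiv.trans_apply]
    rw [hT, LinearEquiv.symm_apply_eq, hS, LinearEquiv.apply_symm_apply]
  have hTS : ∀ u, T u = c • S u := by
    intro u
    have := congrArg S (hc u)
    rwa [LinearEquiv.coe_coe, LinearEquiv.trans_apply, LinearEquiv.apply_symm_apply, map_smul] at this
  have hc0 : c ≠ 0 := by
    rintro rfl
    obtain ⟨u, hu⟩ := exists_ne (0 : U)
    have := hTS u
    rw [zero_smul] at this
    exact hu (by simpa using this)
  -- The factor c turns ⟨Sψ, Sφ⟩ into ⟨Sψ, Tφ⟩, the overlap in the model. Since c B'(u, v) = B(Tu,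
  -- Tv), the basis φ stays orthogonal along with ψ.
  let B' : LinearMap.BilinForm ℂ U := c • B.comp S.toLinearMap S.toLinearMap
  have hB' : ∀ u v, B' u v = c * B (S u) (S v) := fun u v => rfl
  have hB'T : ∀ u v, c * B' u v = B (T u) (T v) := fun u v => by
    rw [hB', hTS, hTS, map_smul, map_smul, LinearMap.smul_apply, smul_eq_mul, smul_eq_mul]
  refine ⟨B', ⟨fun u v => ?_⟩, ⟨fun u hu => ?_, fun v hv => ?_⟩, fun n n' hn => ?_,
    fun a b hab => ?_, fun n a => ?_⟩
  · rw [hB', hB', hs.eq]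
  · rw [← S.map_eq_zero_iff]
    refine hnd.1 _ fun w => ?_
    have := hu (S.symm w)
    rw [hB', S.apply_symm_apply] at this
    exact (mul_eq_zero.mp this).resolve_left hc0
  · rw [← S.map_eq_zero_iff]
    refine hnd.2 _ fun w => ?_
    have := hv (S.symm w)
    rw [hB', S.apply_symm_apply] at this
    exact (mul_eq_zero.mp this).resolve_left hc0
  · rw [hB', hSψ, hSψ, hBψ n n' hn, mul_zero]
  · have := hB'T (φ a) (φ b)
    rw [hTφ, hTφ, hBφ a b hab] at this
    exact (mul_eq_zero.mp this).resolve_left hc0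
  · rw [hB', ← smul_eq_mul, ← map_smul, ← hTS, hSψ, hTφ, hQ]

/-- The generators are diagonalizable and act tridiagonally on each other's eigenspaces. -/
theorem isStandardOrdering {U : Type*} [AddCommGroup U] [Module ℂ U] {W₀ W₁ : Module.End ℂ U}
    {φ : Module.Basis (DualGrid m) ℂ U} (hφ : ActsOnDualBasis q α W₀ W₁ φ) :
    IsStandardOrdering W₀ W₁ (∑ i, m i) fun p => theta N q α p.val := by
  have hsum : ∑ i : Fin N, m i.rev = ∑ i, m i := Equiv.sum_comp Fin.revPerm m
  refine (h.actsOnDualBasis_isTridiagonalAction hφ).isStandardOrdering (fun n => ?_) (fun p hp => ?_)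
    h.theta_injective
  · rw [← hsum]
    exact Grid.psum_toNat_le n
  · rw [← hsum] at hp
    exact Grid.exists_psum_eq hp

theorem isStandardOrdering_star {U : Type*} [AddCommGroup U] [Module ℂ U] {W₀ W₁ : Module.End ℂ U}
    {ψ : Module.Basis (Grid m) ℂ U} (hψ : ActsOnBasis q α W₀ W₁ ψ) :
    IsStandardOrdering W₁ W₀ (∑ i, m i) fun p => thetaStar N q α p.val := by
  refine (h.actsOnBasis_isTridiagonalAction hψ).isStandardOrdering Grid.psum_toNat_le
    (fun p hp => Grid.exists_psum_eq hp) ?_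
  have := h.dual.theta_injective
  simpa only [h.theta_dualParam] using this

lemma theta_eq_qRacah : ∃ b c : ℂ, b ≠ 0 ∧ c ≠ 0 ∧ ∀ (d : ℕ) (p : ℕ), theta N q α p =
    0 + b * q ^ (d : ℤ) * q ^ (2 * (p : ℤ) - d) + c * (q ^ (d : ℤ))⁻¹ * q ^ ((d : ℤ) - 2 * p) := by
  have hq := h.q_ne_zero
  have h1 := h.ne_zero 1 (by omega)
  have hN := h.ne_zero (N + 1) (by omega)
  have hN2 := h.ne_zero (N + 2) (by omega)
  refine ⟨1 / 2 * (α (N + 1) * α (N + 2) / α 1), 1 / 2 * (α 1 / (α (N + 1) * α (N + 2))),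
    mul_ne_zero (by norm_num) (div_ne_zero (mul_ne_zero hN hN2) h1),
    mul_ne_zero (by norm_num) (div_ne_zero h1 (mul_ne_zero hN hN2)), fun d p => ?_⟩
  have hd := zpow_ne_zero (d : ℤ) hq
  have hp := zpow_ne_zero (2 * (p : ℤ)) hq
  rw [theta, zpow_sub₀ hq, zpow_sub₀ hq, neg_mul, zpow_neg]
  field_simp
  ring

/-- Irreducible modules with two dual bases are tridiagonal pairs of `q`-Racah type. -/
theorem isTDPairOfQRacahType {U : Type*} [AddCommGroup U] [Module ℂ U] {ρ : ℂ}
    {π : QOnsager q ρ →ₐ[ℂ] Module.End ℂ U}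
    {ψ : Module.Basis (Grid m) ℂ U} {φ : Module.Basis (DualGrid m) ℂ U}
    (hψ : ActsOnBasis q α (π (QOnsager.W _ _ 0)) (π (QOnsager.W _ _ 1)) ψ)
    (hφ : ActsOnDualBasis q α (π (QOnsager.W _ _ 0)) (π (QOnsager.W _ _ 1)) φ)
    (hπ : IsIrreducibleRep π) :
    IsTDPairOfQRacahType q (π (QOnsager.W _ _ 0)) (π (QOnsager.W _ _ 1)) := by
  have hq := h.q_ne_zero
  have ho := h.isStandardOrdering hφ
  have ho' := h.isStandardOrdering_star hψ
  obtain ⟨b, c, hb, hc, hbc⟩ := h.theta_eq_qRacah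
  obtain ⟨bs, cs, hbs, hcs, hbcs⟩ := h.dual.theta_eq_qRacah
  simp only [h.theta_dualParam] at hbcs
  have hd := zpow_ne_zero ((∑ i, m i : ℕ) : ℤ) hq
  refine ⟨⟨Module.Basis.finiteDimensional_of_finite ψ, hπ.1,
    (h.actsOnDualBasis_isTridiagonalAction hφ).isDiagonalizable,
    (h.actsOnBasis_isTridiagonalAction hψ).isDiagonalizable, ⟨_, _, ho⟩, ⟨_, _, ho'⟩,
    fun S h0 h1 => hπ.2 S (mem_of_generators_mem π fun i => ?_)⟩, hq,
    h.not_root_of_unity 2 (by norm_num), fun hq2 => h.not_root_of_unity 4 (by norm_num) ?_,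
    ∑ i, m i, _, _, 0, _, _, 0, _, _, ho, ho', mul_ne_zero hb hd, mul_ne_zero hc (inv_ne_zero hd),
    mul_ne_zero hbs hd, mul_ne_zero hcs (inv_ne_zero hd), fun p => hbc _ p, fun p => hbcs _ p⟩
  · obtain rfl | rfl : i = 0 ∨ i = 1 := by omega
    · exact h0
    · exact h1
  -- q² = -1 would give q⁴ = 1.
  · linear_combination (q ^ 2 - 1) * hq2

end Admissible

end GasperRahman

end

/-! ### Assembly of the theorem -/

open GasperRahman in
theorem mainTheorem5 {N : ℕ} (q : ℂ) (α : ℕ → ℂ) (m : Fin N → ℕ) (h : Admissible q α m) :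
    -- The discretized polynomials solve the difference-difference bispectral problem. The values
    -- outside the grids are arbitrary: both recurrences terminate.
    ((∀ (nt : DualGrid m) (f : (Fin N → ℤ) → ℂ),
        (∀ n : Grid m, f n.toInt = discretizedPoly q α n nt) →
        ∀ n : Grid m, 1 / 2 * Dn q α f n.toInt =
          theta N q α (psum (Grid.toInt nt) N) * discretizedPoly q α n nt) ∧
      (∀ (n : Grid m) (f : (Fin N → ℤ) → ℂ),
        (∀ nt : DualGrid m, f (Grid.toInt nt) = discretizedPoly q α n nt) →
        ∀ nt : DualGrid m, 1 / 2 * DStarNt q α f (Grid.toInt nt) =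
          thetaStar N q α (psum n.toInt N) * discretizedPoly q α n nt)) ∧
    -- There is a module of the `q`-Onsager algebra with two such dual bases, for which the
    -- discretized polynomials are the overlap coefficients.
    (∃ (π : QOnsager q (-(q ^ 2 - q ^ (-2 : ℤ)) ^ 2 / 4) →ₐ[ℂ] Module.End ℂ (Grid m → ℂ))
        (ψ : Module.Basis (Grid m) ℂ (Grid m → ℂ)) (φ : Module.Basis (DualGrid m) ℂ (Grid m → ℂ)),
        ActsOnBasis q α (π (QOnsager.W _ _ 0)) (π (QOnsager.W _ _ 1)) ψ ∧
        ActsOnDualBasis q α (π (QOnsager.W _ _ 0)) (π (QOnsager.W _ _ 1)) φ ∧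
        AreOverlapCoefficients ψ φ (discretizedPoly q α)) ∧
    -- Every module with two dual bases.
    ∀ (U : Type*) [AddCommGroup U] [Module ℂ U]
      (π : QOnsager q (-(q ^ 2 - q ^ (-2 : ℤ)) ^ 2 / 4) →ₐ[ℂ] Module.End ℂ U)
      (ψ : Module.Basis (Grid m) ℂ U) (φ : Module.Basis (DualGrid m) ℂ U),
      ActsOnBasis q α (π (QOnsager.W _ _ 0)) (π (QOnsager.W _ _ 1)) ψ →
      ActsOnDualBasis q α (π (QOnsager.W _ _ 0)) (π (QOnsager.W _ _ 1)) φ →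
      (IsDiagonalizable (π (QOnsager.W _ _ 0)) ∧ IsDiagonalizable (π (QOnsager.W _ _ 1)) ∧
        IsStandardOrdering (π (QOnsager.W _ _ 0)) (π (QOnsager.W _ _ 1)) (∑ i, m i)
          (fun p => theta N q α p.val) ∧
        IsStandardOrdering (π (QOnsager.W _ _ 1)) (π (QOnsager.W _ _ 0)) (∑ i, m i)
          (fun p => thetaStar N q α p.val)) ∧
      (IsIrreducibleRep π →
        IsTDPairOfQRacahType q (π (QOnsager.W _ _ 0)) (π (QOnsager.W _ _ 1)) ∧
        AreOverlapCoefficients ψ φ (discretizedPoly q α)) := by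
  refine ⟨⟨fun nt f hf n => h.Dn_discretizedPoly nt f hf n,
    fun n f hf nt => h.DStarNt_discretizedPoly n f hf nt⟩, h.exists_module, ?_⟩
  intro U _ _ π ψ φ hψ hφ
  exact ⟨⟨(h.actsOnDualBasis_isTridiagonalAction hφ).isDiagonalizable,
    (h.actsOnBasis_isTridiagonalAction hψ).isDiagonalizable, h.isStandardOrdering hφ,
    h.isStandardOrdering_star hψ⟩,
    fun hπ => ⟨h.isTDPairOfQRacahType hψ hφ hπ, h.areOverlapCoefficients hψ hφ hπ⟩⟩
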